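/- Let $M$ be a compact complex manifold of complex dimension $3$, oriented by its complex structure, with a nowhere vanishing holomorphic $3$-form $\Omega^c$, and let $\Omega=\operatorname{Re}\Omega^c$. Suppose that $M$ satisfies the $\partial\bar\partial$-lemma: every smooth exact complex $p$-form $\alpha$ ($p\ge 2$) with $\partial\alpha=0$ and $\bar\partial\alpha=0$ can be written $\alpha=\partial\bar\partial\beta$ for a smooth $(p-2)$-form $\beta$. For a real $3$-form $\rho$ on an oriented real $6$-dimensional vector space $W$, let $K_\rho:W\to W\otimes\Lambda^6W^*$ be defined by $\theta\wedge\iota(v)\rho\wedge\rho=\theta(K_\rho v)$ for all $\theta\in W^*$, $v\in W$, put $\lambda(\rho)=\frac16\operatorname{tr}K_\rho^2\in(\Lambda^6W^*)^2$, and let $\sqrt{|\lambda(\rho)|}\in\Lambda^6W^*$ be the square root in the closure of the orientation class. For real $3$-forms on $M$ let $\Phi(\rho)=\int_M\sqrt{|\lambda(\rho)|}$. On the open set $\lambda(\rho)<0$ in $\Lambda^3W^*$, let $X_\phi$ be the Hamiltonian vector field of $\phi=\sqrt{|\lambda|}$ for the symplectic form $\omega(\rho_1,\rho_2)\epsilon=\rho_1\wedge\rho_2$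 (where $\epsilon\in\Lambda^6W^*$ is a positive volume form trivialising $\Lambda^6W^*$), i.e. $\omega(X_\phi,\cdot)=d\phi$, and let $J=DX_\phi\in\operatorname{End}(\Lambda^3W^*)$ be its derivative at $\rho$; it does not depend on $\epsilon$. Below, $J$ is taken pointwise at $\rho=\Omega$. The tangent space at $\Omega$ to the $\operatorname{Diff}(M)$-orbit is $T=\{\mathcal L_X\Omega : X \text{ a smooth vector field on } M\}$. Then the Hessian of $\Phi$ at $\Omega$ along exact variations is nondegenerate transverse to the $\operatorname{Diff}(M)$-orbit. Precisely: 1. $\Phi$ is $C^2$ near $\Omega$ along finite-dimensional families of exact variations: for all smooth exact real $3$-forms $a_1,\dots,a_n$ the function $t\mapsto\Phi(\Omega+\sum_i t_ia_i)$ on $\mathbf R^n$ is $C^2$ near $t=0$. In particular the Hessian $\delta^2\Phi(a,b)=\frac{\partial^2}{\partial s\,\partial t}\Phi(\Omega+sa+tb)\big|_{s=t=0}$ is defined for smooth exact $a,b$. 2. For a real $3$-form $a$ on $M$: $a$ is the exterior derivative of a smooth real $2$-form and $\delta^2\Phi(a,d\varphi)=0$ for all smooth real $2$-forms $\varphi$,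 if and only if $a\in T$. That is, the null space of the Hessian on exact forms is exactly the tangent space of the orbit. 3. For every smooth real $2$-form $\psi$: $dJd\psi=0$ if and only if $d\psi\in T$. -/

import Mathlib

open scoped Manifold ContDiff

noncomputable section

namespace Hitchin

/-- The model space `ℂ³`, regarded both as a complex and (by restriction of scalars) as a real
normed space. -/
abbrev E : Type := Fin 3 → ℂ

/-- Real `3`-forms on the `6`-dimensional real vector space `E`. -/
abbrev Forms3 : Type := E [⋀^Fin 3]→L[ℝ] ℝ

/-! ### Linear algebra of `3`-forms in six real dimensions -/

/-- The real basis `e₀, i e₀, e₁, i e₁, e₂, i e₂` of `E`; it is positive for the orientation of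
`E` as a complex vector space. -/
def frame : Module.Basis (Fin 6) ℝ E :=
  (Pi.basis fun _ : Fin 3 => Complex.basisOneI).reindex
    ((Equiv.sigmaEquivProd (Fin 3) (Fin 2)).trans finProdFinEquiv)

/-- The exterior product of alternating forms. -/
def wedge {p q : ℕ} (α : E [⋀^Fin p]→ₗ[ℝ] ℝ) (β : E [⋀^Fin q]→ₗ[ℝ] ℝ) :
    E [⋀^Fin (p + q)]→ₗ[ℝ] ℝ :=
  ((LinearMap.mul' ℝ ℝ).compAlternatingMap (α.domCoprod β)).domDomCongr finSumFinEquiv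

/-- The coefficient of a `6`-form with respect to `ε = θ₀ ∧ ⋯ ∧ θ₅`, where `θ` is the basis dual
to `frame`. -/
def coeff (η : E [⋀^Fin 6]→ₗ[ℝ] ℝ) : ℝ := η frame

/-- The matrix, in the basis `frame`, of the endomorphism `K_Ω` of `E` (with `Λ⁶E*` trivialised
by `ε`) which is characterised by `θ ∧ ι(v)Ω ∧ Ω = θ(K_Ω v) ε` for all `v` and all `θ`. -/
def K (Ω : Forms3) : Matrix (Fin 6) (Fin 6) ℝ :=
  Matrix.of fun i j =>
    coeff (wedge (AlternatingMap.ofSubsingleton ℝ E ℝ (0 : Fin 1) (frame.coord i))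
      (wedge (Ω.toAlternatingMap.curryLeft (frame j)) Ω.toAlternatingMap))

/-- `λ(Ω) = tr(K_Ω²) / 6`. -/
def lam (Ω : Forms3) : ℝ := (1 / 6) * (K Ω * K Ω).trace

/-- `φ(Ω) = √|λ(Ω)|`. -/
def phi (Ω : Forms3) : ℝ := √|lam Ω|

/-- The symplectic form on `3`-forms, `ω(Ω₁, Ω₂) ε = Ω₁ ∧ Ω₂`. -/
def symp (Ω₁ Ω₂ : Forms3) : ℝ := coeff (wedge Ω₁.toAlternatingMap Ω₂.toAlternatingMap)

/-- The Hamiltonian vector field `X_φ` of `φ`: the value `X_φ(Ω)` is the unique `3`-form with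
`ω(X_φ(Ω), β) = dφ_Ω(β)` for all `β`. -/
def hamiltonianField (Ω : Forms3) : Forms3 :=
  Classical.epsilon fun X : Forms3 => ∀ β : Forms3, symp X β = fderiv ℝ phi Ω β

/-- `J = D X_φ` at `Ω`, an endomorphism of the space of `3`-forms. -/
def J (Ω : Forms3) : Forms3 →L[ℝ] Forms3 := fderiv ℝ hamiltonianField Ω

theorem continuous_frame_det : Continuous fun v : Fin 6 → E => frame.det v := by
  simp only [Module.Basis.det_apply]
  refine Continuous.matrix_det (continuous_matrix fun i j => ?_)
  simp only [Module.Basis.toMatrix_apply]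
  exact (frame.coord i).continuous_of_finiteDimensional.comp (continuous_apply j)

/-- The volume form `ε = θ₀ ∧ ⋯ ∧ θ₅` on `E`. -/
def volForm : E [⋀^Fin 6]→L[ℝ] ℝ :=
  { frame.det with
    cont := continuous_frame_det }

/-- The component of type `(a, b)` of a complex valued real-alternating `p`-form, `p = a + b`:
the part on which multiplication of all arguments by `z`, `|z| = 1`, acts by `z ^ a * conj z ^ b`.
All the weights `a - b` that occur lie in `[-p, p]`, so averaging over the `(2p+1)`-st roots of
unity separates them. -/
def typePart {p : ℕ} (a b : ℕ) (α : E [⋀^Fin p]→L[ℝ] ℂ) : E [⋀^Fin p]→L[ℝ] ℂ :=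
  ((2 * p + 1 : ℂ))⁻¹ • ∑ k ∈ Finset.range (2 * p + 1),
    (let z : ℂ := Complex.exp (2 * Real.pi * Complex.I * k / (2 * p + 1))
     ((starRingEnd ℂ z) ^ a * z ^ b) •
      α.compContinuousLinearMap (z • ContinuousLinearMap.id ℝ E))

/-! ### Differential forms on a complex threefold -/

section Forms

variable {M : Type*} [TopologicalSpace M] [ChartedSpace E M]
variable {F : Type*} [NormedAddCommGroup F] [NormedSpace ℝ F]

/-- The smooth real manifold underlying a complex manifold. -/
instance realManifold [IsManifold 𝓘(ℂ, E) ω M] : IsManifold 𝓘(ℝ, E) ∞ M := by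
  apply isManifold_of_contDiffOn
  intro e e' he he'
  have h := (contDiffGroupoid ω 𝓘(ℂ, E)).compatible he he'
  rw [contDiffGroupoid, mem_groupoid_of_pregroupoid] at h
  replace h := h.1
  simp only [contDiffPregroupoid, mfld_simps] at h ⊢
  exact (h.restrict_scalars ℝ).of_le le_top

variable (M) in
/-- (Not necessarily smooth) `F`-valued `p`-forms on `M`. -/
abbrev Form (p : ℕ) (F : Type*) [NormedAddCommGroup F] [NormedSpace ℝ F] : Type _ :=
  ∀ x : M, (TangentSpace 𝓘(ℝ, E) x) [⋀^Fin p]→L[ℝ] F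

/-- The expression of a form in the preferred chart at `c`: its pullback under the inverse of
that chart. Only its values on the target of the chart matter. -/
def inChart {p : ℕ} (η : Form M p F) (c : M) (y : E) : E [⋀^Fin p]→L[ℝ] F :=
  (η ((chartAt E c).symm y)).compContinuousLinearMap
    (mfderiv 𝓘(ℝ, E) 𝓘(ℝ, E) (chartAt E c).symm y)

/-- Smoothness of a form, in charts. -/
def IsSmooth {p : ℕ} (η : Form M p F) : Prop :=
  ∀ c : M, ContDiffOn ℝ ∞ (inChart η c) (chartAt E c).target

/-- The exterior derivative, computed at `x` in the preferred chart at `x`. -/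
def d {p : ℕ} (η : Form M p F) : Form M (p + 1) F := fun x =>
  (extDeriv (inChart η x) (chartAt E x x)).compContinuousLinearMap
    (mfderiv 𝓘(ℝ, E) 𝓘(ℝ, E) (chartAt E x) x)

/-- Exact forms (with a smooth primitive). -/
def IsExact {p : ℕ} (η : Form M (p + 1) F) : Prop :=
  ∃ σ : Form M p F, IsSmooth σ ∧ η = d σ

/-- The pointwise projection to forms of type `(a, b)`. The tangent space of `M` at `x` is
identified with `E` by the preferred (holomorphic) chart at `x`, which gives it its complex
structure. -/
def typeProj {p : ℕ} (a b : ℕ) (η : Form M p ℂ) : Form M p ℂ := fun x =>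
  typePart a b (η x : E [⋀^Fin p]→L[ℝ] ℂ)

/-- `∂`: on forms of type `(a, b)` it is the component of type `(a + 1, b)` of `d`. -/
def del {p : ℕ} (η : Form M p ℂ) : Form M (p + 1) ℂ :=
  ∑ ab ∈ Finset.HasAntidiagonal.antidiagonal p, typeProj (ab.1 + 1) ab.2 (d (typeProj ab.1 ab.2 η))

/-- `∂̄`: on forms of type `(a, b)` it is the component of type `(a, b + 1)` of `d`. -/
def delbar {p : ℕ} (η : Form M p ℂ) : Form M (p + 1) ℂ :=
  ∑ ab ∈ Finset.HasAntidiagonal.antidiagonal p, typeProj ab.1 (ab.2 + 1) (d (typeProj ab.1 ab.2 η))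

variable (M) in
/-- The `∂∂̄`-lemma: an exact form `α` of degree `q + 2` with `∂α = 0` and `∂̄α = 0` is `∂∂̄β` for
some form `β` of degree `q`. -/
def DdbarLemma : Prop :=
  ∀ (q : ℕ) (α : Form M (q + 2) ℂ), IsExact α → del α = 0 → delbar α = 0 →
    ∃ β : Form M q ℂ, IsSmooth β ∧ α = del (delbar β)

/-- Holomorphic `p`-forms: forms of type `(p, 0)`, that is `ℂ`-linear in each argument, with
complex analytic coefficients in the (holomorphic) charts. -/
def IsHolomorphicForm {p : ℕ} (η : Form M p ℂ) : Prop :=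
  (∀ (x : M) (v : Fin p → E) (i : Fin p),
    (η x : E [⋀^Fin p]→L[ℝ] ℂ) (Function.update v i (Complex.I • v i)) =
      Complex.I * (η x : E [⋀^Fin p]→L[ℝ] ℂ) v) ∧
  ∀ c : M, AnalyticOnNhd ℂ (inChart η c) (chartAt E c).target

/-- The real part of a complex valued form. -/
def rePart {p : ℕ} (η : Form M p ℂ) : Form M p ℝ := fun x =>
  Complex.reCLM.compContinuousAlternatingMap (η x)

/-- The operator `J` on `3`-forms defined pointwise by the `3`-form `Ω`. (`J` does not depend on
the choice of the positive volume form `ε`.) -/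
def formJ (Ω a : Form M 3 ℝ) : Form M 3 ℝ := fun x => J (Ω x : Forms3) (a x : Forms3)

/-! ### Vector fields and the Lie derivative -/

/-- Smooth vector fields. -/
def IsSmoothField [IsManifold 𝓘(ℂ, E) ω M] (X : ∀ x : M, TangentSpace 𝓘(ℝ, E) x) : Prop :=
  ContMDiff 𝓘(ℝ, E) (𝓘(ℝ, E).tangent) ∞
    fun x => (⟨x, X x⟩ : TangentBundle 𝓘(ℝ, E) M)

/-- The expression of a vector field in the preferred chart at `c`. -/
def fieldInChart (X : ∀ x : M, TangentSpace 𝓘(ℝ, E) x) (c : M) (y : E) : E :=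
  mfderiv 𝓘(ℝ, E) 𝓘(ℝ, E) (chartAt E c) ((chartAt E c).symm y) (X ((chartAt E c).symm y))

/-- The Lie derivative `(𝓛_X η)_x(v₁, …, v_p)`, computed in the preferred chart at `x`:
`(𝓛_X η)(w) = (D_X η)(w) + ∑ᵢ η(w₁, …, D_{wᵢ} X, …, w_p)`. -/
def lieDeriv {p : ℕ} (X : ∀ x : M, TangentSpace 𝓘(ℝ, E) x) (η : Form M p F) (x : M)
    (v : Fin p → TangentSpace 𝓘(ℝ, E) x) : F :=
  let y : E := chartAt E x x
  let w : Fin p → E := fun i => mfderiv 𝓘(ℝ, E) 𝓘(ℝ, E) (chartAt E x) x (v i)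
  fderiv ℝ (inChart η x) y (fieldInChart X x y) w +
    ∑ i, inChart η x y (Function.update w i (fderiv ℝ (fieldInChart X x) y (w i)))

/-- `a` lies in the tangent space at `Ω` of the orbit of `Ω` under the diffeomorphism group, i.e.
it is the Lie derivative of `Ω` along some smooth vector field. -/
def TangentToOrbit [IsManifold 𝓘(ℂ, E) ω M] {p : ℕ} (Ω a : Form M p ℝ) : Prop :=
  ∃ X : ∀ x : M, TangentSpace 𝓘(ℝ, E) x, IsSmoothField X ∧
    ∀ (x : M) (v : Fin p → TangentSpace 𝓘(ℝ, E) x), a x v = lieDeriv X Ω x v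

end Forms

/-! ### Integration and the functional -/

section Functional

variable {M : Type*} [TopologicalSpace M] [CompactSpace M] [T2Space M] [ChartedSpace E M]
  [IsManifold 𝓘(ℂ, E) ω M]

variable (M) in
/-- A chosen smooth partition of unity subordinate to the preferred charts. -/
def partition : SmoothPartitionOfUnity M 𝓘(ℝ, E) M :=
  Classical.choose (SmoothPartitionOfUnity.exists_isSubordinate_chartAt_source 𝓘(ℝ, E) M)

/-- The integral of a `6`-form over the compact manifold `M` with its orientation as a complex
manifold. Lebesgue measure on `E` gives volume `1` to the cube spanned by `frame`. -/
def integral (η : Form M 6 ℝ) : ℝ :=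
  ∑ᶠ c : M, ∫ y in (chartAt E c).target,
    partition M c ((chartAt E c).symm y) * inChart η c y frame

/-- The `6`-form `√|λ(Ω)|` in the orientation class. -/
def phiForm (Ω : Form M 3 ℝ) : Form M 6 ℝ := fun x => phi (Ω x : Forms3) • volForm

/-- The functional `Φ(Ω) = ∫_M √|λ(Ω)|`. -/
def Phi (Ω : Form M 3 ℝ) : ℝ := integral (phiForm Ω)

/-- The Hessian of `Φ` at `Ω`: the second variation
`∂²/∂s∂t Φ(Ω + s a + t b)` at `s = t = 0`. -/
def hessian (Ω a b : Form M 3 ℝ) : ℝ :=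
  deriv (fun s : ℝ => deriv (fun t : ℝ => Phi (Ω + s • a + t • b)) 0) 0

end Functional

end Hitchin

end

noncomputable section

namespace Hitchin

open Equiv MeasureTheory

set_option linter.unusedSectionVars false

/-! Both null spaces, that of the Hessian and that of d J d, are identified with the forms d Re ν
with ν of type (2,0).

The orbit. Ωᶜ is closed, so Cartan's formula gives 𝓛_X Ω = d Re(ι_X Ωᶜ). As Ωᶜ vanishes nowhere,
every smooth (2,0)-form is ι_X Ωᶜ for a smooth real field X (`exists_field_of_ofType`), and every
ι_X Ωᶜ has type (2,0). Hence T = {d Re ν : ν of type (2,0)} (`tangentToOrbit_reForm_iff`).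

The operator J. Under a linear automorphism g the function φ scales by |det g| and ω by det g, so
X_φ commutes with pullback by every g of positive determinant. At ρ₀ = Re(dz₀ ∧ dz₁ ∧ dz₂),
invariance under diagonal matrices of determinant one, together with the values of dφ on the real
and imaginary parts, forces X_φ(ρ₀) = q Im(dz₀ ∧ dz₁ ∧ dz₂) with q a nonzero real number.
Differentiating the equivariance along 1 + tA gives J Re(A·dz₀₁₂) = q Im(A·dz₀₁₂), where dz₀₁₂ = dz₀
∧ dz₁ ∧ dz₂, and the forms A·dz₀₁₂ include all those of type (3,0) and of type (2,1). So J Re γ = q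
Im γ for γ of type (3,0) + (2,1) (`formJ_reForm`); the value of q plays no role.

The kernel of d J d. For ν of type (2,0) this yields J d Re ν = q d Im ν, which is closed.
Conversely, write ψ = Re(μ + χ) with μ of type (2,0) and χ real of type (1,1), and let A be the
(2,1)-part of dχ. Then dψ = Re(dμ + 2A) and J dψ = q Im(dμ + 2A), so d J dψ = 0 and d dψ = 0
together give dA = 0. Hence ∂ and ∂̄ annihilate dχ = A + Ā, the ∂∂̄-lemma gives dχ = ∂∂̄β, and the
right side equals du - dw with u of type (0,2) and w of type (2,0). Thus dψ = d Re(μ + ū - w)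
(`exists_primitive_of_closed`).

The Hessian. Since ω(Ja, b) = D²φ(a, b), the Hessian is the integral of Ja ∧ b over M
(`hessian_eq_pairInt`). By Stokes' theorem and its converse (`pairInt_d_eq_zero`,
`d_eq_zero_of_pairInt`) it vanishes for all exact b exactly when d(Ja) = 0. -/

/-! ### Exterior products of real forms on ℂ³ -/

/-- Each coset of S_p × S_q contributes p! q! equal terms. In this form, identities for `wedge`
follow from termwise manipulation of a sum over all permutations, after cancelling the nonzero
factor. -/
theorem wedge_eq_sum {p q : ℕ} (a : E [⋀^Fin p]→ₗ[ℝ] ℝ) (b : E [⋀^Fin q]→ₗ[ℝ] ℝ)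
    (v : Fin (p + q) → E) :
    ((p.factorial * q.factorial : ℕ) : ℝ) * wedge a b v =
      ∑ σ : Perm (Fin (p + q)), ((Perm.sign σ : ℤ) : ℝ) *
        (a (fun i => v (σ (Fin.castAdd q i))) * b (fun j => v (σ (Fin.natAdd p j)))) := by
  have h := congrArg (fun η : E [⋀^Fin p ⊕ Fin q]→ₗ[ℝ] (TensorProduct ℝ ℝ ℝ) =>
    (LinearMap.mul' ℝ ℝ) (η (fun i => v (finSumFinEquiv i))))
    (MultilinearMap.domCoprod_alternization_eq a b)
  simp only [MultilinearMap.alternatization_apply, AlternatingMap.smul_apply, map_nsmul,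
    Fintype.card_fin, map_sum, MultilinearMap.domDomCongr_apply] at h
  rw [nsmul_eq_mul] at h
  have h2 : wedge a b v = (LinearMap.mul' ℝ ℝ) ((a.domCoprod b) (fun i => v (finSumFinEquiv i))) := rfl
  rw [h2, ← h]
  refine Fintype.sum_equiv (finSumFinEquiv.permCongr) _ _ fun σ => ?_
  rw [Units.smul_def, map_zsmul, zsmul_eq_mul, Equiv.Perm.sign_permCongr]
  simp [Equiv.permCongr_apply, MultilinearMap.domCoprod_apply]

theorem wedge_comp {p q : ℕ} (a : E [⋀^Fin p]→ₗ[ℝ] ℝ) (b : E [⋀^Fin q]→ₗ[ℝ] ℝ) (g : E →ₗ[ℝ] E) :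
    wedge (a.compLinearMap g) (b.compLinearMap g) = (wedge a b).compLinearMap g := by
  ext v
  have h1 := wedge_eq_sum (a.compLinearMap g) (b.compLinearMap g) v
  have h2 := wedge_eq_sum a b (fun i => g (v i))
  have h0 : ((p.factorial * q.factorial : ℕ) : ℝ) ≠ 0 := by positivity
  apply mul_left_cancel₀ h0
  rw [h1]
  exact h2.symm

theorem coeff_comp (η : E [⋀^Fin 6]→ₗ[ℝ] ℝ) (g : E →ₗ[ℝ] E) :
    coeff (η.compLinearMap g) = LinearMap.det g * coeff η := by
  have h := η.eq_smul_basis_det frame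
  unfold coeff
  rw [AlternatingMap.compLinearMap_apply]
  conv_lhs => rw [h]
  have := frame.det_comp g frame
  rw [AlternatingMap.smul_apply, smul_eq_mul]
  simp only [Function.comp_def] at this
  rw [this, frame.det_self]
  ring

theorem wedge_add_left {p q : ℕ} (a a' : E [⋀^Fin p]→ₗ[ℝ] ℝ) (b : E [⋀^Fin q]→ₗ[ℝ] ℝ) :
    wedge (a + a') b = wedge a b + wedge a' b := by
  ext v
  have h0 : ((p.factorial * q.factorial : ℕ) : ℝ) ≠ 0 := by positivity
  apply mul_left_cancel₀ h0
  simp only [AlternatingMap.add_apply, mul_add (_ : ℝ) (wedge a b v), wedge_eq_sum,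
    ← Finset.sum_add_distrib]
  exact Finset.sum_congr rfl fun σ _ => by ring

theorem wedge_smul_left {p q : ℕ} (c : ℝ) (a : E [⋀^Fin p]→ₗ[ℝ] ℝ) (b : E [⋀^Fin q]→ₗ[ℝ] ℝ) :
    wedge (c • a) b = c • wedge a b := by
  ext v
  have h0 : ((p.factorial * q.factorial : ℕ) : ℝ) ≠ 0 := by positivity
  apply mul_left_cancel₀ h0
  simp only [AlternatingMap.smul_apply, smul_eq_mul, mul_left_comm _ c, wedge_eq_sum, Finset.mul_sum,
    mul_assoc]

theorem wedge_add_right {p q : ℕ} (a : E [⋀^Fin p]→ₗ[ℝ] ℝ) (b b' : E [⋀^Fin q]→ₗ[ℝ] ℝ) :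
    wedge a (b + b') = wedge a b + wedge a b' := by
  ext v
  have h0 : ((p.factorial * q.factorial : ℕ) : ℝ) ≠ 0 := by positivity
  apply mul_left_cancel₀ h0
  simp only [AlternatingMap.add_apply, mul_add (_ : ℝ) (wedge a b v), wedge_eq_sum,
    ← Finset.sum_add_distrib]
  exact Finset.sum_congr rfl fun σ _ => by ring

theorem wedge_smul_right {p q : ℕ} (c : ℝ) (a : E [⋀^Fin p]→ₗ[ℝ] ℝ) (b : E [⋀^Fin q]→ₗ[ℝ] ℝ) :
    wedge a (c • b) = c • wedge a b := by
  ext v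
  have h0 : ((p.factorial * q.factorial : ℕ) : ℝ) ≠ 0 := by positivity
  apply mul_left_cancel₀ h0
  simp only [AlternatingMap.smul_apply, smul_eq_mul, mul_left_comm _ c, wedge_eq_sum, Finset.mul_sum]

/-- If `b` vanishes whenever one of its arguments is among the first `p` vectors of `v`, only one
term of the exterior product survives on `v`. -/
theorem wedge_apply_of_vanish {p q : ℕ} (a : E [⋀^Fin p]→ₗ[ℝ] ℝ) (b : E [⋀^Fin q]→ₗ[ℝ] ℝ)
    (v : Fin (p + q) → E)
    (hb : ∀ (w : Fin q → E) (i : Fin p) (j : Fin q), w j = v (Fin.castAdd q i) → b w = 0) :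
    wedge a b v = a (fun i => v (Fin.castAdd q i)) * b (fun j => v (Fin.natAdd p j)) := by
  have h2 : wedge a b v = ∑ σ : Perm.ModSumCongr (Fin p) (Fin q),
    (LinearMap.mul' ℝ ℝ) (AlternatingMap.domCoprod.summand a b σ (fun i => v (finSumFinEquiv i))) := by
    change (LinearMap.mul' ℝ ℝ) ((a.domCoprod b) (fun i => v (finSumFinEquiv i))) = _
    rw [AlternatingMap.domCoprod_apply, sum_apply, map_sum]
  rw [h2]
  refine (Finset.sum_eq_single (QuotientGroup.mk (1 : Perm (Fin p ⊕ Fin q)) :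
    Perm.ModSumCongr (Fin p) (Fin q)) ?_ ?_).trans ?_
  · intro σ _ hσ
    induction σ using Quotient.inductionOn' with | _ σ
    rw [AlternatingMap.domCoprod.summand_mk'']
    by_cases h : ∃ j i, σ (Sum.inr j) = Sum.inl i
    · obtain ⟨j, i, h⟩ := h
      have := hb (fun j => v (finSumFinEquiv (σ (Sum.inr j)))) i j (by simp [h])
      simp [MultilinearMap.domCoprod_apply, this]
    -- A permutation that sends no right index to a left one preserves the two blocks, so it
    -- represents the trivial coset.
    · exfalso
      apply hσ
      push Not at h
      apply Quotient.sound'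
      rw [QuotientGroup.leftRel_apply]
      have : σ ∈ (Perm.sumCongrHom (Fin p) (Fin q)).range := by
        rw [← inv_mem_iff]
        apply Perm.mem_sumCongrHom_range_of_perm_mapsTo_inl
        rintro _ ⟨i, rfl⟩
        rcases h' : σ⁻¹ (Sum.inl i) with k | k
        · exact ⟨k, rfl⟩
        · exfalso; apply h k i; rw [← h']; simp
      simpa using this
  · simp
  · change (LinearMap.mul' ℝ ℝ) (AlternatingMap.domCoprod.summand a b (Quotient.mk'' 1) _) = _
    rw [AlternatingMap.domCoprod.summand_mk'']
    simp [MultilinearMap.domCoprod_apply]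


theorem coeff_wedge_three_three (a b : E [⋀^Fin 3]→ₗ[ℝ] ℝ) :
    36 * coeff (wedge a b) = ∑ σ : Perm (Fin 6), ((Perm.sign σ : ℤ) : ℝ) *
      (a ![frame (σ 0), frame (σ 1), frame (σ 2)] * b ![frame (σ 3), frame (σ 4), frame (σ 5)]) := by
  have h := wedge_eq_sum a b frame
  have h0 : (((Nat.factorial 3 * Nat.factorial 3 : ℕ) : ℝ)) = 36 := by norm_num [Nat.factorial]
  rw [h0] at h
  refine h.trans (Finset.sum_congr rfl fun σ _ => ?_)
  congr 3 <;> exact funext fun i => by fin_cases i <;> rfl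

theorem coeff_wedge_four_two (a : E [⋀^Fin 4]→ₗ[ℝ] ℝ) (b : E [⋀^Fin 2]→ₗ[ℝ] ℝ) :
    48 * coeff (wedge a b) = ∑ σ : Perm (Fin 6), ((Perm.sign σ : ℤ) : ℝ) *
      (a ![frame (σ 0), frame (σ 1), frame (σ 2), frame (σ 3)] * b ![frame (σ 4), frame (σ 5)]) := by
  have h := wedge_eq_sum a b frame
  have h0 : (((Nat.factorial 4 * Nat.factorial 2 : ℕ) : ℝ)) = 48 := by norm_num [Nat.factorial]
  rw [h0] at h
  refine h.trans (Finset.sum_congr rfl fun σ _ => ?_)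
  congr 3 <;> exact funext fun i => by fin_cases i <;> rfl

theorem sum_sign_mul_comp (f : Perm (Fin 6) → ℝ) (τ : Perm (Fin 6)) :
    ∑ σ : Perm (Fin 6), ((Perm.sign σ : ℤ) : ℝ) * f (σ * τ) =
      ((Perm.sign τ : ℤ) : ℝ) * ∑ σ : Perm (Fin 6), ((Perm.sign σ : ℤ) : ℝ) * f σ := by
  rw [Finset.mul_sum]
  refine Fintype.sum_equiv (Equiv.mulRight τ) _ _ fun σ => ?_
  rw [Equiv.coe_mulRight, Perm.sign_mul, ← mul_assoc]
  congr 1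
  rcases Int.units_eq_one_or (Perm.sign τ) with h | h <;> simp [h]

theorem coeff_wedge_comm (a b : E [⋀^Fin 3]→ₗ[ℝ] ℝ) :
    coeff (wedge a b) = - coeff (wedge b a) := by
  have h0 : (36 : ℝ) ≠ 0 := by norm_num
  apply mul_left_cancel₀ h0
  -- Exchanging the two blocks of three is a product of three disjoint transpositions, hence odd.
  let τ : Perm (Fin 6) := ⟨![3,4,5,0,1,2], ![3,4,5,0,1,2], by decide, by decide⟩
  have hτ : Perm.sign τ = -1 := by decide +kernel
  have h := sum_sign_mul_comp (fun σ => b ![frame (σ 0), frame (σ 1), frame (σ 2)] *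
    a ![frame (σ 3), frame (σ 4), frame (σ 5)]) τ
  rw [mul_neg, coeff_wedge_three_three, coeff_wedge_three_three, ← neg_one_mul]
  rw [hτ] at h
  simp only [Units.val_neg, Units.val_one, Int.cast_neg, Int.cast_one] at h
  rw [← h]
  exact Finset.sum_congr rfl fun σ _ => by rw [mul_comm (a _)]; rfl

/-- The sum `∑ⱼ L(eⱼ) ∧ (θⱼ ∧ b)` in terms of the alternatization of `L`. -/
theorem sum_coeff_wedge_alternatize (L : E →ₗ[ℝ] E [⋀^Fin 3]→ₗ[ℝ] ℝ) (b : E [⋀^Fin 2]→ₗ[ℝ] ℝ) :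
    ∑ j, coeff (wedge (L (frame j))
      (AlternatingMap.alternatizeUncurryFin ((frame.coord j).smulRight b))) =
    - coeff (wedge (AlternatingMap.alternatizeUncurryFin L) b) := by
  -- Both sides are multiples of the one signed sum S of F. The alternatization of L has four terms
  -- and that of θⱼ ⊗ b has three; each gives S up to sign once a cycle moves the argument of L to
  -- the front. The two sides are compared as 4S/48 and -3S/36.
  let F : Perm (Fin 6) → ℝ := fun σ => L (frame (σ 0)) ![frame (σ 1), frame (σ 2), frame (σ 3)] *
    b ![frame (σ 4), frame (σ 5)]
  set S : ℝ := ∑ σ : Perm (Fin 6), ((Perm.sign σ : ℤ) : ℝ) * F σ with hS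
  have key : ∀ τ : Perm (Fin 6), ∑ σ : Perm (Fin 6), ((Perm.sign σ : ℤ) : ℝ) * F (σ * τ) =
      ((Perm.sign τ : ℤ) : ℝ) * S := fun τ => sum_sign_mul_comp F τ
  have h1 : 48 * coeff (wedge (AlternatingMap.alternatizeUncurryFin L) b) = 4 * S := by
    rw [coeff_wedge_four_two]
    let τ1 : Perm (Fin 6) := ⟨![1,0,2,3,4,5], ![1,0,2,3,4,5], by decide, by decide⟩
    let τ2 : Perm (Fin 6) := ⟨![2,0,1,3,4,5], ![1,2,0,3,4,5], by decide, by decide⟩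
    let τ3 : Perm (Fin 6) := ⟨![3,0,1,2,4,5], ![1,2,3,0,4,5], by decide, by decide⟩
    have k1 := key τ1
    have k2 := key τ2
    have k3 := key τ3
    rw [show Perm.sign τ1 = -1 by decide +kernel] at k1
    rw [show Perm.sign τ2 = 1 by decide +kernel] at k2
    rw [show Perm.sign τ3 = -1 by decide +kernel] at k3
    have : (4 : ℝ) * S = S - ∑ σ : Perm (Fin 6), ((Perm.sign σ : ℤ) : ℝ) * F (σ * τ1)
        + ∑ σ : Perm (Fin 6), ((Perm.sign σ : ℤ) : ℝ) * F (σ * τ2)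
        - ∑ σ : Perm (Fin 6), ((Perm.sign σ : ℤ) : ℝ) * F (σ * τ3) := by
      rw [k1, k2, k3]; push_cast; ring
    rw [this, hS, ← Finset.sum_sub_distrib, ← Finset.sum_add_distrib,
      ← Finset.sum_sub_distrib]
    refine Finset.sum_congr rfl fun σ _ => ?_
    rw [AlternatingMap.alternatizeUncurryFin_apply, Fin.sum_univ_four]
    have e0 : Fin.removeNth (α := fun _ => E) 0 ![frame (σ 0), frame (σ 1), frame (σ 2), frame (σ 3)] =
      ![frame (σ 1), frame (σ 2), frame (σ 3)] := funext fun i => by fin_cases i <;> rfl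
    have e1 : Fin.removeNth (α := fun _ => E) 1 ![frame (σ 0), frame (σ 1), frame (σ 2), frame (σ 3)] =
      ![frame (σ 0), frame (σ 2), frame (σ 3)] := funext fun i => by fin_cases i <;> rfl
    have e2 : Fin.removeNth (α := fun _ => E) 2 ![frame (σ 0), frame (σ 1), frame (σ 2), frame (σ 3)] =
      ![frame (σ 0), frame (σ 1), frame (σ 3)] := funext fun i => by fin_cases i <;> rfl
    have e3 : Fin.removeNth (α := fun _ => E) 3 ![frame (σ 0), frame (σ 1), frame (σ 2), frame (σ 3)] =
      ![frame (σ 0), frame (σ 1), frame (σ 2)] := funext fun i => by fin_cases i <;> rfl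
    rw [e0, e1, e2, e3]
    have f1 : F (σ * τ1) = L (frame (σ 1)) ![frame (σ 0), frame (σ 2), frame (σ 3)] *
      b ![frame (σ 4), frame (σ 5)] := rfl
    have f2 : F (σ * τ2) = L (frame (σ 2)) ![frame (σ 0), frame (σ 1), frame (σ 3)] *
      b ![frame (σ 4), frame (σ 5)] := rfl
    have f3 : F (σ * τ3) = L (frame (σ 3)) ![frame (σ 0), frame (σ 1), frame (σ 2)] *
      b ![frame (σ 4), frame (σ 5)] := rfl
    rw [f1, f2, f3]
    simp [F]
    ring
  have h2 : 36 * ∑ j, coeff (wedge (L (frame j))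
      (AlternatingMap.alternatizeUncurryFin ((frame.coord j).smulRight b))) = - 3 * S := by
    rw [Finset.mul_sum]
    simp_rw [coeff_wedge_three_three]
    rw [Finset.sum_comm]
    let τ1 : Perm (Fin 6) := ⟨![3,0,1,2,4,5], ![1,2,3,0,4,5], by decide, by decide⟩
    let τ2 : Perm (Fin 6) := ⟨![4,0,1,2,3,5], ![1,2,3,4,0,5], by decide, by decide⟩
    let τ3 : Perm (Fin 6) := ⟨![5,0,1,2,3,4], ![1,2,3,4,5,0], by decide, by decide⟩
    have k1 := key τ1
    have k2 := key τ2
    have k3 := key τ3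
    rw [show Perm.sign τ1 = -1 by decide +kernel] at k1
    rw [show Perm.sign τ2 = 1 by decide +kernel] at k2
    rw [show Perm.sign τ3 = -1 by decide +kernel] at k3
    have : - (3 : ℝ) * S = ∑ σ : Perm (Fin 6), ((Perm.sign σ : ℤ) : ℝ) * F (σ * τ1)
        - ∑ σ : Perm (Fin 6), ((Perm.sign σ : ℤ) : ℝ) * F (σ * τ2)
        + ∑ σ : Perm (Fin 6), ((Perm.sign σ : ℤ) : ℝ) * F (σ * τ3) := by
      rw [k1, k2, k3]; push_cast; ring
    rw [this, ← Finset.sum_sub_distrib, ← Finset.sum_add_distrib]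
    refine Finset.sum_congr rfl fun σ _ => ?_
    have e0 : Fin.removeNth (α := fun _ => E) 0 ![frame (σ 3), frame (σ 4), frame (σ 5)] =
      ![frame (σ 4), frame (σ 5)] := funext fun i => by fin_cases i <;> rfl
    have e1 : Fin.removeNth (α := fun _ => E) 1 ![frame (σ 3), frame (σ 4), frame (σ 5)] =
      ![frame (σ 3), frame (σ 5)] := funext fun i => by fin_cases i <;> rfl
    have e2 : Fin.removeNth (α := fun _ => E) 2 ![frame (σ 3), frame (σ 4), frame (σ 5)] =
      ![frame (σ 3), frame (σ 4)] := funext fun i => by fin_cases i <;> rfl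
    have f1 : F (σ * τ1) = L (frame (σ 3)) ![frame (σ 0), frame (σ 1), frame (σ 2)] *
      b ![frame (σ 4), frame (σ 5)] := rfl
    have f2 : F (σ * τ2) = L (frame (σ 4)) ![frame (σ 0), frame (σ 1), frame (σ 2)] *
      b ![frame (σ 3), frame (σ 5)] := rfl
    have f3 : F (σ * τ3) = L (frame (σ 5)) ![frame (σ 0), frame (σ 1), frame (σ 2)] *
      b ![frame (σ 3), frame (σ 4)] := rfl
    rw [f1, f2, f3, ← Finset.mul_sum, ← mul_sub, ← mul_add]
    congr 1
    have hw : ∀ j, AlternatingMap.alternatizeUncurryFin ((frame.coord j).smulRight b)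
        ![frame (σ 3), frame (σ 4), frame (σ 5)] =
        frame.coord j (frame (σ 3)) * b ![frame (σ 4), frame (σ 5)]
        - frame.coord j (frame (σ 4)) * b ![frame (σ 3), frame (σ 5)]
        + frame.coord j (frame (σ 5)) * b ![frame (σ 3), frame (σ 4)] := fun j => by
      rw [AlternatingMap.alternatizeUncurryFin_apply, Fin.sum_univ_three, e0, e1, e2]
      simp [-Module.Basis.coord_apply]
      ring
    simp only [hw]
    have hc : ∀ i, (∑ j, L (frame j) ![frame (σ 0), frame (σ 1), frame (σ 2)] *
        frame.coord j (frame (σ i))) = L (frame (σ i)) ![frame (σ 0), frame (σ 1), frame (σ 2)] := by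
      intro i
      rw [Finset.sum_eq_single (σ i)]
      · simp
      · intro j _ hj
        simp [hj.symm]
      · simp
    rw [← hc 3, ← hc 4, ← hc 5, Finset.sum_mul, Finset.sum_mul, Finset.sum_mul,
      ← Finset.sum_sub_distrib, ← Finset.sum_add_distrib]
    refine Finset.sum_congr rfl fun j _ => ?_
    ring
  linarith

/-- To read off the value of a on basis vectors chosen by an injective s, take for b the determinant
in the complementary coordinates: on the basis reordered so that the range of s comes first, only
one term of the product survives. -/
theorem eq_zero_of_wedge_eq_zero {p q : ℕ} (hpq : p + q = 6) (a : E [⋀^Fin p]→ₗ[ℝ] ℝ)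
    (h : ∀ b : E [⋀^Fin q]→ₗ[ℝ] ℝ, wedge a b = 0) : a = 0 := by
  refine Module.Basis.ext_alternating frame fun s hs => ?_
  have hcard : Fintype.card (Fin q) = Fintype.card ↥(Set.range s)ᶜ := by
    rw [Fintype.card_compl_set, Set.card_range_of_injective hs]
    simp only [Fintype.card_fin]
    omega
  let e : Fin q ≃ ↥(Set.range s)ᶜ := Fintype.equivOfCardEq hcard
  let t : Fin (p + q) ≃ Fin 6 := finSumFinEquiv.symm.trans
    ((Equiv.sumCongr (Equiv.ofInjective s hs) e).trans (Equiv.Set.sumCompl (Set.range s)))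
  have ht : ∀ i, t (Fin.castAdd q i) = s i := fun i => by
    simp [t]
  let v := frame.reindex t.symm
  let f : E →ₗ[ℝ] (Fin q → ℝ) := LinearMap.pi fun i => v.coord (Fin.natAdd p i)
  let b : E [⋀^Fin q]→ₗ[ℝ] ℝ := (Matrix.detRowAlternating (R := ℝ) (n := Fin q)).compLinearMap f
  have hb1 : ∀ i, f (v (Fin.castAdd q i)) = 0 := fun i => by
    funext j
    simp only [f, LinearMap.pi_apply, Module.Basis.coord_apply, Module.Basis.repr_self,
      Pi.zero_apply]
    rw [Finsupp.single_apply, if_neg]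
    intro h'
    have := congrArg Fin.val h'
    simp at this
    omega
  have hb2 : b (fun j => v (Fin.natAdd p j)) = 1 := by
    have : (fun j => f (v (Fin.natAdd p j))) = (1 : Matrix (Fin q) (Fin q) ℝ) := by
      funext j i
      simp [f, Finsupp.single_apply, Matrix.one_apply]
    change Matrix.det (fun j => f (v (Fin.natAdd p j))) = 1
    rw [this, Matrix.det_one]
  have key := wedge_apply_of_vanish a b v fun w i j hw => by
    have : f (w j) = 0 := by rw [hw]; exact hb1 i
    exact (Matrix.detRowAlternating (R := ℝ) (n := Fin q)).map_coord_zero j this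
  rw [h b, hb2, mul_one] at key
  have hv : (fun i => v (Fin.castAdd q i)) = fun i => frame (s i) := funext fun i => by
    simp only [v, Module.Basis.reindex_apply, Equiv.symm_symm, ht]
  rw [hv] at key
  simpa using key.symm

theorem eq_zero_of_coeff_eq_zero (η : E [⋀^Fin 6]→ₗ[ℝ] ℝ) (h : coeff η = 0) : η = 0 := by
  have := η.eq_smul_basis_det frame
  unfold coeff at h
  rw [this, h, zero_smul]

/-- The holomorphic volume form `dz₀ ∧ dz₁ ∧ dz₂`. -/
def stdForm : E [⋀^Fin 3]→L[ℝ] ℂ :=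
  ContinuousAlternatingMap.restrictScalars ℝ
    { (Matrix.detRowAlternating : E [⋀^Fin 3]→ₗ[ℂ] ℂ) with
      cont := Continuous.matrix_det (A := fun v : Fin 3 → E => (v : Matrix (Fin 3) (Fin 3) ℂ))
        continuous_id }

theorem stdForm_apply (v : Fin 3 → E) : stdForm v = Matrix.det (v : Matrix (Fin 3) (Fin 3) ℂ) := rfl

/-- The real part of the holomorphic volume form. -/
def reStd : Forms3 := Complex.reCLM.compContinuousAlternatingMap stdForm

/-! ### The endomorphism K in coordinates, and λ at the standard form -/

/-- A permutation of six indices splits into the image k of 0 and a permutation of the other five;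
the 5! choices of the latter contribute equally because b is alternating. -/
theorem coeff_wedge_one_five (a : E →ₗ[ℝ] ℝ) (b : E [⋀^Fin 5]→ₗ[ℝ] ℝ) :
    coeff (wedge (AlternatingMap.ofSubsingleton ℝ E ℝ (0 : Fin 1) a) b) =
      ∑ k : Fin 6, ((Perm.sign (swap 0 k) : ℤ) : ℝ) *
        (a (frame k) * b (fun j : Fin 5 => frame (swap 0 k j.succ))) := by
  have h0 : (((Nat.factorial 1 * Nat.factorial 5 : ℕ) : ℝ)) = 120 := by norm_num [Nat.factorial]
  have h := wedge_eq_sum (AlternatingMap.ofSubsingleton ℝ E ℝ (0 : Fin 1) a) b frame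
  rw [h0] at h
  apply mul_left_cancel₀ (show (120 : ℝ) ≠ 0 by norm_num)
  refine h.trans ?_
  refine (Fintype.sum_equiv (Perm.decomposeFin (n := 5)) _
    (fun kτ : Fin 6 × Perm (Fin 5) => ((Perm.sign (swap 0 kτ.1) : ℤ) : ℝ) *
      (a (frame kτ.1) * b (fun j : Fin 5 => frame (swap 0 kτ.1 j.succ)))) fun σ => ?_).trans ?_
  · obtain ⟨⟨k, τ⟩, rfl⟩ := (Perm.decomposeFin (n := 5)).symm.surjective σ
    have e1 : (Perm.decomposeFin.symm (k, τ)) (Fin.castAdd 5 (0 : Fin 1)) = k :=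
      Perm.decomposeFin_symm_apply_zero k τ
    have e2 : ∀ j : Fin 5, (Perm.decomposeFin.symm (k, τ)) (Fin.natAdd 1 j) = swap 0 k (τ j).succ := by
      intro j
      rw [← Perm.decomposeFin_symm_apply_succ]
      congr 1
      ext; simp [add_comm]
    have e3 : b (fun j : Fin 5 => frame (swap 0 k (τ j).succ)) =
      ((Perm.sign τ : ℤ) : ℝ) * b (fun j : Fin 5 => frame (swap 0 k j.succ)) := by
      have := b.map_perm (fun j : Fin 5 => frame (swap 0 k j.succ)) τ
      rw [Units.smul_def, zsmul_eq_mul] at this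
      exact this
    simp only [AlternatingMap.ofSubsingleton_apply_apply, Equiv.apply_symm_apply]
    have e4 : ((Perm.sign (Perm.decomposeFin.symm (k, τ)) : ℤ) : ℝ) =
        ((Perm.sign (swap 0 k) : ℤ) : ℝ) * ((Perm.sign τ : ℤ) : ℝ) := by
      rw [Perm.decomposeFin.symm_sign]
      split_ifs with hk
      · subst hk; simp
      · rw [Perm.sign_swap (Ne.symm hk)]; push_cast; ring
    have e5 : ((Perm.sign τ : ℤ) : ℝ) * ((Perm.sign τ : ℤ) : ℝ) = 1 := by
      rcases Int.units_eq_one_or (Perm.sign τ) with h | h <;> simp [h]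
    have e6 : (fun j : Fin 5 => frame ((Perm.decomposeFin.symm (k, τ)) (Fin.natAdd 1 j))) =
      fun j : Fin 5 => frame (swap 0 k (τ j).succ) := funext fun j => by rw [e2]
    erw [e1, e6, e3]
    erw [e4]
    linear_combination (((Perm.sign (swap 0 k) : ℤ) : ℝ) *
        (a (frame k) * b (fun j : Fin 5 => frame (swap 0 k j.succ)))) * e5
  · rw [Fintype.sum_prod_type, Finset.mul_sum]
    refine Finset.sum_congr rfl fun k _ => ?_
    simp [Fintype.card_perm, Nat.factorial]

theorem wedge_two_three_apply (a : E [⋀^Fin 2]→ₗ[ℝ] ℝ) (b : E [⋀^Fin 3]→ₗ[ℝ] ℝ) (v : Fin 5 → E) :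
    12 * wedge a b v = ∑ τ : Perm (Fin 5), ((Perm.sign τ : ℤ) : ℝ) *
      (a ![v (τ 0), v (τ 1)] * b ![v (τ 2), v (τ 3), v (τ 4)]) := by
  have h := wedge_eq_sum a b v
  have h0 : (((Nat.factorial 2 * Nat.factorial 3 : ℕ) : ℝ)) = 12 := by norm_num [Nat.factorial]
  rw [h0] at h
  refine h.trans (Finset.sum_congr rfl fun σ _ => ?_)
  congr 3 <;> exact funext fun i => by fin_cases i <;> rfl

/-- The coordinate form annihilates every term but k = i of the expansion of a 1-form against a
5-form. The entries of K become explicit quadratic polynomials in the values of Ω, from which come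
the smoothness of λ and its evaluation at the standard form. -/
theorem K_apply (Ω : Forms3) (i j : Fin 6) :
    12 * K Ω i j = ((Perm.sign (swap 0 i) : ℤ) : ℝ) * ∑ τ : Perm (Fin 5), ((Perm.sign τ : ℤ) : ℝ) *
      (Ω ![frame j, frame (swap 0 i (τ 0).succ), frame (swap 0 i (τ 1).succ)] *
       Ω ![frame (swap 0 i (τ 2).succ), frame (swap 0 i (τ 3).succ), frame (swap 0 i (τ 4).succ)]) := by
  have h0 : (((Nat.factorial 2 * Nat.factorial 3 : ℕ) : ℝ)) = 12 := by norm_num [Nat.factorial]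
  let η : E [⋀^Fin 5]→ₗ[ℝ] ℝ := wedge (Ω.toAlternatingMap.curryLeft (frame j)) Ω.toAlternatingMap
  have hK : K Ω i j = coeff (wedge (AlternatingMap.ofSubsingleton ℝ E ℝ (0 : Fin 1) (frame.coord i)) η) := by
    rw [K, Matrix.of_apply]
  have h1 : K Ω i j = ((Perm.sign (swap 0 i) : ℤ) : ℝ) * η (fun j : Fin 5 => frame (swap 0 i j.succ)) := by
    rw [hK, coeff_wedge_one_five, Finset.sum_eq_single i]
    · simp
    · intro k _ hk
      simp [hk]
    · simp
  have h2 := wedge_two_three_apply (Ω.toAlternatingMap.curryLeft (frame j)) Ω.toAlternatingMap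
        (fun j : Fin 5 => frame (swap 0 i j.succ))
  have h3 : ∀ v w : E, ![frame j, v, w] = Matrix.vecCons (frame j) ![v, w] := fun v w => rfl
  simp only [h3]
  rw [h1, mul_left_comm]
  congr 1
/-- The values of `reStd` on the vectors of `frame`. -/
def reStdTable (a b c : Fin 6) : ℤ :=
  let eps : ℤ := ((b / 2 : ℕ) - (a / 2 : ℕ) : ℤ) * ((c / 2 : ℕ) - (a / 2 : ℕ)) * ((c / 2 : ℕ) - (b / 2 : ℕ))
  eps * (if (a % 2 + b % 2 + c % 2 : ℕ) = 0 then 1 else if (a % 2 + b % 2 + c % 2 : ℕ) = 2 then -1 else 0)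

/-- Twelve times `K` at `reStd`, in integers, computed from twice `reStd`. -/
def stdTable (i j : Fin 6) : ℤ := Perm.sign (swap 0 i) * ∑ τ : Perm (Fin 5), (Perm.sign τ : ℤ) *
      (reStdTable j (swap 0 i (τ 0).succ) (swap 0 i (τ 1).succ) *
       reStdTable (swap 0 i (τ 2).succ) (swap 0 i (τ 3).succ) (swap 0 i (τ 4).succ))

set_option maxRecDepth 100000 in
-- The only numerical computation. It shows that λ does not vanish at Re(dz₀ ∧ dz₁ ∧ dz₂), and
-- therefore that φ is smooth and nonzero there; the sign of λ is never used.
theorem sum_stdTable : ∑ i, ∑ j, stdTable i j * stdTable j i ≠ 0 := by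
  decide +kernel


theorem frame_apply (a : Fin 6) :
    frame a = Pi.single (⟨a / 2, by omega⟩ : Fin 3) (if (a % 2 : ℕ) = 0 then (1 : ℂ) else Complex.I) := by
  obtain ⟨⟨l, t⟩, rfl⟩ := (finProdFinEquiv (m := 3) (n := 2)).surjective a
  have h : frame (finProdFinEquiv (l, t)) = Pi.single l (Complex.basisOneI t) := by
    simp [frame, Pi.basis_apply]
  rw [h]
  fin_cases l <;> fin_cases t <;> simp <;> rfl

theorem reStd_frame (a b c : Fin 6) :
    2 * reStd ![frame a, frame b, frame c] = (reStdTable a b c : ℝ) := by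
  -- The Vandermonde product of (l, m, n) is twice the sign of the arrangement and zero when an
  -- index repeats; hence the factor 2.
  have h : ∀ (l m n : Fin 3) (x y z : ℂ), 2 * stdForm ![Pi.single l x, Pi.single m y, Pi.single n z] =
      (((m : ℤ) - (l : ℤ)) * ((n : ℤ) - (l : ℤ)) * ((n : ℤ) - (m : ℤ)) : ℤ) * (x * y * z) := by
    intro l m n x y z
    rw [stdForm_apply]
    erw [Matrix.det_fin_three]
    fin_cases l <;> fin_cases m <;> fin_cases n <;> simp
  have h2 : 2 * reStd ![frame a, frame b, frame c] =
    (2 * stdForm ![frame a, frame b, frame c]).re := by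
    rw [show ((2 : ℂ) * stdForm ![frame a, frame b, frame c]).re =
      2 * (stdForm ![frame a, frame b, frame c]).re by simp]
    rfl
  rw [h2, frame_apply, frame_apply, frame_apply, h, reStdTable]
  rw [← Complex.ofReal_intCast, Complex.re_ofReal_mul]
  push_cast
  congr 1
  have := Nat.mod_two_eq_zero_or_one a
  have := Nat.mod_two_eq_zero_or_one b
  have := Nat.mod_two_eq_zero_or_one c
  rcases Nat.mod_two_eq_zero_or_one a with ha | ha <;> rcases Nat.mod_two_eq_zero_or_one b with hb | hb <;>
    rcases Nat.mod_two_eq_zero_or_one c with hc | hc <;> simp [ha, hb, hc]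

theorem lam_reStd_ne_zero : lam reStd ≠ 0 := by
  -- Both values of the form in a term of `K_apply` are half a table entry, and K carries a factor
  -- 12: 12 · 4 = 48.
  have hK : ∀ i j, K reStd i j = (stdTable i j : ℝ) / 48 := by
    intro i j
    have h := K_apply reStd i j
    have h2 : ∀ a b c, reStd ![frame a, frame b, frame c] = (reStdTable a b c : ℝ) / 2 := fun a b c => by
      rw [← reStd_frame]; ring
    simp only [h2] at h
    rw [stdTable]
    push_cast
    have e : ∀ x : ℝ, 12 * K reStd i j = x / 4 → K reStd i j = x / 48 := fun x hx => by linarith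
    apply e
    rw [h, mul_div_assoc, Finset.sum_div]
    congr 1
    exact Finset.sum_congr rfl fun τ _ => by ring
  have h := sum_stdTable
  unfold lam
  rw [Matrix.trace]
  simp only [Matrix.diag_apply, Matrix.mul_apply, hK]
  have e : ∑ i, ∑ j, (stdTable i j : ℝ) / 48 * ((stdTable j i : ℝ) / 48) =
      ((∑ i, ∑ j, stdTable i j * stdTable j i : ℤ) : ℝ) / (48 * 48) := by
    push_cast
    rw [Finset.sum_div]
    refine Finset.sum_congr rfl fun i _ => ?_
    rw [Finset.sum_div]
    exact Finset.sum_congr rfl fun j _ => by ring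
  rw [e]
  generalize (∑ i, ∑ j, stdTable i j * stdTable j i : ℤ) = N at h
  exact mul_ne_zero (by norm_num) (div_ne_zero (Int.cast_ne_zero.2 h) (by norm_num))

/-! ### Behaviour of λ and φ under linear maps -/

/-- The real determinant of a complex linear map is the squared modulus of its complex determinant.
This is why holomorphic coordinate changes preserve the orientation. -/
theorem det_pos_of_complexLinear (g : E →L[ℂ] E) (hg : Function.Injective g) :
    0 < LinearMap.det ((g.restrictScalars ℝ : E →L[ℝ] E) : E →ₗ[ℝ] E) := by
  have h : LinearMap.det ((g.restrictScalars ℝ : E →L[ℝ] E) : E →ₗ[ℝ] E) =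
      LinearMap.det ((g : E →ₗ[ℂ] E).restrictScalars ℝ) := rfl
  rw [h, LinearMap.det_restrictScalars, Algebra.norm_complex_apply]
  apply Complex.normSq_pos.2
  intro h0
  have hb := LinearMap.bot_lt_ker_of_det_eq_zero h0
  rw [LinearMap.ker_eq_bot.2 hg] at hb
  exact lt_irrefl _ hb

instance finiteDimensional_forms {p : ℕ} {F : Type*} [NormedAddCommGroup F] [NormedSpace ℝ F]
    [FiniteDimensional ℝ F] : FiniteDimensional ℝ (E [⋀^Fin p]→L[ℝ] F) := by
  let f : (E [⋀^Fin p]→L[ℝ] F) →ₗ[ℝ] MultilinearMap ℝ (fun _ : Fin p => E) F :=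
    { toFun := fun a => a.toAlternatingMap.toMultilinearMap
      map_add' := fun _ _ => rfl
      map_smul' := fun _ _ => rfl }
  refine FiniteDimensional.of_injective f fun a b h => ?_
  ext v
  exact congrArg (fun m : MultilinearMap ℝ (fun _ : Fin p => E) F => m v) h

theorem coeff_add (a b : E [⋀^Fin 6]→ₗ[ℝ] ℝ) : coeff (a + b) = coeff a + coeff b := rfl

theorem coeff_smul (c : ℝ) (a : E [⋀^Fin 6]→ₗ[ℝ] ℝ) : coeff (c • a) = c * coeff a := rfl

/-- The pairing `θ ↦ v ↦ θ ∧ ι(v)Ω ∧ Ω` defining `K`. -/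
def pairK (Ω : Forms3) (θ : E →ₗ[ℝ] ℝ) (v : E) : ℝ :=
  coeff (wedge (AlternatingMap.ofSubsingleton ℝ E ℝ (0 : Fin 1) θ)
    (wedge (Ω.toAlternatingMap.curryLeft v) Ω.toAlternatingMap))

theorem pairK_eq_sum (Ω : Forms3) (θ : E →ₗ[ℝ] ℝ) (v : E) :
    pairK Ω θ v = ∑ k, θ (frame k) * pairK Ω (frame.coord k) v := by
  let η : E [⋀^Fin 5]→ₗ[ℝ] ℝ := wedge (Ω.toAlternatingMap.curryLeft v) Ω.toAlternatingMap
  have h : ∀ θ : E →ₗ[ℝ] ℝ, pairK Ω θ v = ∑ k : Fin 6, ((Perm.sign (swap 0 k) : ℤ) : ℝ) *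
        (θ (frame k) * η (fun j : Fin 5 => frame (swap 0 k j.succ))) := fun θ =>
    coeff_wedge_one_five θ η
  rw [h]
  refine Finset.sum_congr rfl fun k _ => ?_
  rw [h, Finset.sum_eq_single k]
  · simp; ring
  · intro j _ hj
    simp [hj]
  · simp

/-- `K` as an endomorphism. -/
def endK (Ω : Forms3) : E →ₗ[ℝ] E where
  toFun v := ∑ k, pairK Ω (frame.coord k) v • frame k
  map_add' v w := by
    have h : ∀ θ, pairK Ω θ (v + w) = pairK Ω θ v + pairK Ω θ w := fun θ => by
      rw [pairK, map_add, wedge_add_left, wedge_add_right]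
      exact coeff_add _ _
    rw [← Finset.sum_add_distrib]
    refine Finset.sum_congr rfl fun k _ => ?_
    rw [← add_smul, h]
  map_smul' c v := by
    have h : ∀ θ, pairK Ω θ (c • v) = c * pairK Ω θ v := fun θ => by
      rw [pairK, map_smul, wedge_smul_left, wedge_smul_right]
      exact coeff_smul _ _
    rw [RingHom.id_apply, Finset.smul_sum]
    refine Finset.sum_congr rfl fun k _ => ?_
    rw [smul_smul, h]

theorem apply_endK (Ω : Forms3) (θ : E →ₗ[ℝ] ℝ) (v : E) : θ (endK Ω v) = pairK Ω θ v := by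
  rw [pairK_eq_sum]
  simp only [endK, LinearMap.coe_mk, AddHom.coe_mk, map_sum, map_smul, smul_eq_mul]
  exact Finset.sum_congr rfl fun k _ => mul_comm _ _

theorem toMatrix_endK (Ω : Forms3) : LinearMap.toMatrix frame frame (endK Ω) = K Ω := by
  ext i j
  rw [LinearMap.toMatrix_apply, ← Module.Basis.coord_apply, apply_endK, K, Matrix.of_apply, pairK]

theorem lam_eq_trace (Ω : Forms3) : lam Ω = (1 / 6) * LinearMap.trace ℝ E (endK Ω ∘ₗ endK Ω) := by
  rw [lam, LinearMap.trace_eq_matrix_trace ℝ frame, LinearMap.toMatrix_comp frame frame frame,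
    toMatrix_endK]

theorem pairK_comp (Ω : Forms3) (g : E →L[ℝ] E) (θ : E →ₗ[ℝ] ℝ) (v : E) :
    pairK (Ω.compContinuousLinearMap g) (θ ∘ₗ g) v = LinearMap.det (g : E →ₗ[ℝ] E) * pairK Ω θ (g v) := by
  have e1 : AlternatingMap.ofSubsingleton ℝ E ℝ (0 : Fin 1) (θ ∘ₗ (g : E →ₗ[ℝ] E)) =
    (AlternatingMap.ofSubsingleton ℝ E ℝ (0 : Fin 1) θ).compLinearMap (g : E →ₗ[ℝ] E) := by
    ext v; rfl
  have e2 : (Ω.compContinuousLinearMap g).toAlternatingMap =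
    Ω.toAlternatingMap.compLinearMap (g : E →ₗ[ℝ] E) := rfl
  have e3 : (Ω.toAlternatingMap.compLinearMap (g : E →ₗ[ℝ] E)).curryLeft v =
      (Ω.toAlternatingMap.curryLeft (g v)).compLinearMap (g : E →ₗ[ℝ] E) := by
    ext w
    simp only [AlternatingMap.curryLeft_apply_apply, AlternatingMap.compLinearMap_apply]
    congr 1
    funext i
    refine Fin.cases ?_ (fun j => ?_) i <;> simp
  unfold pairK
  rw [e1, e2, e3, wedge_comp, wedge_comp]
  exact coeff_comp _ _

/-- By naturality of the defining pairing, the endomorphism of the pulled back form is det g · g⁻¹ K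
g, and the trace of its square does not see the conjugation. -/
theorem lam_comp (Ω : Forms3) (g : E ≃L[ℝ] E) :
    lam (Ω.compContinuousLinearMap (g : E →L[ℝ] E)) =
      (LinearMap.det ((g : E →L[ℝ] E) : E →ₗ[ℝ] E)) ^ 2 * lam Ω := by
  set c := LinearMap.det ((g : E →L[ℝ] E) : E →ₗ[ℝ] E)
  have h : endK (Ω.compContinuousLinearMap (g : E →L[ℝ] E)) =
      c • (g.symm.toLinearEquiv.conj (endK Ω)) := by
    refine LinearMap.ext fun v => ?_
    apply g.injective
    rw [← sub_eq_zero]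
    apply (Module.forall_dual_apply_eq_zero_iff ℝ _).1
    intro θ
    rw [map_sub, sub_eq_zero]
    have h1 := apply_endK (Ω.compContinuousLinearMap (g : E →L[ℝ] E)) (θ ∘ₗ (g : E →L[ℝ] E)) v
    rw [pairK_comp, ← apply_endK] at h1
    refine Eq.trans h1 ?_
    simp [c, LinearEquiv.conj_apply]
  rw [lam_eq_trace, lam_eq_trace, h, LinearMap.smul_comp, LinearMap.comp_smul, smul_smul, map_smul,
    ← LinearEquiv.conj_comp, LinearMap.trace_conj', smul_eq_mul]
  ring

theorem phi_comp (Ω : Forms3) (g : E ≃L[ℝ] E) :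
    phi (Ω.compContinuousLinearMap (g : E →L[ℝ] E)) =
      |LinearMap.det ((g : E →L[ℝ] E) : E →ₗ[ℝ] E)| * phi Ω := by
  rw [phi, phi, lam_comp, abs_mul, abs_pow, Real.sqrt_mul (by positivity), Real.sqrt_sq (abs_nonneg _)]

theorem K_smul (t : ℝ) (Ω : Forms3) : K (t • Ω) = t ^ 2 • K Ω := by
  ext i j
  have h1 := K_apply (t • Ω) i j
  have h2 := K_apply Ω i j
  apply mul_left_cancel₀ (show (12 : ℝ) ≠ 0 by norm_num)
  rw [h1, Matrix.smul_apply, smul_eq_mul, mul_left_comm, h2]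
  simp only [ContinuousAlternatingMap.smul_apply, smul_eq_mul, Finset.mul_sum]
  exact Finset.sum_congr rfl fun τ _ => by ring

/-- K is quadratic in the form, so λ is quartic and its square root quadratic. Euler's identity for
φ will follow from this. -/
theorem phi_smul (t : ℝ) (Ω : Forms3) : phi (t • Ω) = t ^ 2 * phi Ω := by
  have h : lam (t • Ω) = (t ^ 2) ^ 2 * lam Ω := by
    have e : (t ^ 2 • K Ω) * (t ^ 2 • K Ω) = (t ^ 2 * t ^ 2) • (K Ω * K Ω) := by
      rw [Matrix.smul_mul, Matrix.mul_smul, smul_smul]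
    rw [lam, lam, K_smul, e, Matrix.trace_smul, smul_eq_mul]
    ring
  rw [phi, phi, h, abs_mul, abs_pow, Real.sqrt_mul (by positivity), Real.sqrt_sq (abs_nonneg _),
    abs_of_nonneg (by positivity)]

theorem contDiff_lam : ContDiff ℝ ∞ lam := by
  have hev : ∀ v : Fin 3 → E, ContDiff ℝ ∞ fun Ω : Forms3 => Ω v := fun v =>
    (ContinuousAlternatingMap.apply ℝ E ℝ v).contDiff
  have hK : ∀ i j, ContDiff ℝ ∞ fun Ω => K Ω i j := by
    intro i j
    have h : (fun Ω => K Ω i j) = fun Ω => ((Perm.sign (swap 0 i) : ℤ) : ℝ) *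
      (∑ τ : Perm (Fin 5), ((Perm.sign τ : ℤ) : ℝ) *
      (Ω ![frame j, frame (swap 0 i (τ 0).succ), frame (swap 0 i (τ 1).succ)] *
       Ω ![frame (swap 0 i (τ 2).succ), frame (swap 0 i (τ 3).succ), frame (swap 0 i (τ 4).succ)])) / 12 := by
      funext Ω
      rw [← K_apply]
      ring
    rw [h]
    refine (contDiff_const.mul (ContDiff.sum fun τ _ => ?_)).div_const _
    exact contDiff_const.mul ((hev _).mul (hev _))
  unfold lam
  simp only [Matrix.trace, Matrix.diag_apply, Matrix.mul_apply]
  exact contDiff_const.mul (ContDiff.sum fun i _ => ContDiff.sum fun j _ => (hK i j).mul (hK j i))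

theorem contDiffAt_phi {Ω : Forms3} (h : lam Ω ≠ 0) : ContDiffAt ℝ ∞ phi Ω := by
  have h1 : ContDiffAt ℝ ∞ (fun x : ℝ => √|x|) (lam Ω) :=
    (contDiffAt_abs h).sqrt (abs_ne_zero.2 h)
  exact h1.comp Ω contDiff_lam.contDiffAt

/-! ### The symplectic form -/

theorem symp_add_left (a a' b : Forms3) : symp (a + a') b = symp a b + symp a' b := by
  rw [symp, ContinuousAlternatingMap.toAlternatingMap_add, wedge_add_left]
  exact coeff_add _ _

theorem symp_smul_left (c : ℝ) (a b : Forms3) : symp (c • a) b = c * symp a b := by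
  rw [symp, ContinuousAlternatingMap.toAlternatingMap_smul, wedge_smul_left]
  exact coeff_smul _ _

theorem symp_comm (a b : Forms3) : symp a b = - symp b a := coeff_wedge_comm _ _

theorem symp_comp (a b : Forms3) (g : E →L[ℝ] E) :
    symp (a.compContinuousLinearMap g) (b.compContinuousLinearMap g) =
      LinearMap.det (g : E →ₗ[ℝ] E) * symp a b := by
  have e : ∀ a : Forms3, (a.compContinuousLinearMap g).toAlternatingMap =
    a.toAlternatingMap.compLinearMap (g : E →ₗ[ℝ] E) := fun _ => rfl
  rw [symp, e, e, wedge_comp]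
  exact coeff_comp _ _

/-- A linear alternating map on `E`, as a continuous one. -/
def toContinuousForm {p : ℕ} (a : E [⋀^Fin p]→ₗ[ℝ] ℝ) : E [⋀^Fin p]→L[ℝ] ℝ :=
  { a with
    cont := by
      have h : a.toFun = fun v => ∑ s : Fin p → Fin 6,
          (∏ i, frame.coord (s i) (v i)) * a (fun i => frame (s i)) := by
        funext v
        have hv : v = fun i => ∑ k, frame.coord k (v i) • frame k := funext fun i =>
          (frame.sum_repr (v i)).symm
        conv_lhs => rw [hv]
        change a.toMultilinearMap _ = _
        rw [MultilinearMap.map_sum]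
        exact Finset.sum_congr rfl fun s _ => MultilinearMap.map_smul_univ _ _ _
      rw [h]
      refine continuous_finsetSum _ fun s _ => Continuous.mul (continuous_finsetProd _ fun i _ => ?_)
        continuous_const
      exact (LinearMap.continuous_of_finiteDimensional (frame.coord (s i))).comp (continuous_apply i) }

theorem symp_add_right (a b c : Forms3) : symp a (b + c) = symp a b + symp a c := by
  rw [symp_comm, symp_add_left, symp_comm b, symp_comm c]
  ring

theorem symp_smul_right (c : ℝ) (a b : Forms3) : symp a (c • b) = c * symp a b := by
  rw [symp_comm, symp_smul_left, symp_comm b]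
  ring

theorem exists_bilinear_of_finiteDimensional {V W : Type*} [NormedAddCommGroup V] [NormedSpace ℝ V]
    [FiniteDimensional ℝ V] [NormedAddCommGroup W] [NormedSpace ℝ W] [FiniteDimensional ℝ W]
    (f : V → W → ℝ) (h1 : ∀ a a' b, f (a + a') b = f a b + f a' b) (h2 : ∀ (c : ℝ) a b, f (c • a) b = c * f a b)
    (h3 : ∀ a b b', f a (b + b') = f a b + f a b') (h4 : ∀ (c : ℝ) a b, f a (c • b) = c * f a b) :
    ∃ B : V →L[ℝ] W →L[ℝ] ℝ, ∀ a b, B a b = f a b :=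
  ⟨LinearMap.toContinuousBilinearMap (LinearMap.mk₂ ℝ f h1 h2 h3 h4), fun _ _ => rfl⟩

theorem exists_sympL : ∃ B : Forms3 →L[ℝ] Forms3 →L[ℝ] ℝ, ∀ a b, B a b = symp a b :=
  exists_bilinear_of_finiteDimensional symp symp_add_left symp_smul_left symp_add_right symp_smul_right

/-- The symplectic form as a bilinear map. -/
def sympL : Forms3 →L[ℝ] Forms3 →L[ℝ] ℝ := Classical.choose exists_sympL

@[simp] theorem sympL_apply (a b : Forms3) : sympL a b = symp a b := Classical.choose_spec exists_sympL a b

theorem symp_nondegenerate (a : Forms3) (h : ∀ b, symp a b = 0) : a = 0 := by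
  apply ContinuousAlternatingMap.toAlternatingMap_injective
  refine eq_zero_of_wedge_eq_zero (p := 3) (q := 3) rfl _ fun b => ?_
  have h1 : coeff (wedge a.toAlternatingMap b) = 0 := h (toContinuousForm b)
  exact eq_zero_of_coeff_eq_zero _ h1

theorem exists_equiv_dual_of_injective {V : Type*} [NormedAddCommGroup V] [NormedSpace ℝ V]
    [FiniteDimensional ℝ V] (B : V →L[ℝ] V →L[ℝ] ℝ) (hB : ∀ a, B a = 0 → a = 0) :
    ∃ e : V ≃L[ℝ] (V →L[ℝ] ℝ), ∀ a, e a = B a := by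
  have hf : Module.finrank ℝ V = Module.finrank ℝ (V →L[ℝ] ℝ) := by
    rw [← (LinearMap.toContinuousLinearMap (𝕜 := ℝ) (E := V) (F' := ℝ)).finrank_eq]
    exact Subspace.dual_finrank_eq.symm
  have hi : Function.Injective (B : V →ₗ[ℝ] (V →L[ℝ] ℝ)) :=
    LinearMap.ker_eq_bot.1 ((LinearMap.ker_eq_bot').2 hB)
  exact ⟨(LinearMap.linearEquivOfInjective (B : V →ₗ[ℝ] (V →L[ℝ] ℝ)) hi hf).toContinuousLinearEquiv,
    fun a => rfl⟩

theorem exists_sympEquiv : ∃ e : Forms3 ≃L[ℝ] (Forms3 →L[ℝ] ℝ), ∀ a, e a = sympL a :=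
  exists_equiv_dual_of_injective sympL fun a h => symp_nondegenerate a fun b => by
    rw [← sympL_apply, h, zero_apply]

/-- The symplectic form identifies `3`-forms with their dual. -/
def sympEquiv : Forms3 ≃L[ℝ] (Forms3 →L[ℝ] ℝ) := Classical.choose exists_sympEquiv

theorem sympEquiv_apply (a b : Forms3) : sympEquiv a b = symp a b := by
  rw [← sympL_apply, sympEquiv, Classical.choose_spec exists_sympEquiv]

/-- Nondegeneracy of ω provides a solution, so the choice in `hamiltonianField` is a genuine one at
every Ω, including those where φ is not differentiable and `fderiv` is zero by convention. -/
theorem hamiltonianField_spec (Ω β : Forms3) :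
    symp (hamiltonianField Ω) β = fderiv ℝ phi Ω β := by
  have h : ∃ X : Forms3, ∀ β : Forms3, symp X β = fderiv ℝ phi Ω β :=
    ⟨sympEquiv.symm (fderiv ℝ phi Ω), fun β => by rw [← sympEquiv_apply, sympEquiv.apply_symm_apply]⟩
  exact Classical.epsilon_spec h β

theorem hamiltonianField_eq : hamiltonianField = fun Ω => sympEquiv.symm (fderiv ℝ phi Ω) := by
  funext Ω
  apply sympEquiv.injective
  ext β
  rw [sympEquiv_apply, hamiltonianField_spec, sympEquiv.apply_symm_apply]

theorem contDiffAt_hamiltonianField {Ω : Forms3} (h : lam Ω ≠ 0) :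
    ContDiffAt ℝ ∞ hamiltonianField Ω := by
  rw [hamiltonianField_eq]
  exact sympEquiv.symm.contDiff.contDiffAt.comp Ω ((contDiffAt_phi h).fderiv_right (m := ∞) le_rfl)

theorem contDiffAt_J {Ω : Forms3} (h : lam Ω ≠ 0) : ContDiffAt ℝ ∞ J Ω :=
  (contDiffAt_hamiltonianField h).fderiv_right (m := ∞) le_rfl

/-- Differentiating ω(X_φ, b) = dφ(b) identifies J with the second derivative of φ through ω. -/
theorem symp_J {Ω : Forms3} (h : lam Ω ≠ 0) (a b : Forms3) :
    symp (J Ω a) b = fderiv ℝ (fderiv ℝ phi) Ω a b := by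
  have h1 : HasFDerivAt hamiltonianField (J Ω) Ω :=
    ((contDiffAt_hamiltonianField h).differentiableAt (by simp)).hasFDerivAt
  have h2 : HasFDerivAt (fderiv ℝ phi) (fderiv ℝ (fderiv ℝ phi) Ω) Ω :=
    (((contDiffAt_phi h).fderiv_right (m := ∞) le_rfl).differentiableAt (by simp)).hasFDerivAt
  have h3 : HasFDerivAt (fun Ω => sympL (hamiltonianField Ω) b) ((sympL.flip b).comp (J Ω)) Ω :=
    (sympL.flip b).hasFDerivAt.comp Ω h1
  have h4 := h2.clm_apply (hasFDerivAt_const b Ω)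
  have h5 : (fun Ω => sympL (hamiltonianField Ω) b) = fun Ω => fderiv ℝ phi Ω b :=
    funext fun Ω => by rw [sympL_apply, hamiltonianField_spec]
  rw [h5] at h3
  have h6 := congrArg (fun f : Forms3 →L[ℝ] ℝ => f a) (h3.unique h4)
  rw [← sympL_apply]
  simpa using h6

/-- The pullback of `3`-forms under a linear automorphism. -/
def pullE (g : E ≃L[ℝ] E) : Forms3 ≃L[ℝ] Forms3 := g.symm.continuousAlternatingMapCongrLeft

theorem pullE_apply (g : E ≃L[ℝ] E) (Ω : Forms3) :
    pullE g Ω = Ω.compContinuousLinearMap (g : E →L[ℝ] E) := rfl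

theorem fderiv_phi_pullE (g : E ≃L[ℝ] E) (Ω β : Forms3) :
    fderiv ℝ phi (pullE g Ω) (pullE g β) =
      |LinearMap.det ((g : E →L[ℝ] E) : E →ₗ[ℝ] E)| * fderiv ℝ phi Ω β := by
  have h1 : fderiv ℝ (phi ∘ pullE g) Ω = (fderiv ℝ phi (pullE g Ω)).comp (pullE g : Forms3 →L[ℝ] Forms3) :=
    (pullE g).comp_right_fderiv
  have h2 : phi ∘ pullE g = fun Ω => |LinearMap.det ((g : E →L[ℝ] E) : E →ₗ[ℝ] E)| • phi Ω :=
    funext fun Ω => phi_comp Ω g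
  rw [h2] at h1
  have h3 : fderiv ℝ (fun Ω => |LinearMap.det ((g : E →L[ℝ] E) : E →ₗ[ℝ] E)| • phi Ω) Ω =
      |LinearMap.det ((g : E →L[ℝ] E) : E →ₗ[ℝ] E)| • fderiv ℝ phi Ω :=
    congrFun (fderiv_const_smul_field (𝕜 := ℝ) (f := phi) |LinearMap.det ((g : E →L[ℝ] E) : E →ₗ[ℝ] E)|) Ω
  rw [h3] at h1
  exact (congrArg (fun f : Forms3 →L[ℝ] ℝ => f β) h1).symm

/-- Pullback multiplies dφ by |det g| and ω by det g. The two factors cancel exactly when the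
determinant is positive. -/
theorem hamiltonianField_pullE (g : E ≃L[ℝ] E) (hg : 0 < LinearMap.det ((g : E →L[ℝ] E) : E →ₗ[ℝ] E))
    (Ω : Forms3) : hamiltonianField (pullE g Ω) = pullE g (hamiltonianField Ω) := by
  apply sympEquiv.injective
  ext β
  obtain ⟨β, rfl⟩ := (pullE g).surjective β
  rw [sympEquiv_apply, sympEquiv_apply, hamiltonianField_spec, fderiv_phi_pullE, pullE_apply,
    pullE_apply, symp_comp, hamiltonianField_spec, abs_of_pos hg]

theorem J_pullE (g : E ≃L[ℝ] E) (hg : 0 < LinearMap.det ((g : E →L[ℝ] E) : E →ₗ[ℝ] E))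
    (Ω a : Forms3) : J (pullE g Ω) (pullE g a) = pullE g (J Ω a) := by
  have h1 : fderiv ℝ (hamiltonianField ∘ pullE g) Ω =
    (fderiv ℝ hamiltonianField (pullE g Ω)).comp (pullE g : Forms3 →L[ℝ] Forms3) :=
    (pullE g).comp_right_fderiv
  have h2 : fderiv ℝ (pullE g ∘ hamiltonianField) Ω =
    (pullE g : Forms3 →L[ℝ] Forms3).comp (fderiv ℝ hamiltonianField Ω) := (pullE g).comp_fderiv
  have h3 : hamiltonianField ∘ pullE g = pullE g ∘ hamiltonianField :=
    funext fun Ω => hamiltonianField_pullE g hg Ω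
  rw [h3, h2] at h1
  exact (congrArg (fun f : Forms3 →L[ℝ] Forms3 => f a) h1).symm

/-! ### The Hamiltonian vector field at the standard form -/

/-- The imaginary part of the holomorphic volume form. -/
def imStd : Forms3 := Complex.imCLM.compContinuousAlternatingMap stdForm

/-- The diagonal automorphism of `E` with nonzero entries `z`. -/
def diagE (z : Fin 3 → ℂ) (hz : ∀ i, z i ≠ 0) : E ≃L[ℂ] E :=
  ContinuousLinearEquiv.piCongrRight fun i => ContinuousLinearEquiv.smulLeft (Units.mk0 (z i) (hz i))

theorem diagE_apply (z : Fin 3 → ℂ) (hz : ∀ i, z i ≠ 0) (v : E) : diagE z hz v = z * v := rfl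

theorem det_diagE (z : Fin 3 → ℂ) (hz : ∀ i, z i ≠ 0) :
    LinearMap.det ((((diagE z hz).restrictScalars ℝ : E ≃L[ℝ] E) : E →L[ℝ] E) : E →ₗ[ℝ] E) =
      Complex.normSq (∏ i, z i) := by
  have h : ((((diagE z hz).restrictScalars ℝ : E ≃L[ℝ] E) : E →L[ℝ] E) : E →ₗ[ℝ] E) =
      (Matrix.toLin' (Matrix.diagonal z)).restrictScalars ℝ := by
    refine LinearMap.ext fun v => ?_
    change diagE z hz v = Matrix.toLin' (Matrix.diagonal z) v
    rw [diagE_apply, Matrix.toLin'_apply]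
    funext i
    rw [Matrix.mulVec_diagonal]
    rfl
  rw [h, LinearMap.det_restrictScalars, LinearMap.det_toLin', Matrix.det_diagonal,
    Algebra.norm_complex_apply]

theorem stdForm_diagE (z : Fin 3 → ℂ) (hz : ∀ i, z i ≠ 0) (v : Fin 3 → E) :
    stdForm (fun i => diagE z hz (v i)) = (∏ i, z i) * stdForm v :=
  Matrix.det_mul_row z v

theorem pullE_diagE_re (w : ℂ) (z : Fin 3 → ℂ) (hz : ∀ i, z i ≠ 0) :
    pullE ((diagE z hz).restrictScalars ℝ) (Complex.reCLM.compContinuousAlternatingMap (w • stdForm)) =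
      Complex.reCLM.compContinuousAlternatingMap ((w * ∏ i, z i) • stdForm) := by
  ext v
  change (w * stdForm (fun i => diagE z hz (v i))).re = _
  rw [stdForm_diagE, ← mul_assoc]
  rfl

/-- For w ≠ 0, diag(w, 1, 1) pulls the volume form back to w times itself and has real determinant
|w|². The case w = 0 is covered by homogeneity. -/
theorem phi_re_smul_stdForm (w : ℂ) :
    phi (Complex.reCLM.compContinuousAlternatingMap (w • stdForm)) = Complex.normSq w * phi reStd := by
  by_cases hw : w = 0
  · subst hw
    have : Complex.reCLM.compContinuousAlternatingMap ((0 : ℂ) • stdForm) = (0 : ℝ) • reStd := by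
      ext v; simp
    rw [this, phi_smul]; simp
  have hz : ∀ i, (![w, 1, 1] : Fin 3 → ℂ) i ≠ 0 := by
    intro i; fin_cases i <;> simp [hw]
  have hp : ∏ i, (![w, 1, 1] : Fin 3 → ℂ) i = w := by simp [Fin.prod_univ_three]
  have h := pullE_diagE_re 1 ![w, 1, 1] hz
  rw [hp, one_mul, one_smul] at h
  have h2 := phi_comp reStd ((diagE ![w, 1, 1] hz).restrictScalars ℝ)
  rw [det_diagE, hp, abs_of_nonneg (Complex.normSq_nonneg _)] at h2
  rw [← h, ← h2]
  rfl


theorem map_vec_swap_left {F : Type*} [NormedAddCommGroup F] [NormedSpace ℝ F]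
    (Y : E [⋀^Fin 3]→L[ℝ] F) (u v w : E) : Y ![v, u, w] = - Y ![u, v, w] := by
  rw [← Y.coe_toAlternatingMap, ← Y.toAlternatingMap.map_swap ![u, v, w] (show (0 : Fin 3) ≠ 1 by decide)]
  congr 1
  funext i
  fin_cases i <;> rfl

theorem map_vec_swap_right {F : Type*} [NormedAddCommGroup F] [NormedSpace ℝ F]
    (Y : E [⋀^Fin 3]→L[ℝ] F) (u v w : E) : Y ![u, w, v] = - Y ![u, v, w] := by
  rw [← Y.coe_toAlternatingMap, ← Y.toAlternatingMap.map_swap ![u, v, w] (show (1 : Fin 3) ≠ 2 by decide)]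
  congr 1
  funext i
  fin_cases i <;> rfl

theorem map_vec_smul {F : Type*} [NormedAddCommGroup F] [NormedSpace ℝ F]
    (Y : E [⋀^Fin 3]→L[ℝ] F) (a b c : ℝ) (u v w : E) :
    Y ![a • u, b • v, c • w] = (a * b * c) • Y ![u, v, w] := by
  have := Y.toMultilinearMap.map_smul_univ ![a, b, c] ![u, v, w]
  simp only [Fin.prod_univ_three] at this
  refine Eq.trans ?_ this
  change Y _ = Y _
  congr 1
  funext i
  fin_cases i <;> rfl

/-- A real `3`-form that is invariant under the diagonal matrices of determinant one and vanishes on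
two suitable triples of basis vectors is zero. -/
theorem eq_zero_of_diagE_invariant (Y : Forms3)
    (hY : ∀ (z : Fin 3 → ℂ), (∏ i, z i = 1) → ∀ v : Fin 3 → E, Y (fun i => z * v i) = Y v)
    (h0 : Y ![Pi.single 0 1, Pi.single 1 1, Pi.single 2 1] = 0)
    (h1 : Y ![Pi.single 0 Complex.I, Pi.single 1 1, Pi.single 2 1] = 0) : Y = 0 := by
  have hs : ∀ (z : Fin 3 → ℂ) (l : Fin 3) (x : ℂ),
      z * (Pi.single l x : E) = Pi.single l (z l * x) := fun z l x => by
    funext i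
    rw [Pi.mul_apply]
    by_cases h : i = l
    · subst h; simp
    · simp [h]
  have key : ∀ (z : Fin 3 → ℂ), (∏ i, z i = 1) → ∀ (l m n : Fin 3) (x y w : ℂ),
      Y ![Pi.single l x, Pi.single m y, Pi.single n w] =
      Y ![Pi.single l (z l * x), Pi.single m (z m * y), Pi.single n (z n * w)] := by
    intro z hz l m n x y w
    rw [← hY z hz, ← hs, ← hs, ← hs]
    congr 1
    funext i
    fin_cases i <;> rfl
  -- The real matrices with 1 in place k and -1 elsewhere have determinant one. If such a matrix
  -- multiplies a triple of arguments by -1 in total, the value of Y there equals its own negative.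
  let s : Fin 3 → Fin 3 → ℤ := fun k l => if l = k then 1 else -1
  have hsign : ∀ (k l m n : Fin 3), s k l * s k m * s k n = -1 → ∀ (x y w : ℂ),
      Y ![Pi.single l x, Pi.single m y, Pi.single n w] = 0 := by
    intro k l m n hk x y w
    have h := key (fun l => ((s k l : ℝ) : ℂ)) (by
      fin_cases k <;> simp [s, Fin.prod_univ_three]) l m n x y w
    have hsm : ∀ (l : Fin 3) (a : ℝ) (x : ℂ), (Pi.single l ((a : ℂ) * x) : E) = a • Pi.single l x := by
      intro l a x
      rw [← Pi.single_smul, Complex.real_smul]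
    rw [hsm, hsm, hsm, map_vec_smul] at h
    have hk' : (s k l : ℝ) * s k m * s k n = -1 := by exact_mod_cast hk
    rw [hk', neg_one_smul] at h
    linarith
  -- Every triple with a repeated index is killed by one of these signs; only permutations of (0, 1,
  -- 2) remain.
  have hne : ∀ l m n : Fin 3, (∃ k, s k l * s k m * s k n = -1) ∨ (l ≠ m ∧ m ≠ n ∧ l ≠ n) := by decide
  -- The matrices diag(i, -i, 1) and diag(i, 1, -i) move a factor i from one slot to another, so all
  -- remaining values reduce, up to sign, to the two assumed to vanish.
  have m1 : ∀ x y w : ℂ, Y ![Pi.single 0 (Complex.I * x), Pi.single 1 y, Pi.single 2 w] =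
      Y ![Pi.single 0 x, Pi.single 1 (Complex.I * y), Pi.single 2 w] := by
    intro x y w
    rw [key ![Complex.I, -Complex.I, 1] (by simp [Fin.prod_univ_three]) 0 1 2 x (Complex.I * y) w]
    simp [← mul_assoc]
  have m2 : ∀ x y w : ℂ, Y ![Pi.single 0 (Complex.I * x), Pi.single 1 y, Pi.single 2 w] =
      Y ![Pi.single 0 x, Pi.single 1 y, Pi.single 2 (Complex.I * w)] := by
    intro x y w
    rw [key ![Complex.I, 1, -Complex.I] (by simp [Fin.prod_univ_three]) 0 1 2 x y (Complex.I * w)]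
    simp [← mul_assoc]
  have m0 : ∀ x y w : ℂ, Y ![Pi.single 0 (Complex.I * (Complex.I * x)), Pi.single 1 y, Pi.single 2 w] =
      - Y ![Pi.single 0 x, Pi.single 1 y, Pi.single 2 w] := by
    intro x y w
    have := map_vec_smul Y (-1) 1 1 (Pi.single 0 x) (Pi.single 1 y) (Pi.single 2 w)
    rw [← mul_assoc, Complex.I_mul_I, neg_one_mul, Pi.single_neg]
    simpa using this
  have hstd : ∀ x y w : ℂ, (x = 1 ∨ x = Complex.I) → (y = 1 ∨ y = Complex.I) → (w = 1 ∨ w = Complex.I) →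
      Y ![Pi.single 0 x, Pi.single 1 y, Pi.single 2 w] = 0 := by
    have hI : Complex.I = Complex.I * 1 := (mul_one _).symm
    have h1' : Y ![Pi.single 0 (Complex.I * 1), Pi.single 1 1, Pi.single 2 1] = 0 := by rwa [mul_one]
    have h2' : Y ![Pi.single 0 (Complex.I * (Complex.I * 1)), Pi.single 1 1, Pi.single 2 1] = 0 := by
      rw [m0, h0, neg_zero]
    have h3' : Y ![Pi.single 0 (Complex.I * (Complex.I * (Complex.I * 1))), Pi.single 1 1, Pi.single 2 1] = 0 := by
      rw [m0, h1', neg_zero]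
    rintro x y w (rfl | rfl) (rfl | rfl) (rfl | rfl)
    · exact h0
    · rw [hI, ← m2]; exact h1'
    · rw [hI, ← m1]; exact h1'
    · rw [hI, ← m1, ← m2]; exact h2'
    · exact h1
    · rw [hI, ← m2]; exact h2'
    · rw [hI, ← m1]; exact h2'
    · rw [hI, ← m1, ← m2]; exact h3'
  apply ContinuousAlternatingMap.toAlternatingMap_injective
  refine Module.Basis.ext_alternating frame fun t _ => ?_
  change Y _ = 0
  have ht : (fun i => frame (t i)) = ![frame (t 0), frame (t 1), frame (t 2)] :=
    funext fun i => by fin_cases i <;> rfl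
  rw [ht, frame_apply, frame_apply, frame_apply]
  have hval : ∀ a : Fin 6, (if (a % 2 : ℕ) = 0 then (1 : ℂ) else Complex.I) = 1 ∨
    (if (a % 2 : ℕ) = 0 then (1 : ℂ) else Complex.I) = Complex.I := fun a => by
      split_ifs <;> simp
  have hx := hval (t 0)
  have hy := hval (t 1)
  have hw := hval (t 2)
  generalize (if ((t 0 : Fin 6) % 2 : ℕ) = 0 then (1 : ℂ) else Complex.I) = x at hx ⊢
  generalize (if ((t 1 : Fin 6) % 2 : ℕ) = 0 then (1 : ℂ) else Complex.I) = y at hy ⊢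
  generalize (if ((t 2 : Fin 6) % 2 : ℕ) = 0 then (1 : ℂ) else Complex.I) = w at hw ⊢
  generalize (⟨(t 0 : ℕ) / 2, _⟩ : Fin 3) = l
  generalize (⟨(t 1 : ℕ) / 2, _⟩ : Fin 3) = m
  generalize (⟨(t 2 : ℕ) / 2, _⟩ : Fin 3) = n
  rcases hne l m n with ⟨k, hk⟩ | ⟨hlm, hmn, hln⟩
  · exact hsign k l m n hk x y w
  · have e012 := hstd
    fin_cases l <;> fin_cases m <;> fin_cases n <;> simp only [ne_eq, not_true_eq_false] at hlm hmn hln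
    · exact hstd x y w hx hy hw
    · exact (map_vec_swap_right Y _ _ _).trans (neg_eq_zero.2 (hstd x w y hx hw hy))
    · exact (map_vec_swap_left Y _ _ _).trans (neg_eq_zero.2 (hstd y x w hy hx hw))
    · exact (map_vec_swap_right Y _ _ _).trans (neg_eq_zero.2
        ((map_vec_swap_left Y _ _ _).trans (neg_eq_zero.2 (hstd w x y hw hx hy))))
    · exact (map_vec_swap_left Y _ _ _).trans (neg_eq_zero.2
        ((map_vec_swap_right Y _ _ _).trans (neg_eq_zero.2 (hstd y w x hy hw hx))))
    · exact (map_vec_swap_left Y _ _ _).trans (neg_eq_zero.2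
        ((map_vec_swap_right Y _ _ _).trans (neg_eq_zero.2
        ((map_vec_swap_left Y _ _ _).trans (neg_eq_zero.2 (hstd w y x hw hy hx))))))

theorem phi_reStd_ne_zero : phi reStd ≠ 0 :=
  Real.sqrt_ne_zero'.2 (abs_pos.2 lam_reStd_ne_zero)

/-- Euler's identity for a function homogeneous of degree two. -/
theorem fderiv_phi_self {Ω : Forms3} (h : lam Ω ≠ 0) : fderiv ℝ phi Ω Ω = 2 * phi Ω := by
  have h1 : HasDerivAt (fun t : ℝ => phi (Ω + t • Ω)) (fderiv ℝ phi Ω Ω) 0 := by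
    have hd := ((contDiffAt_phi h).differentiableAt (by simp)).hasFDerivAt
    have hl : HasDerivAt (fun t : ℝ => Ω + t • Ω) Ω 0 := by
      simpa using ((hasDerivAt_id (0 : ℝ)).smul_const Ω).const_add Ω
    have e : Ω = (fun t : ℝ => Ω + t • Ω) 0 := by simp
    rw [e] at hd
    have := hd.comp_hasDerivAt (0 : ℝ) hl
    simpa [Function.comp_def] using this
  have h2 : (fun t : ℝ => phi (Ω + t • Ω)) = fun t => (1 + t) ^ 2 * phi Ω := funext fun t => by
    rw [← phi_smul, add_smul, one_smul]
  rw [h2] at h1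
  have h3 : HasDerivAt (fun t : ℝ => (1 + t) ^ 2 * phi Ω) (2 * phi Ω) 0 := by
    have := (((hasDerivAt_id (0 : ℝ)).const_add 1).pow 2).mul_const (phi Ω)
    simpa using this
  exact h1.unique h3

/-- The line reStd + t imStd consists of the real parts of (1 - it) times the volume form, along
which φ is (1 + t²) φ(reStd), with zero derivative at t = 0. -/
theorem fderiv_phi_imStd : fderiv ℝ phi reStd imStd = 0 := by
  have h1 : HasDerivAt (fun t : ℝ => phi (reStd + t • imStd)) (fderiv ℝ phi reStd imStd) 0 := by
    have hd := ((contDiffAt_phi lam_reStd_ne_zero).differentiableAt (by simp)).hasFDerivAt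
    have hl : HasDerivAt (fun t : ℝ => reStd + t • imStd) imStd 0 := by
      simpa using ((hasDerivAt_id (0 : ℝ)).smul_const imStd).const_add reStd
    have e : reStd = (fun t : ℝ => reStd + t • imStd) 0 := by simp
    rw [e] at hd
    have := hd.comp_hasDerivAt (0 : ℝ) hl
    simpa [Function.comp_def] using this
  have h2 : (fun t : ℝ => phi (reStd + t • imStd)) = fun t => (1 + t ^ 2) * phi reStd := funext fun t => by
    have : reStd + t • imStd = Complex.reCLM.compContinuousAlternatingMap ((⟨1, -t⟩ : ℂ) • stdForm) := by
      ext v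
      simp [reStd, imStd, Complex.mul_re]
    rw [this, phi_re_smul_stdForm, Complex.normSq_mk]
    ring
  rw [h2] at h1
  have h3 : HasDerivAt (fun t : ℝ => (1 + t ^ 2) * phi reStd) 0 0 := by
    have := (((hasDerivAt_id (0 : ℝ)).pow 2).const_add 1).mul_const (phi reStd)
    simpa using this
  exact h1.unique h3

/-- Diagonal matrices of determinant one fix `reStd`, hence also X_φ(reStd), and the invariant
3-forms are the real parts of c times the volume form. Pairing with `imStd` gives Re c = 0, and
pairing with `reStd` gives Im c ≠ 0 by Euler's identity. -/
theorem exists_hamiltonianField_reStd : ∃ q : ℝ, q ≠ 0 ∧ hamiltonianField reStd = q • imStd := by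
  set X := hamiltonianField reStd with hX
  -- On these two triples the volume form takes the values 1 and i, and Re c and Re(ic) = -Im c
  -- recover c.
  let c : ℂ := ⟨X ![Pi.single 0 1, Pi.single 1 1, Pi.single 2 1],
    - X ![Pi.single 0 Complex.I, Pi.single 1 1, Pi.single 2 1]⟩
  have hinv : ∀ (w : ℂ) (z : Fin 3 → ℂ), (∏ i, z i = 1) → ∀ v : Fin 3 → E,
      stdForm (fun i => z * v i) = stdForm v := by
    intro w z hz v
    have := Matrix.det_mul_row z v
    rw [hz, one_mul] at this
    exact this
  have hY : X - Complex.reCLM.compContinuousAlternatingMap (c • stdForm) = 0 := by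
    refine eq_zero_of_diagE_invariant _ (fun z hz v => ?_) ?_ ?_
    · have hz0 : ∀ i, z i ≠ 0 := fun i h => by
        rw [Finset.prod_eq_zero (Finset.mem_univ i) h] at hz
        exact zero_ne_one hz
      have hd := det_diagE z hz0
      have h1 := hamiltonianField_pullE ((diagE z hz0).restrictScalars ℝ)
        (by rw [hd, hz]; simp) reStd
      have h2 : pullE ((diagE z hz0).restrictScalars ℝ) reStd = reStd := by
        have := pullE_diagE_re 1 z hz0
        rw [hz, one_mul, one_smul] at this
        exact this
      rw [h2] at h1
      have h3 : X v = X (fun i => z * v i) := congrArg (fun f : Forms3 => f v) h1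
      rw [ContinuousAlternatingMap.sub_apply, ContinuousAlternatingMap.sub_apply, ← h3]
      change X v - (c * stdForm (fun i => z * v i)).re = X v - (c * stdForm v).re
      rw [hinv c z hz]
    · change X _ - (c * stdForm _).re = 0
      have : stdForm ![Pi.single 0 1, Pi.single 1 1, Pi.single 2 1] = 1 := by
        rw [stdForm_apply]; erw [Matrix.det_fin_three]; simp
      rw [this]
      simp [c]
    · change X _ - (c * stdForm _).re = 0
      have : stdForm ![Pi.single 0 Complex.I, Pi.single 1 1, Pi.single 2 1] = Complex.I := by
        rw [stdForm_apply]; erw [Matrix.det_fin_three]; simp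
      rw [this]
      simp [c]
  have hX2 : X = c.re • reStd + (-c.im) • imStd := by
    rw [sub_eq_zero.1 hY]
    ext v
    simp [reStd, imStd]
    ring
  have h1 : symp X reStd = 2 * phi reStd := by
    rw [hX, hamiltonianField_spec, fderiv_phi_self lam_reStd_ne_zero]
  have h2 : symp X imStd = 0 := by rw [hX, hamiltonianField_spec, fderiv_phi_imStd]
  have hself : ∀ a, symp a a = 0 := fun a => by linarith [symp_comm a a]
  rw [hX2, symp_add_left, symp_smul_left, symp_smul_left, hself, mul_zero, zero_add] at h1
  rw [hX2, symp_add_left, symp_smul_left, symp_smul_left, hself, mul_zero, add_zero] at h2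
  have hne : -c.im * symp imStd reStd ≠ 0 := by
    rw [h1]; exact mul_ne_zero two_ne_zero phi_reStd_ne_zero
  refine ⟨-c.im, left_ne_zero_of_mul hne, ?_⟩
  have h3 : symp reStd imStd ≠ 0 := by
    rw [symp_comm]; exact neg_ne_zero.2 (right_ne_zero_of_mul hne)
  have h4 : c.re = 0 := (mul_eq_zero.1 h2).resolve_right h3
  rw [hX2, h4, zero_smul, zero_add]

/-- The infinitesimal action of an endomorphism on forms. -/
def act {p : ℕ} {F : Type*} [NormedAddCommGroup F] [NormedSpace ℝ F] (A : E →L[ℝ] E)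
    (α : E [⋀^Fin p]→L[ℝ] F) : E [⋀^Fin p]→L[ℝ] F :=
  α.fderivCompContinuousLinearMap (ContinuousLinearMap.id ℝ E) A

theorem act_apply {p : ℕ} {F : Type*} [NormedAddCommGroup F] [NormedSpace ℝ F] (A : E →L[ℝ] E)
    (α : E [⋀^Fin p]→L[ℝ] F) (v : Fin p → E) :
    act A α v = ∑ i, α (Function.update v i (A (v i))) := by
  rw [act, ContinuousAlternatingMap.fderivCompContinuousLinearMap_apply]
  refine Finset.sum_congr rfl fun i _ => congrArg α (funext fun j => ?_)
  by_cases h : j = i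
  · subst h; simp
  · simp [h]

/-! ### The derivative of the Hamiltonian field at the standard form -/

/-- Both sides are the derivative at t = 0 of X_φ at the pullback of `reStd` by 1 + tA: one by the
chain rule, the other by the equivariance of X_φ, which applies because 1 + tA has positive
determinant for small t. -/
theorem J_reStd_act (A : E →L[ℝ] E) :
    J reStd (act A reStd) = act A (hamiltonianField reStd) := by
  have hline : HasDerivAt (fun t : ℝ => ContinuousLinearMap.id ℝ E + t • A) A 0 := by
    simpa using ((hasDerivAt_id (0 : ℝ)).smul_const A).const_add (ContinuousLinearMap.id ℝ E)
  have e0 : ContinuousLinearMap.id ℝ E + (0 : ℝ) • A = ContinuousLinearMap.id ℝ E :=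
    ContinuousLinearMap.ext fun v => by simp
  have hpull : ∀ α : Forms3, HasDerivAt
      (fun t : ℝ => α.compContinuousLinearMap (ContinuousLinearMap.id ℝ E + t • A)) (act A α) 0 := by
    intro α
    have h := ((hasFDerivAt_const α (0 : ℝ)).continuousAlternatingMapCompContinuousLinearMap
      hline.hasFDerivAt).hasDerivAt
    rw [e0] at h
    simpa [act] using h
  have hX : HasFDerivAt hamiltonianField (J reStd)
      (reStd.compContinuousLinearMap (ContinuousLinearMap.id ℝ E + (0 : ℝ) • A)) := by
    have e : reStd.compContinuousLinearMap (ContinuousLinearMap.id ℝ E + (0 : ℝ) • A) = reStd := by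
      ext v; simp
    rw [e]
    exact ((contDiffAt_hamiltonianField lam_reStd_ne_zero).differentiableAt (by simp)).hasFDerivAt
  have h1 := hX.comp_hasDerivAt (0 : ℝ) (hpull reStd)
  have h2 := hpull (hamiltonianField reStd)
  have hdet : ∀ᶠ t : ℝ in nhds 0, 0 < LinearMap.det
      ((ContinuousLinearMap.id ℝ E + t • A : E →L[ℝ] E) : E →ₗ[ℝ] E) := by
    have hc : Continuous fun t : ℝ => (ContinuousLinearMap.id ℝ E + t • A : E →L[ℝ] E).det :=
      ContinuousLinearMap.continuous_det.comp (by fun_prop)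
    refine hc.continuousAt.eventually (lt_mem_nhds ?_)
    change 0 < (ContinuousLinearMap.id ℝ E + (0 : ℝ) • A : E →L[ℝ] E).det
    rw [e0, ContinuousLinearMap.det, ContinuousLinearMap.coe_id, LinearMap.det_id]
    exact one_pos
  refine h1.unique (h2.congr_of_eventuallyEq ?_)
  filter_upwards [hdet] with t ht
  let g := (ContinuousLinearMap.id ℝ E + t • A : E →L[ℝ] E).toContinuousLinearEquivOfDetNeZero ht.ne'
  have hg : (g : E →L[ℝ] E) = ContinuousLinearMap.id ℝ E + t • A :=
    ContinuousLinearMap.coe_toContinuousLinearEquivOfDetNeZero _ _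
  have := hamiltonianField_pullE g (by rw [hg]; exact ht) reStd
  rw [pullE_apply, pullE_apply, hg] at this
  exact this

/-- A form has weight `k` if multiplication of all arguments by a unit complex number `z` acts on
it as `z ^ k`. Forms of type `(a, b)` are the forms of degree `a + b` and weight `a - b`. -/
def HasWeight {p : ℕ} (k : ℤ) (α : E [⋀^Fin p]→L[ℝ] ℂ) : Prop :=
  ∀ z : ℂ, ‖z‖ = 1 → ∀ v : Fin p → E, α (fun i => z • v i) = z ^ k * α v

/-! ### Forms of weight one and three in degree three -/

theorem map_vec_add {F : Type*} [NormedAddCommGroup F] [NormedSpace ℝ F]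
    (Y : E [⋀^Fin 3]→L[ℝ] F) (u u' v w : E) : Y ![u + u', v, w] = Y ![u, v, w] + Y ![u', v, w] := by
  have h := Y.toMultilinearMap.map_update_add ![u, v, w] 0 u u'
  have e : ∀ x, Function.update ![u, v, w] 0 x = ![x, v, w] := fun x => by
    funext i; fin_cases i <;> rfl
  rw [e, e, e] at h
  exact h

theorem map_vec_add₁ {F : Type*} [NormedAddCommGroup F] [NormedSpace ℝ F]
    (Y : E [⋀^Fin 3]→L[ℝ] F) (u v v' w : E) : Y ![u, v + v', w] = Y ![u, v, w] + Y ![u, v', w] := by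
  rw [map_vec_swap_left, map_vec_add, map_vec_swap_left Y u v, map_vec_swap_left Y u v', neg_add,
    neg_neg, neg_neg]

theorem map_vec_add₂ {F : Type*} [NormedAddCommGroup F] [NormedSpace ℝ F]
    (Y : E [⋀^Fin 3]→L[ℝ] F) (u v w w' : E) : Y ![u, v, w + w'] = Y ![u, v, w] + Y ![u, v, w'] := by
  rw [map_vec_swap_right, map_vec_add₁, map_vec_swap_right Y u v, map_vec_swap_right Y u v, neg_add,
    neg_neg, neg_neg]

theorem map_vec_smul₀ (Y : E [⋀^Fin 3]→L[ℝ] ℂ) (a : ℝ) (u v w : E) :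
    Y ![a • u, v, w] = a * Y ![u, v, w] := by
  have := map_vec_smul Y a 1 1 u v w
  simpa using this

theorem map_vec_smul₁ (Y : E [⋀^Fin 3]→L[ℝ] ℂ) (a : ℝ) (u v w : E) :
    Y ![u, a • v, w] = a * Y ![u, v, w] := by
  have := map_vec_smul Y 1 a 1 u v w
  simpa using this

theorem map_vec_smul₂ (Y : E [⋀^Fin 3]→L[ℝ] ℂ) (a : ℝ) (u v w : E) :
    Y ![u, v, a • w] = a * Y ![u, v, w] := by
  have := map_vec_smul Y 1 1 a u v w
  simpa using this

theorem I_smul_I_smul (u : E) : Complex.I • Complex.I • u = (-1 : ℝ) • u := by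
  rw [smul_smul, Complex.I_mul_I]
  simp

theorem HasWeight.apply_vec {k : ℤ} {α : E [⋀^Fin 3]→L[ℝ] ℂ} (h : HasWeight k α) (z : ℂ) (hz : ‖z‖ = 1)
    (u v w : E) : α ![z • u, z • v, z • w] = z ^ k * α ![u, v, w] := by
  rw [← h z hz]
  congr 1
  funext i
  fin_cases i <;> rfl

/-- The number 3/5 + 4i/5 has modulus one and rational coordinates. The weight condition at this
number and at i gives enough linear relations to replace differentiation in z at z = 1. -/
theorem pythagorean_smul (u : E) : ((⟨3 / 5, 4 / 5⟩ : ℂ)) • u = (3 / 5 : ℝ) • u + (4 / 5 : ℝ) • (Complex.I • u) := by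
  funext i
  simp only [Pi.smul_apply, Pi.add_apply, smul_eq_mul, Complex.real_smul]
  rw [← mul_assoc, ← add_mul]
  congr 1
  apply Complex.ext <;> simp

theorem norm_pythagorean : ‖(⟨3 / 5, 4 / 5⟩ : ℂ)‖ = 1 := by
  rw [← Real.sqrt_one, Complex.norm_def, Complex.normSq_mk]
  norm_num

theorem HasWeight.expand {k : ℤ} {α : E [⋀^Fin 3]→L[ℝ] ℂ} (h : HasWeight k α) (u v w : E) :
    (⟨3 / 5, 4 / 5⟩ : ℂ) ^ k * α ![u, v, w] =
      27 / 125 * α ![u, v, w] + 36 / 125 * (α ![Complex.I • u, v, w] + α ![u, Complex.I • v, w]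
        + α ![u, v, Complex.I • w])
      + 48 / 125 * (α ![Complex.I • u, Complex.I • v, w] + α ![Complex.I • u, v, Complex.I • w]
        + α ![u, Complex.I • v, Complex.I • w])
      + 64 / 125 * α ![Complex.I • u, Complex.I • v, Complex.I • w] := by
  rw [← h.apply_vec _ norm_pythagorean]
  simp only [pythagorean_smul, map_vec_add, map_vec_add₁, map_vec_add₂, map_vec_smul₀, map_vec_smul₁,
    map_vec_smul₂]
  push_cast
  ring

theorem pythagorean_eq : (⟨3 / 5, 4 / 5⟩ : ℂ) = 3 / 5 + 4 / 5 * Complex.I := by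
  apply Complex.ext <;> simp

theorem HasWeight.rotate {α : E [⋀^Fin 3]→L[ℝ] ℂ} (h : HasWeight 1 α) (u v w : E) :
    α ![Complex.I • u, Complex.I • v, Complex.I • w] = Complex.I * α ![u, v, w] := by
  simpa using h.apply_vec Complex.I Complex.norm_I u v w

theorem HasWeight.two_slots {α : E [⋀^Fin 3]→L[ℝ] ℂ} (h : HasWeight 1 α) (u v w : E) :
    α ![Complex.I • u, Complex.I • v, w] = - Complex.I * α ![u, v, Complex.I • w] := by
  have := h.rotate u v (Complex.I • w)
  rw [I_smul_I_smul, map_vec_smul₂] at this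
  push_cast at this
  linear_combination -this

theorem HasWeight.two_slots' {α : E [⋀^Fin 3]→L[ℝ] ℂ} (h : HasWeight 1 α) (u v w : E) :
    α ![Complex.I • u, v, Complex.I • w] = - Complex.I * α ![u, Complex.I • v, w] := by
  have := h.rotate u (Complex.I • v) w
  rw [I_smul_I_smul, map_vec_smul₁] at this
  push_cast at this
  linear_combination -this

theorem HasWeight.two_slots'' {α : E [⋀^Fin 3]→L[ℝ] ℂ} (h : HasWeight 1 α) (u v w : E) :
    α ![u, Complex.I • v, Complex.I • w] = - Complex.I * α ![Complex.I • u, v, w] := by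
  have := h.rotate (Complex.I • u) v w
  rw [I_smul_I_smul, map_vec_smul₀] at this
  push_cast at this
  linear_combination -this

/-- The infinitesimal form of the weight one condition. The relations at z = i turn the terms with
two or three factors i into terms with one or none; the relation at 3/5 + 4i/5 then becomes this
identity times a nonzero constant. -/
theorem HasWeight.derivation {α : E [⋀^Fin 3]→L[ℝ] ℂ} (h : HasWeight 1 α) (u v w : E) :
    α ![Complex.I • u, v, w] + α ![u, Complex.I • v, w] + α ![u, v, Complex.I • w] =
      Complex.I * α ![u, v, w] := by
  have e := h.expand u v w
  rw [h.two_slots, h.two_slots', h.two_slots'', h.rotate, zpow_one, pythagorean_eq] at e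
  have hc : (36 / 125 - 48 / 125 * Complex.I) ≠ 0 := by
    intro h0
    have := congrArg Complex.re h0
    norm_num at this
  apply mul_left_cancel₀ hc
  linear_combination -e + 48 / 125 * α ![u, v, w] * Complex.I_mul_I

/-- Alternating complex bilinear forms on `E` are contractions of the holomorphic volume form. -/
theorem bilinear_eq_stdForm (B : E →ₗ[ℂ] E →ₗ[ℂ] ℂ) (hB : ∀ v, B v v = 0) (v w : E) :
    B v w = stdForm ![fun k => B (Pi.single (k + 1) 1) (Pi.single (k + 2) 1), v, w] := by
  have hanti : ∀ v w, B v w = - B w v := fun v w => by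
    have := hB (v + w)
    simp only [map_add, LinearMap.add_apply, hB] at this
    linear_combination this
  have hexp : ∀ v : E, v = v 0 • Pi.single 0 1 + v 1 • Pi.single 1 1 + v 2 • Pi.single 2 1 := fun v => by
    funext i
    fin_cases i <;> simp
  conv_lhs => rw [hexp v, hexp w]
  rw [stdForm_apply]
  erw [Matrix.det_fin_three]
  simp only [map_add, LinearMap.add_apply, map_smul, LinearMap.smul_apply, hB, smul_eq_mul,
    Matrix.cons_val]
  rw [hanti (Pi.single 1 1) (Pi.single 0 1), hanti (Pi.single 2 1) (Pi.single 1 1),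
    hanti (Pi.single 0 1) (Pi.single 2 1)]
  have e1 : (1 : Fin 3) + 1 = 2 := rfl
  have e2 : (1 : Fin 3) + 2 = 0 := rfl
  have e3 : (2 : Fin 3) + 1 = 0 := rfl
  have e4 : (2 : Fin 3) + 2 = 1 := rfl
  simp only [zero_add, e1, e2, e3, e4]
  rw [hanti (Pi.single 2 1) (Pi.single 0 1)]
  ring

theorem complex_smul_of_I_smul {V : Type*} [AddCommGroup V] [Module ℂ V] (f : V → ℂ)
    (hadd : ∀ u v, f (u + v) = f u + f v) (hsmul : ∀ (c : ℝ) u, f (c • u) = c * f u)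
    (hI : ∀ u, f (Complex.I • u) = Complex.I * f u) (c : ℂ) (u : V) : f (c • u) = c * f u := by
  have : c • u = c.re • u + c.im • (Complex.I • u) := by
    conv_lhs => rw [← Complex.re_add_im c, add_smul, mul_smul]
    simp only [Complex.coe_smul]
  rw [this, hadd, hsmul, hsmul, hI, ← mul_assoc, ← add_mul, Complex.re_add_im]

/-- Every form of weight one in degree three is obtained from the holomorphic volume form by the
action of an endomorphism. -/
theorem HasWeight.exists_act {γ : E [⋀^Fin 3]→L[ℝ] ℂ} (h : HasWeight 1 γ) :
    ∃ A : E →L[ℝ] E, γ = act A stdForm := by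
  -- This is the part of γ antilinear in its first argument. In weight one it is complex bilinear
  -- and alternating in the other two, so it has the form `stdForm ![A u, v, w]`. The terms of `act
  -- A stdForm` are the values of g with each argument in turn put first, with signs; they add up to
  -- (3γ + i·iγ)/2 = γ by `HasWeight.derivation`.
  let g : E → E → E → ℂ := fun u v w => (γ ![u, v, w] + Complex.I * γ ![Complex.I • u, v, w]) / 2
  have hII : Complex.I ^ 2 = -1 := Complex.I_sq
  have gswap : ∀ u v w, g u w v = - g u v w := fun u v w => by
    simp only [g]
    rw [map_vec_swap_right γ u v w, map_vec_swap_right γ (Complex.I • u) v w]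
    ring
  have gadd : ∀ u v v' w, g u (v + v') w = g u v w + g u v' w := fun u v v' w => by
    simp only [g, map_vec_add₁]; ring
  have gI : ∀ u v w, g u (Complex.I • v) w = Complex.I * g u v w := fun u v w => by
    simp only [g]
    rw [h.two_slots]
    have := h.derivation u v w
    linear_combination (-1 / 2) * γ ![u, v, Complex.I • w] * hII + (-1 / 2) * γ ![Complex.I • u, v, w] * hII + (1 / 2) * this
  have gsmul : ∀ u (c : ℂ) v w, g u (c • v) w = c * g u v w := fun u c v w =>
    complex_smul_of_I_smul (fun v => g u v w) (fun a b => gadd u a b w)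
      (fun c v => by simp only [g, map_vec_smul₁]; ring) (fun v => gI u v w) c v
  let B : E → E →ₗ[ℂ] E →ₗ[ℂ] ℂ := fun u => LinearMap.mk₂ ℂ (g u) (gadd u) (gsmul u)
    (fun a b c => by rw [gswap, gadd, gswap u a b, gswap u a c]; ring)
    (fun c a b => by rw [gswap, gsmul, gswap u a b, smul_eq_mul]; ring)
  have hB : ∀ u v, B u v v = 0 := fun u v => by
    have := gswap u v v
    change g u v v = 0
    linear_combination (1 / 2) * this
  let A : E →L[ℝ] E := LinearMap.toContinuousLinearMap
    { toFun := fun u k => g u (Pi.single (k + 1) 1) (Pi.single (k + 2) 1)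
      map_add' := fun u u' => by
        funext k
        simp only [g, map_vec_add, smul_add, Pi.add_apply]; ring
      map_smul' := fun c u => by
        funext k
        simp only [g, map_vec_smul₀, smul_comm Complex.I c, Pi.smul_apply, RingHom.id_apply,
          Complex.real_smul]
        ring }
  have hA : ∀ u v w, stdForm ![A u, v, w] = g u v w := fun u v w =>
    (bilinear_eq_stdForm (B u) (hB u) v w).symm
  refine ⟨A, ?_⟩
  ext v
  rw [act_apply, Fin.sum_univ_three]
  have e : v = ![v 0, v 1, v 2] := funext fun i => by fin_cases i <;> rfl
  have e0 : Function.update v 0 (A (v 0)) = ![A (v 0), v 1, v 2] := funext fun i => by fin_cases i <;> rfl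
  have e1 : Function.update v 1 (A (v 1)) = ![v 0, A (v 1), v 2] := funext fun i => by fin_cases i <;> rfl
  have e2 : Function.update v 2 (A (v 2)) = ![v 0, v 1, A (v 2)] := funext fun i => by fin_cases i <;> rfl
  rw [e0, e1, e2, map_vec_swap_left stdForm (A (v 1)) (v 0) (v 2), map_vec_swap_right stdForm (v 0) (A (v 2)) (v 1),
    map_vec_swap_left stdForm (A (v 2)) (v 0) (v 1), hA, hA, hA]
  conv_lhs => rw [e]
  have := h.derivation (v 0) (v 1) (v 2)
  simp only [g]
  rw [map_vec_swap_left γ (v 0) (v 1) (v 2), map_vec_swap_left γ (v 0) (Complex.I • v 1) (v 2),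
    map_vec_swap_left γ (v 0) (v 2) (v 1), map_vec_swap_right γ (v 0) (v 1) (v 2),
    map_vec_swap_left γ (v 0) (Complex.I • v 2) (v 1), map_vec_swap_right γ (v 0) (v 1) (Complex.I • v 2)]
  linear_combination (-Complex.I / 2) * this - (1 / 2) * γ ![v 0, v 1, v 2] * hII


theorem HasWeight.add {p : ℕ} {k : ℤ} {α β : E [⋀^Fin p]→L[ℝ] ℂ} (hα : HasWeight k α)
    (hβ : HasWeight k β) : HasWeight k (α + β) := fun z hz v => by
  rw [ContinuousAlternatingMap.add_apply, ContinuousAlternatingMap.add_apply, hα z hz, hβ z hz, mul_add]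

theorem HasWeight.comp {p : ℕ} {k : ℤ} {α : E [⋀^Fin p]→L[ℝ] ℂ} (hα : HasWeight k α)
    (g : E →L[ℂ] E) : HasWeight k (α.compContinuousLinearMap (g.restrictScalars ℝ)) := fun z hz v => by
  have := hα z hz (fun i => g (v i))
  simp only [← map_smul] at this
  exact this

/-- Complex conjugation of the values of a form. -/
def conjForm {p : ℕ} (α : E [⋀^Fin p]→L[ℝ] ℂ) : E [⋀^Fin p]→L[ℝ] ℂ :=
  (Complex.conjCLE : ℂ →L[ℝ] ℂ).compContinuousAlternatingMap α

@[simp] theorem conjForm_apply {p : ℕ} (α : E [⋀^Fin p]→L[ℝ] ℂ) (v : Fin p → E) :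
    conjForm α v = starRingEnd ℂ (α v) := rfl

theorem HasWeight.conj {p : ℕ} {k : ℤ} {α : E [⋀^Fin p]→L[ℝ] ℂ} (hα : HasWeight k α) :
    HasWeight (-k) (conjForm α) := fun z hz v => by
  rw [conjForm_apply, conjForm_apply, hα z hz, map_mul, map_zpow₀, zpow_neg, ← inv_zpow,
    Complex.inv_eq_conj hz]

/-- The constant by which `J` relates real and imaginary parts. -/
def qConst : ℝ := Classical.choose exists_hamiltonianField_reStd

theorem qConst_ne_zero : qConst ≠ 0 := (Classical.choose_spec exists_hamiltonianField_reStd).1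

theorem J_reStd_re_act (A : E →L[ℝ] E) :
    J reStd (Complex.reCLM.compContinuousAlternatingMap (act A stdForm)) =
      qConst • Complex.imCLM.compContinuousAlternatingMap (act A stdForm) := by
  have h1 : Complex.reCLM.compContinuousAlternatingMap (act A stdForm) = act A reStd := by
    ext v
    change (act A stdForm v).re = act A reStd v
    rw [act_apply, act_apply, Complex.re_sum]
    rfl
  have h2 : qConst • Complex.imCLM.compContinuousAlternatingMap (act A stdForm) =
      act A (qConst • imStd) := by
    ext v
    change qConst * (act A stdForm v).im = act A (qConst • imStd) v
    rw [act_apply, act_apply, Complex.im_sum, Finset.mul_sum]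
    rfl
  rw [h1, J_reStd_act, h2, (Classical.choose_spec exists_hamiltonianField_reStd).2]
  rfl

/-- Forms of degree and weight three are multiples of the holomorphic volume form. -/
theorem eq_smul_stdForm (γ : E [⋀^Fin 3]→L[ℝ] ℂ)
    (h : ∀ u v w, γ ![Complex.I • u, v, w] = Complex.I * γ ![u, v, w]) :
    γ = γ ![Pi.single 0 1, Pi.single 1 1, Pi.single 2 1] • stdForm := by
  have gsmul : ∀ (c : ℂ) u v w, γ ![c • u, v, w] = c * γ ![u, v, w] := fun c u v w =>
    complex_smul_of_I_smul (fun u => γ ![u, v, w]) (fun a b => map_vec_add γ a b v w)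
      (fun c u => map_vec_smul₀ γ c u v w) (fun u => h u v w) c u
  have gsmul₁ : ∀ (c : ℂ) u v w, γ ![u, c • v, w] = c * γ ![u, v, w] := fun c u v w => by
    rw [map_vec_swap_left, gsmul, map_vec_swap_left γ u v w]; ring
  have gadd : ∀ u v v' w, γ ![u, v + v', w] = γ ![u, v, w] + γ ![u, v', w] := map_vec_add₁ γ
  let B : E → E →ₗ[ℂ] E →ₗ[ℂ] ℂ := fun u => LinearMap.mk₂ ℂ (fun v w => γ ![u, v, w]) (gadd u)
    (fun c v w => gsmul₁ c u v w) (fun a b c => map_vec_add₂ γ u a b c)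
    (fun c a b => by rw [map_vec_swap_right, gsmul₁, map_vec_swap_right γ u a b, smul_eq_mul]; ring)
  have hB : ∀ u v, B u v v = 0 := fun u v => γ.map_eq_zero_of_eq ![u, v, v] (i := 1) (j := 2) rfl (by decide)
  have hx : ∀ u : E, (fun k => B u (Pi.single (k + 1) 1) (Pi.single (k + 2) 1)) =
      γ ![Pi.single 0 1, Pi.single 1 1, Pi.single 2 1] • u := by
    intro u
    have hexp : u = u 0 • Pi.single 0 1 + u 1 • Pi.single 1 1 + u 2 • Pi.single 2 1 := by
      funext i
      fin_cases i <;> simp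
    have hz01 : ∀ a b : E, γ ![a, a, b] = 0 := fun a b =>
      γ.map_eq_zero_of_eq ![a, a, b] (i := 0) (j := 1) rfl (by decide)
    have hz02 : ∀ a b : E, γ ![a, b, a] = 0 := fun a b =>
      γ.map_eq_zero_of_eq ![a, b, a] (i := 0) (j := 2) rfl (by decide)
    funext k
    change γ ![u, Pi.single (k + 1) 1, Pi.single (k + 2) 1] = _
    rw [hexp, map_vec_add, map_vec_add, gsmul, gsmul, gsmul, ← hexp]
    have e1 : (1 : Fin 3) + 1 = 2 := rfl
    have e2 : (1 : Fin 3) + 2 = 0 := rfl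
    have e3 : (2 : Fin 3) + 1 = 0 := rfl
    have e4 : (2 : Fin 3) + 2 = 1 := rfl
    fin_cases k
    · simp [hz01, hz02, mul_comm]
    · simp only [Fin.mk_one, e1, e2, hz01, hz02, Pi.smul_apply, smul_eq_mul]
      rw [map_vec_swap_right, map_vec_swap_left]; ring
    · simp only [Fin.reduceFinMk, e3, e4, hz01, hz02, Pi.smul_apply, smul_eq_mul]
      rw [map_vec_swap_left γ (Pi.single 0 1), map_vec_swap_right γ (Pi.single 0 1)]; ring
  ext v
  have e : v = ![v 0, v 1, v 2] := funext fun i => by fin_cases i <;> rfl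
  have h1 := bilinear_eq_stdForm (B (v 0)) (hB (v 0)) (v 1) (v 2)
  rw [hx] at h1
  conv_lhs => rw [e]
  refine Eq.trans h1 ?_
  rw [ContinuousAlternatingMap.smul_apply, smul_eq_mul]
  conv_rhs => rw [e]
  have := Matrix.det_updateRow_smul (![v 0, v 1, v 2] : Matrix (Fin 3) (Fin 3) ℂ) 0 (γ ![Pi.single 0 1, Pi.single 1 1, Pi.single 2 1]) (v 0)
  have e5 : ∀ x : E, Matrix.updateRow (![v 0, v 1, v 2] : Matrix (Fin 3) (Fin 3) ℂ) 0 x = ![x, v 1, v 2] := by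
    intro x
    funext i
    fin_cases i <;> rfl
  rw [e5, e5] at this
  exact this

/-- A scalar acts once in each of the three slots, whence c/3. Forms of type (3,0) thus also arise
from the action of an endomorphism. -/
theorem act_id_stdForm (c : ℂ) :
    act (((c / 3) • ContinuousLinearMap.id ℂ E).restrictScalars ℝ) stdForm = c • stdForm := by
  ext v
  rw [act_apply]
  have : ∀ i, stdForm (Function.update v i ((((c / 3) • ContinuousLinearMap.id ℂ E).restrictScalars ℝ) (v i))) =
      c / 3 * stdForm v := by
    intro i
    have := Matrix.det_updateRow_smul (v : Matrix (Fin 3) (Fin 3) ℂ) i (c / 3) (v i)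
    have h2 : Matrix.updateRow (v : Matrix (Fin 3) (Fin 3) ℂ) i (v i) = v := Function.update_eq_self i v
    rw [h2] at this
    exact this
  simp only [this, Finset.sum_const, Finset.card_univ, Fintype.card_fin,
    ContinuousAlternatingMap.smul_apply, smul_eq_mul, nsmul_eq_mul]
  push_cast
  ring

theorem J_reStd_of_weight_one {γ : E [⋀^Fin 3]→L[ℝ] ℂ} (h : HasWeight 1 γ) :
    J reStd (Complex.reCLM.compContinuousAlternatingMap γ) =
      qConst • Complex.imCLM.compContinuousAlternatingMap γ := by
  obtain ⟨A, rfl⟩ := h.exists_act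
  exact J_reStd_re_act A

/-- As in weight one, z = i and z = 3/5 + 4i/5 show that inserting i in each slot in turn and adding
gives 3iγ. Using this identity a second time with iu in place of u isolates the first slot. -/
theorem HasWeight.linear_of_three {γ : E [⋀^Fin 3]→L[ℝ] ℂ} (h : HasWeight 3 γ) (u v w : E) :
    γ ![Complex.I • u, v, w] = Complex.I * γ ![u, v, w] := by
  have hII : Complex.I ^ 2 = -1 := Complex.I_sq
  have rot : ∀ u v w, γ ![Complex.I • u, Complex.I • v, Complex.I • w] = -Complex.I * γ ![u, v, w] := fun u v w => by
    have := h.apply_vec Complex.I Complex.norm_I u v w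
    rw [this]
    have : Complex.I ^ (3 : ℤ) = -Complex.I := by
      rw [show (3 : ℤ) = ((3 : ℕ) : ℤ) from rfl, zpow_natCast, Complex.I_pow_three]
    rw [this]
  have t2 : ∀ u v w, γ ![Complex.I • u, Complex.I • v, w] = Complex.I * γ ![u, v, Complex.I • w] := fun u v w => by
    have := rot u v (Complex.I • w)
    rw [I_smul_I_smul, map_vec_smul₂] at this
    push_cast at this
    linear_combination -this
  have t1 : ∀ u v w, γ ![Complex.I • u, v, Complex.I • w] = Complex.I * γ ![u, Complex.I • v, w] := fun u v w => by
    have := rot u (Complex.I • v) w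
    rw [I_smul_I_smul, map_vec_smul₁] at this
    push_cast at this
    linear_combination -this
  have t0 : ∀ u v w, γ ![u, Complex.I • v, Complex.I • w] = Complex.I * γ ![Complex.I • u, v, w] := fun u v w => by
    have := rot (Complex.I • u) v w
    rw [I_smul_I_smul, map_vec_smul₀] at this
    push_cast at this
    linear_combination -this
  have der : ∀ u v w, γ ![Complex.I • u, v, w] + γ ![u, Complex.I • v, w] + γ ![u, v, Complex.I • w] =
      3 * Complex.I * γ ![u, v, w] := fun u v w => by
    have e := h.expand u v w
    have h3 : (⟨3 / 5, 4 / 5⟩ : ℂ) ^ (3 : ℤ) = (3 / 5 + 4 / 5 * Complex.I) ^ 3 := by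
      rw [pythagorean_eq, show (3 : ℤ) = ((3 : ℕ) : ℤ) from rfl, zpow_natCast]
    rw [t2, t1, t0, rot, h3] at e
    have hc : (36 / 125 + 48 / 125 * Complex.I) ≠ 0 := by
      intro h0
      have := congrArg Complex.re h0
      norm_num at this
    have h4 : Complex.I ^ 3 = -Complex.I := Complex.I_pow_three
    apply mul_left_cancel₀ hc
    linear_combination -e + (64 / 125) * γ ![u, v, w] * h4
  have d := der (Complex.I • u) v w
  rw [I_smul_I_smul, map_vec_smul₀, t2, t1] at d
  push_cast at d
  have d0 := der u v w
  linear_combination (Complex.I / 4) * d - (Complex.I ^ 2 / 4) * d0 +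
    (γ ![Complex.I • u, v, w] - 3 / 4 * Complex.I * γ ![u, v, w]) * hII

theorem J_reStd_of_weight_three {γ : E [⋀^Fin 3]→L[ℝ] ℂ} (h : HasWeight 3 γ) :
    J reStd (Complex.reCLM.compContinuousAlternatingMap γ) =
      qConst • Complex.imCLM.compContinuousAlternatingMap γ := by
  rw [eq_smul_stdForm γ h.linear_of_three, ← act_id_stdForm]
  exact J_reStd_re_act _

/-- `J` takes the real part of a form of weight one or three to a multiple of its imaginary part. -/
theorem J_re_of_weight {c : ℂ} (hc : c ≠ 0) {γ : E [⋀^Fin 3]→L[ℝ] ℂ} (h : HasWeight 1 γ ∨ HasWeight 3 γ) :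
    J (Complex.reCLM.compContinuousAlternatingMap (c • stdForm))
      (Complex.reCLM.compContinuousAlternatingMap γ) =
      qConst • Complex.imCLM.compContinuousAlternatingMap γ := by
  have hz : ∀ i, (![c, 1, 1] : Fin 3 → ℂ) i ≠ 0 := by
    intro i; fin_cases i <;> simp [hc]
  have hp : ∏ i, (![c, 1, 1] : Fin 3 → ℂ) i = c := by simp [Fin.prod_univ_three]
  -- This map carries the volume form to c times itself; it is complex linear, so it preserves
  -- weights and has positive determinant, and J commutes with it.
  let g := diagE ![c, 1, 1] hz
  have h1 := pullE_diagE_re 1 ![c, 1, 1] hz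
  rw [hp, one_mul, one_smul] at h1
  let γ' := γ.compContinuousLinearMap ((g.symm : E →L[ℂ] E).restrictScalars ℝ)
  have h2 : ∀ L : ℂ →L[ℝ] ℝ, pullE (g.restrictScalars ℝ) (L.compContinuousAlternatingMap γ') =
      L.compContinuousAlternatingMap γ := fun L => by
    ext v
    change L (γ fun i => g.symm (g (v i))) = L (γ v)
    simp
  have h3 : J reStd (Complex.reCLM.compContinuousAlternatingMap γ') =
      qConst • Complex.imCLM.compContinuousAlternatingMap γ' := by
    rcases h with h | h
    · exact J_reStd_of_weight_one (h.comp _)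
    · exact J_reStd_of_weight_three (h.comp _)
  have hdet : 0 < LinearMap.det (((g.restrictScalars ℝ : E ≃L[ℝ] E) : E →L[ℝ] E) : E →ₗ[ℝ] E) := by
    rw [det_diagE, hp]
    exact Complex.normSq_pos.2 hc
  have h4 := J_pullE (g.restrictScalars ℝ) hdet reStd (Complex.reCLM.compContinuousAlternatingMap γ')
  rw [h3, map_smul, h2, h2] at h4
  rw [← h4, ← h1]
  rfl

/-! ### The type decomposition -/

theorem smul_eq_re_add_im (z : ℂ) (u : E) : z • u = z.re • u + z.im • (Complex.I • u) := by
  conv_lhs => rw [← Complex.re_add_im z, add_smul, mul_smul]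
  simp only [Complex.coe_smul]

/-- The action of unit complex numbers on a form is a Laurent polynomial. -/
theorem exists_weight_expansion {p : ℕ} (α : E [⋀^Fin p]→L[ℝ] ℂ) (v : Fin p → E) :
    ∃ Q : ℕ → ℂ, ∀ z : ℂ, ‖z‖ = 1 →
      α (fun i => z • v i) = ∑ j ∈ Finset.range (p + 1), z ^ (2 * (j : ℤ) - p) * Q j := by
  classical
  let a : Finset (Fin p) → ℂ := fun S => α (S.piecewise v fun i => Complex.I • v i)
  -- Each argument z • v splits as Re z · v + Im z · iv. On the unit circle Re z = (z² + 1)/(2z) and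
  -- Im z = (z² - 1)/(2iz), so each set S of slots contributes z⁻ᵖ times a polynomial of degree at
  -- most p in z².
  let P : Finset (Fin p) → Polynomial ℂ := fun S => Polynomial.C (a S) *
    ((Polynomial.C (1 / 2) * (Polynomial.X + 1)) ^ S.card *
      (Polynomial.C (1 / (2 * Complex.I)) * (Polynomial.X - 1)) ^ (p - S.card))
  have hdeg : ∀ S, (P S).natDegree < p + 1 := by
    intro S
    have hS : S.card ≤ p := by simpa using S.card_le_univ
    have h1 : (Polynomial.C (1 / 2 : ℂ) * (Polynomial.X + 1)).natDegree ≤ 1 := by compute_degree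
    have h2 : (Polynomial.C (1 / (2 * Complex.I) : ℂ) * (Polynomial.X - 1)).natDegree ≤ 1 := by
      compute_degree
    have h3 := Polynomial.natDegree_pow_le_of_le S.card h1
    have h4 := Polynomial.natDegree_pow_le_of_le (p - S.card) h2
    have h5 := Polynomial.natDegree_mul_le_of_le h3 h4
    have h6 := (Polynomial.natDegree_C_mul_le (a S) _).trans h5
    simp only [P]
    omega
  have hz : ∀ z : ℂ, ‖z‖ = 1 → α (fun i => z • v i) = ∑ S, (P S).eval (z ^ 2) * z ^ (-(p : ℤ)) := by
    intro z hz
    have hz0 : z ≠ 0 := fun h => by rw [h, norm_zero] at hz; exact zero_ne_one hz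
    have hinv : starRingEnd ℂ z = z⁻¹ := (Complex.inv_eq_conj hz).symm
    have hre : (z.re : ℂ) = (1 / 2) * (z ^ 2 + 1) * z⁻¹ := by
      rw [Complex.re_eq_add_conj, hinv]; field_simp
    have him : (z.im : ℂ) = (1 / (2 * Complex.I)) * (z ^ 2 - 1) * z⁻¹ := by
      rw [Complex.im_eq_sub_conj, hinv]; field_simp
    have h1 : (fun i => z • v i) = (fun i => z.re • v i) + fun i => z.im • (Complex.I • v i) :=
      funext fun i => smul_eq_re_add_im z (v i)
    rw [h1, α.map_add_univ]
    refine Finset.sum_congr rfl fun S _ => ?_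
    have hS : S.card ≤ p := by simpa using S.card_le_univ
    have h2 : S.piecewise (fun i => z.re • v i) (fun i => z.im • (Complex.I • v i)) =
        fun i => (S.piecewise (fun _ => z.re) (fun _ => z.im) i) •
          (S.piecewise v fun i => Complex.I • v i) i := by
      funext i
      by_cases hi : i ∈ S <;> simp [hi]
    have h3 : ∏ i, S.piecewise (fun _ => z.re) (fun _ => z.im) i = z.re ^ S.card * z.im ^ (p - S.card) := by
      rw [Finset.prod_piecewise]
      simp [Finset.card_sdiff, Finset.inter_comm]
    rw [h2, α.map_smul_univ, h3, Complex.real_smul]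
    simp only [P, Polynomial.eval_mul, Polynomial.eval_C, Polynomial.eval_pow, Polynomial.eval_add,
      Polynomial.eval_sub, Polynomial.eval_X, Polynomial.eval_one]
    push_cast
    rw [hre, him, mul_pow _ z⁻¹, mul_pow _ z⁻¹]
    have h4 : z ^ (-(p : ℤ)) = z⁻¹ ^ S.card * z⁻¹ ^ (p - S.card) := by
      rw [← pow_add, Nat.add_sub_cancel' hS, zpow_neg, zpow_natCast, inv_pow]
    rw [h4]
    ring
  refine ⟨fun j => ∑ S, (P S).coeff j, fun z h => ?_⟩
  have hz0 : z ≠ 0 := fun h0 => by rw [h0, norm_zero] at h; exact zero_ne_one h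
  rw [hz z h]
  simp only [Finset.mul_sum]
  rw [Finset.sum_comm]
  refine Finset.sum_congr rfl fun S _ => ?_
  rw [Polynomial.eval_eq_sum_range' (hdeg S), Finset.sum_mul]
  refine Finset.sum_congr rfl fun j _ => ?_
  rw [sub_eq_add_neg, zpow_add₀ hz0, zpow_mul]
  norm_cast
  ring

theorem sum_rootsOfUnity_zpow (N : ℕ) (hN : N ≠ 0) (m : ℤ) (hm : ¬ (N : ℤ) ∣ m) :
    ∑ k ∈ Finset.range N, (Complex.exp (2 * Real.pi * Complex.I * k / N)) ^ m = 0 := by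
  have hp := Complex.isPrimitiveRoot_exp N hN
  set ζ := Complex.exp (2 * Real.pi * Complex.I / N) with hζ
  have h1 : ∀ k : ℕ, (Complex.exp (2 * Real.pi * Complex.I * k / N)) ^ m = (ζ ^ m) ^ k := fun k => by
    rw [hζ, ← Complex.exp_int_mul, ← Complex.exp_int_mul, ← Complex.exp_nat_mul]
    congr 1; ring
  simp only [h1]
  have h2 : ζ ^ m ≠ 1 := fun h => hm ((hp.zpow_eq_one_iff_dvd m).1 h)
  have h3 : (ζ ^ m) ^ N = 1 := by
    rw [← zpow_natCast, ← zpow_mul, mul_comm, zpow_mul, zpow_natCast, hp.pow_eq_one, one_zpow]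
  have h4 := geom_sum_mul (ζ ^ m) N
  rw [h3, sub_self] at h4
  exact (mul_eq_zero.1 h4).resolve_right (sub_ne_zero.2 h2)

/-- The average over roots of unity retains the terms whose exponent 2(j - a) is divisible by 2p +
1. Since |2(j - a)| ≤ 2p, only j = a qualifies. -/
theorem typePart_apply_of_expansion {p a b : ℕ} (hab : a + b = p) (α : E [⋀^Fin p]→L[ℝ] ℂ)
    (v : Fin p → E) (Q : ℕ → ℂ) (hQ : ∀ z : ℂ, ‖z‖ = 1 →
      α (fun i => z • v i) = ∑ j ∈ Finset.range (p + 1), z ^ (2 * (j : ℤ) - p) * Q j) :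
    typePart a b α v = Q a := by
  have hcast : ((2 * p + 1 : ℕ) : ℂ) = 2 * (p : ℂ) + 1 := by push_cast; ring
  have hN : (2 * (p : ℂ) + 1) ≠ 0 := by rw [← hcast]; exact_mod_cast Nat.succ_ne_zero (2 * p)
  rw [typePart, ContinuousAlternatingMap.smul_apply, ContinuousAlternatingMap.sum_apply, smul_eq_mul]
  have hterm : ∀ k ∈ Finset.range (2 * p + 1),
      ((let z : ℂ := Complex.exp (2 * Real.pi * Complex.I * k / (2 * p + 1))
        ((starRingEnd ℂ z) ^ a * z ^ b) •
        α.compContinuousLinearMap (z • ContinuousLinearMap.id ℝ E)) : E [⋀^Fin p]→L[ℝ] ℂ) v =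
      ∑ j ∈ Finset.range (p + 1),
        (Complex.exp (2 * Real.pi * Complex.I * k / ((2 * p + 1 : ℕ) : ℂ))) ^ (2 * ((j : ℤ) - a)) * Q j := by
    intro k _
    rw [hcast]
    set z : ℂ := Complex.exp (2 * Real.pi * Complex.I * k / (2 * p + 1)) with hz
    have hnorm : ‖z‖ = 1 := by
      rw [hz, show (2 * Real.pi * Complex.I * k / (2 * p + 1) : ℂ) =
        ((2 * Real.pi * k / (2 * p + 1) : ℝ) : ℂ) * Complex.I by push_cast; ring]
      exact Complex.norm_exp_ofReal_mul_I _
    have hz0 : z ≠ 0 := Complex.exp_ne_zero _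
    change (starRingEnd ℂ z) ^ a * z ^ b * α (fun i => z • v i) = _
    rw [hQ z hnorm, Finset.mul_sum, ← Complex.inv_eq_conj hnorm]
    refine Finset.sum_congr rfl fun j _ => ?_
    rw [← mul_assoc]
    congr 1
    rw [← zpow_natCast, ← zpow_natCast, inv_zpow', ← zpow_add₀ hz0, ← zpow_add₀ hz0]
    congr 1
    rw [← hab]; push_cast; ring
  rw [Finset.sum_congr rfl hterm, Finset.sum_comm]
  have ha : a ∈ Finset.range (p + 1) := Finset.mem_range.2 (by omega)
  rw [Finset.sum_eq_single_of_mem a ha]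
  · simp only [sub_self, mul_zero, zpow_zero, one_mul, Finset.sum_const, Finset.card_range, nsmul_eq_mul]
    rw [hcast, ← mul_assoc, inv_mul_cancel₀ hN, one_mul]
  · intro j hj hja
    rw [← Finset.sum_mul, sum_rootsOfUnity_zpow _ (Nat.succ_ne_zero _), zero_mul]
    rintro ⟨c, hc⟩
    have hj := Finset.mem_range.1 hj
    have hc0 : c ≠ 0 := by
      rintro rfl
      omega
    have h1 : |2 * ((j : ℤ) - a)| < (2 * p + 1 : ℕ) := by
      rw [abs_lt]; push_cast; omega
    rw [hc, abs_mul, Nat.abs_cast] at h1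
    have h2 : (1 : ℤ) ≤ |c| := Int.one_le_abs hc0
    nlinarith [Nat.cast_nonneg (α := ℤ) (2 * p + 1)]

theorem HasWeight.typePart_self {p a b : ℕ} (hab : a + b = p) {α : E [⋀^Fin p]→L[ℝ] ℂ}
    (h : HasWeight ((a : ℤ) - b) α) : typePart a b α = α := by
  ext v
  refine (typePart_apply_of_expansion hab α v (fun j => if j = a then α v else 0) fun z hz => ?_).trans
    (if_pos rfl)
  rw [h z hz, Finset.sum_eq_single_of_mem a (Finset.mem_range.2 (by omega))]
  · rw [if_pos rfl]; congr 2; omega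
  · intro j _ hj
    rw [if_neg hj, mul_zero]

theorem HasWeight.typePart_of_ne {p a b a' b' : ℕ} (hab : a + b = p) (hab' : a' + b' = p) (hne : a ≠ a')
    {α : E [⋀^Fin p]→L[ℝ] ℂ} (h : HasWeight ((a' : ℤ) - b') α) : typePart a b α = 0 := by
  ext v
  refine (typePart_apply_of_expansion hab α v (fun j => if j = a' then α v else 0) fun z hz => ?_).trans
    (if_neg hne)
  rw [h z hz, Finset.sum_eq_single_of_mem a' (Finset.mem_range.2 (by omega))]
  · rw [if_pos rfl]; congr 2; omega
  · intro j _ hj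
    rw [if_neg hj, mul_zero]

theorem hasWeight_typePart {p a b : ℕ} (hab : a + b = p) (α : E [⋀^Fin p]→L[ℝ] ℂ) :
    HasWeight ((a : ℤ) - b) (typePart a b α) := by
  intro z hz v
  have hz0 : z ≠ 0 := fun h0 => by rw [h0, norm_zero] at hz; exact zero_ne_one hz
  obtain ⟨Q, hQ⟩ := exists_weight_expansion α v
  rw [typePart_apply_of_expansion hab α v Q hQ]
  rw [typePart_apply_of_expansion hab α (fun i => z • v i) (fun j => z ^ (2 * (j : ℤ) - p) * Q j)]
  · congr 2; omega
  · intro w hw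
    have h1 : (fun i => w • z • v i) = fun i => (w * z) • v i := funext fun i => smul_smul _ _ _
    rw [h1, hQ (w * z) (by rw [norm_mul, hw, hz, mul_one])]
    refine Finset.sum_congr rfl fun j _ => ?_
    rw [mul_zpow, mul_assoc]

theorem sum_typePart {p : ℕ} (α : E [⋀^Fin p]→L[ℝ] ℂ) :
    ∑ ab ∈ Finset.HasAntidiagonal.antidiagonal p, typePart ab.1 ab.2 α = α := by
  ext v
  obtain ⟨Q, hQ⟩ := exists_weight_expansion α v
  have h1 := hQ 1 norm_one
  simp only [one_smul, one_zpow, one_mul] at h1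
  rw [h1, ContinuousAlternatingMap.sum_apply,
    Finset.sum_congr rfl fun ab hab => typePart_apply_of_expansion (Finset.HasAntidiagonal.mem_antidiagonal.1 hab) α v Q hQ,
    Finset.Nat.sum_antidiagonal_eq_sum_range_succ_mk]

/-- `typePart` as a continuous linear map. -/
def typePartL (p a b : ℕ) : (E [⋀^Fin p]→L[ℝ] ℂ) →L[ℝ] (E [⋀^Fin p]→L[ℝ] ℂ) :=
  LinearMap.toContinuousLinearMap
    { toFun := typePart a b
      map_add' := fun α β => by
        ext v
        simp only [typePart, ContinuousAlternatingMap.smul_apply, ContinuousAlternatingMap.sum_apply,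
          ContinuousAlternatingMap.add_apply, ContinuousAlternatingMap.compContinuousLinearMap_apply,
          smul_add, Finset.sum_add_distrib]
      map_smul' := fun c α => by
        ext v
        simp only [typePart, ContinuousAlternatingMap.smul_apply, ContinuousAlternatingMap.sum_apply,
          ContinuousAlternatingMap.compContinuousLinearMap_apply, smul_comm _ c, Finset.smul_sum,
          RingHom.id_apply] }

theorem typePartL_apply {p a b : ℕ} (α : E [⋀^Fin p]→L[ℝ] ℂ) : typePartL p a b α = typePart a b α := rfl

theorem typePart_comp {p a b : ℕ} (α : E [⋀^Fin p]→L[ℝ] ℂ) (g : E →L[ℂ] E) :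
    typePart a b (α.compContinuousLinearMap (g.restrictScalars ℝ)) =
      (typePart a b α).compContinuousLinearMap (g.restrictScalars ℝ) := by
  ext v
  simp only [typePart, ContinuousAlternatingMap.smul_apply, ContinuousAlternatingMap.sum_apply,
    ContinuousAlternatingMap.compContinuousLinearMap_apply]
  congr 1
  refine Finset.sum_congr rfl fun k _ => ?_
  congr 2
  funext i
  simp

theorem conjForm_typePart {p a b : ℕ} (α : E [⋀^Fin p]→L[ℝ] ℂ) :
    conjForm (typePart a b α) = typePart b a (conjForm α) := by
  ext v
  simp only [typePart, conjForm_apply, ContinuousAlternatingMap.smul_apply,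
    ContinuousAlternatingMap.sum_apply, ContinuousAlternatingMap.compContinuousLinearMap_apply,
    smul_eq_mul, map_mul, map_sum, map_inv₀, map_pow, map_add, map_one, Complex.conj_conj, map_natCast,
    map_ofNat]
  congr 1
  refine Finset.sum_congr rfl fun k _ => ?_
  ring

/-! ### The exterior derivative and weights -/

theorem hasWeight_fderiv {p : ℕ} {k : ℤ} {η : E → E [⋀^Fin p]→L[ℝ] ℂ} {y : E}
    (h : ∀ᶠ x in nhds y, HasWeight k (η x)) (v : E) : HasWeight k (fderiv ℝ η y v) := by
  by_cases hd : DifferentiableAt ℝ η y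
  · intro z hz w
    let T : (E [⋀^Fin p]→L[ℝ] ℂ) →L[ℝ] ℂ :=
      ContinuousAlternatingMap.apply ℝ E ℂ (fun i => z • w i) - z ^ k • ContinuousAlternatingMap.apply ℝ E ℂ w
    have hT : ∀ α, T α = α (fun i => z • w i) - z ^ k * α w := fun α => rfl
    have h0 : (T ∘ η) =ᶠ[nhds y] fun _ => 0 := h.mono fun x hx => by
      change T (η x) = 0
      rw [hT, hx z hz, sub_self]
    have h1 : HasFDerivAt (T ∘ η) (T.comp (fderiv ℝ η y)) y := T.hasFDerivAt.comp y hd.hasFDerivAt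
    have h2 : T.comp (fderiv ℝ η y) = 0 := by
      rw [← h1.fderiv, h0.fderiv_eq, fderiv_fun_const]; rfl
    have h3 : T (fderiv ℝ η y v) = 0 := congrArg (fun L : E →L[ℝ] ℂ => L v) h2
    rw [hT] at h3
    exact sub_eq_zero.1 h3
  · rw [fderiv_zero_of_not_differentiableAt hd]
    intro z _ w
    simp

/-- This is d = ∂ + ∂̄ at a point. The derivative splits into parts linear and antilinear in the
direction of differentiation; with the coefficients of weight k, the first raises the weight by one
and the second lowers it by one. -/
theorem exists_extDeriv_weight {p : ℕ} {k : ℤ} {η : E → E [⋀^Fin p]→L[ℝ] ℂ} {y : E}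
    (h : ∀ᶠ x in nhds y, HasWeight k (η x)) : ∃ A B : E [⋀^Fin (p + 1)]→L[ℝ] ℂ,
      HasWeight (k + 1) A ∧ HasWeight (k - 1) B ∧ extDeriv η y = A + B := by
  let L := fderiv ℝ η y
  have hL := hasWeight_fderiv h
  let mI : E →L[ℝ] E := Complex.I • ContinuousLinearMap.id ℝ E
  let L₁ : E →L[ℝ] E [⋀^Fin p]→L[ℝ] ℂ := (1 / 2 : ℂ) • (L - Complex.I • L.comp mI)
  let L₂ : E →L[ℝ] E [⋀^Fin p]→L[ℝ] ℂ := (1 / 2 : ℂ) • (L + Complex.I • L.comp mI)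
  have h1 : ∀ u w, L₁ u w = 1 / 2 * (L u w - Complex.I * L (Complex.I • u) w) := fun u w => rfl
  have h2 : ∀ u w, L₂ u w = 1 / 2 * (L u w + Complex.I * L (Complex.I • u) w) := fun u w => rfl
  have hz : ∀ (z : ℂ) u w, L (z • u) w = z.re * L u w + z.im * L (Complex.I • u) w := fun z u w => by
    rw [smul_eq_re_add_im, map_add, map_smul, map_smul, ContinuousAlternatingMap.add_apply,
      ContinuousAlternatingMap.smul_apply, ContinuousAlternatingMap.smul_apply]
    rfl
  have hII : Complex.I ^ 2 = -1 := Complex.I_sq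
  have hr : ∀ z : ℂ, z = z.re + z.im * Complex.I := fun z => (Complex.re_add_im z).symm
  have hzi : ∀ (z : ℂ) u w, L (Complex.I • z • u) w = z.re * L (Complex.I • u) w - z.im * L u w := fun z u w => by
    rw [smul_smul, mul_comm, ← smul_smul, hz, I_smul_I_smul, L.map_smul (-1 : ℝ) u,
      ContinuousAlternatingMap.smul_apply]
    simp; ring
  have e1 : ∀ (z : ℂ) u w, L₁ (z • u) w = z * L₁ u w := fun z u w => by
    rw [h1, h1, hz, hzi]
    conv_rhs => rw [hr z]
    linear_combination (1 / 2 * L (Complex.I • u) w * z.im) * hII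
  have e2 : ∀ (z : ℂ) u w, L₂ (z • u) w = starRingEnd ℂ z * L₂ u w := fun z u w => by
    rw [h2, h2, hz, hzi]
    have : starRingEnd ℂ z = z.re - z.im * Complex.I := by apply Complex.ext <;> simp
    rw [this]
    linear_combination (1 / 2 * L (Complex.I • u) w * z.im) * hII
  have w1 : ∀ u, HasWeight k (L₁ u) := fun u z hz w => by
    rw [h1, h1, hL u z hz, hL _ z hz]; ring
  have w2 : ∀ u, HasWeight k (L₂ u) := fun u z hz w => by
    rw [h2, h2, hL u z hz, hL _ z hz]; ring
  refine ⟨ContinuousAlternatingMap.alternatizeUncurryFin L₁,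
    ContinuousAlternatingMap.alternatizeUncurryFin L₂, ?_, ?_, ?_⟩
  · intro z hz v
    have hz0 : z ≠ 0 := fun h0 => by rw [h0, norm_zero] at hz; exact zero_ne_one hz
    rw [ContinuousAlternatingMap.alternatizeUncurryFin_apply,
      ContinuousAlternatingMap.alternatizeUncurryFin_apply, Finset.mul_sum]
    refine Finset.sum_congr rfl fun i _ => ?_
    have : (i.removeNth fun j => z • v j) = fun j => z • i.removeNth v j := rfl
    rw [e1, this, w1 _ z hz, zpow_add₀ hz0, zpow_one, mul_smul_comm]
    congr 1; ring
  · intro z hz v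
    have hz0 : z ≠ 0 := fun h0 => by rw [h0, norm_zero] at hz; exact zero_ne_one hz
    rw [ContinuousAlternatingMap.alternatizeUncurryFin_apply,
      ContinuousAlternatingMap.alternatizeUncurryFin_apply, Finset.mul_sum]
    refine Finset.sum_congr rfl fun i _ => ?_
    have : (i.removeNth fun j => z • v j) = fun j => z • i.removeNth v j := rfl
    rw [e2, this, w2 _ z hz, zpow_sub₀ hz0, zpow_one, mul_smul_comm, ← Complex.inv_eq_conj hz]
    congr 1; ring
  · have : L₁ + L₂ = L := by
      ext u w
      change L₁ u w + L₂ u w = L u w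
      rw [h1, h2]; ring
    rw [extDeriv, ← ContinuousAlternatingMap.alternatizeUncurryFin_add, this]

/-! ### Coordinate changes -/

section Charts

variable {M : Type*} [TopologicalSpace M] [ChartedSpace E M]
variable {F : Type*} [NormedAddCommGroup F] [NormedSpace ℝ F]

/-- The coordinate change from the chart at `c` to the chart at `c'`. -/
def trans (c c' : M) (y : E) : E := chartAt E c' ((chartAt E c).symm y)

/-- The domain of `trans c c'`. -/
def transDom (c c' : M) : Set E := (chartAt E c).target ∩ (chartAt E c).symm ⁻¹' (chartAt E c').source

theorem isOpen_transDom (c c' : M) : IsOpen (transDom c c') :=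
  ((chartAt E c).symm.trans (chartAt E c')).open_source

theorem transDom_mem_nhds {c c' : M} {y : E} (hy : y ∈ transDom c c') : transDom c c' ∈ nhds y :=
  (isOpen_transDom c c').mem_nhds hy

theorem target_mem_nhds {c : M} {y : E} (hy : y ∈ (chartAt E c).target) :
    (chartAt E c).target ∈ nhds y := (chartAt E c).open_target.mem_nhds hy

theorem mem_transDom_symm {c : M} {y : E} (hy : y ∈ (chartAt E c).target) :
    y ∈ transDom c ((chartAt E c).symm y) := ⟨hy, mem_chart_source E _⟩

theorem trans_mem_target {c c' : M} {y : E} (hy : y ∈ transDom c c') :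
    trans c c' y ∈ (chartAt E c').target := (chartAt E c').map_source hy.2

theorem symm_trans {c c' : M} {y : E} (hy : y ∈ transDom c c') :
    (chartAt E c').symm (trans c c' y) = (chartAt E c).symm y := (chartAt E c').left_inv hy.2

theorem trans_mem_transDom {c c' c'' : M} {y : E} (hy : y ∈ transDom c c') (hy' : y ∈ transDom c c'') :
    trans c c' y ∈ transDom c' c'' :=
  ⟨trans_mem_target hy, by rw [Set.mem_preimage, symm_trans hy]; exact hy'.2⟩

theorem trans_trans {c c' c'' : M} {y : E} (hy : y ∈ transDom c c') :
    trans c' c'' (trans c c' y) = trans c c'' y := by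
  rw [trans, symm_trans hy, trans]

theorem trans_self {c : M} {y : E} (hy : y ∈ (chartAt E c).target) : trans c c y = y :=
  (chartAt E c).right_inv hy

theorem mem_transDom_self {c : M} {y : E} (hy : y ∈ (chartAt E c).target) : y ∈ transDom c c :=
  ⟨hy, (chartAt E c).map_target hy⟩

theorem trans_inv {c c' : M} {y : E} (hy : y ∈ transDom c c') : trans c' c (trans c c' y) = y := by
  rw [trans_trans hy, trans_self hy.1]

variable [IsManifold 𝓘(ℂ, E) ω M]

theorem contDiffAt_trans_complex {c c' : M} {y : E} (hy : y ∈ transDom c c') :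
    ContDiffAt ℂ ω (trans c c') y := by
  have h := (contDiffGroupoid ω 𝓘(ℂ, E)).compatible (chart_mem_atlas E c) (chart_mem_atlas E c')
  rw [contDiffGroupoid, mem_groupoid_of_pregroupoid] at h
  replace h := h.1
  simp only [contDiffPregroupoid, mfld_simps] at h
  exact h.contDiffAt (transDom_mem_nhds hy)

theorem contDiffAt_trans {c c' : M} {y : E} (hy : y ∈ transDom c c') :
    ContDiffAt ℝ ∞ (trans c c') y :=
  ((contDiffAt_trans_complex hy).restrict_scalars ℝ).of_le le_top

theorem differentiableAt_trans {c c' : M} {y : E} (hy : y ∈ transDom c c') :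
    DifferentiableAt ℝ (trans c c') y := (contDiffAt_trans hy).differentiableAt (by simp)

theorem fderiv_trans_restrict {c c' : M} {y : E} (hy : y ∈ transDom c c') :
    fderiv ℝ (trans c c') y = (fderiv ℂ (trans c c') y).restrictScalars ℝ :=
  ((contDiffAt_trans_complex hy).differentiableAt (by simp)).fderiv_restrictScalars ℝ

theorem fderiv_trans_comp {c c' c'' : M} {y : E} (hy : y ∈ transDom c c') (hy' : y ∈ transDom c c'') :
    fderiv ℝ (trans c c'') y = (fderiv ℝ (trans c' c'') (trans c c' y)).comp (fderiv ℝ (trans c c') y) := by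
  have h1 : trans c c'' =ᶠ[nhds y] trans c' c'' ∘ trans c c' :=
    Filter.eventuallyEq_of_mem (transDom_mem_nhds hy) fun z hz => (trans_trans hz).symm
  rw [h1.fderiv_eq]
  exact fderiv_comp _ (differentiableAt_trans (trans_mem_transDom hy hy')) (differentiableAt_trans hy)

theorem fderiv_trans_self {c : M} {y : E} (hy : y ∈ (chartAt E c).target) :
    fderiv ℝ (trans c c) y = ContinuousLinearMap.id ℝ E := by
  have h1 : trans c c =ᶠ[nhds y] id :=
    Filter.eventuallyEq_of_mem (target_mem_nhds hy) fun z hz => trans_self hz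
  rw [h1.fderiv_eq, fderiv_id]

theorem fderiv_trans_inv {c c' : M} {y : E} (hy : y ∈ transDom c c') :
    (fderiv ℝ (trans c' c) (trans c c' y)).comp (fderiv ℝ (trans c c') y) = ContinuousLinearMap.id ℝ E := by
  rw [← fderiv_trans_comp hy (mem_transDom_self hy.1), fderiv_trans_self hy.1]

theorem fderiv_trans_inv' {c c' : M} {y : E} (hy : y ∈ transDom c c') :
    (fderiv ℝ (trans c c') y).comp (fderiv ℝ (trans c' c) (trans c c' y)) = ContinuousLinearMap.id ℝ E := by
  have := fderiv_trans_inv (trans_mem_transDom hy (mem_transDom_self hy.1))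
  rwa [trans_inv hy] at this

/-- The derivative of a coordinate change. -/
def transEquiv {c c' : M} {y : E} (hy : y ∈ transDom c c') : E ≃L[ℝ] E :=
  ContinuousLinearEquiv.equivOfInverse (fderiv ℝ (trans c c') y) (fderiv ℝ (trans c' c) (trans c c' y))
    (fun v => congrArg (fun L : E →L[ℝ] E => L v) (fderiv_trans_inv hy))
    (fun v => congrArg (fun L : E →L[ℝ] E => L v) (fderiv_trans_inv' hy))

theorem coe_transEquiv {c c' : M} {y : E} (hy : y ∈ transDom c c') :
    (transEquiv hy : E →L[ℝ] E) = fderiv ℝ (trans c c') y := rfl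

theorem det_fderiv_trans_pos {c c' : M} {y : E} (hy : y ∈ transDom c c') :
    0 < LinearMap.det ((fderiv ℝ (trans c c') y : E →L[ℝ] E) : E →ₗ[ℝ] E) := by
  rw [fderiv_trans_restrict hy]
  refine det_pos_of_complexLinear _ fun v w h => (transEquiv hy).injective ?_
  change fderiv ℝ (trans c c') y v = fderiv ℝ (trans c c') y w
  rw [fderiv_trans_restrict hy]
  exact h

/-- The tangent space at x is identified with E through the preferred chart at x, so the derivative
of an inverse chart at y is that of the coordinate change to the preferred chart at the image point.
-/
theorem mfderiv_chart_symm {c : M} {y : E} (hy : y ∈ (chartAt E c).target) :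
    (mfderiv 𝓘(ℝ, E) 𝓘(ℝ, E) (chartAt E c).symm y : E →L[ℝ] E) =
      fderiv ℝ (trans c ((chartAt E c).symm y)) y := by
  have h : MDifferentiableAt 𝓘(ℝ, E) 𝓘(ℝ, E) (chartAt E c).symm y :=
    mdifferentiableAt_atlas_symm (chart_mem_atlas E c) hy
  rw [h.mfderiv]
  simp only [mfld_simps, fderivWithin_univ]
  rfl

theorem mfderiv_chart_self (x : M) :
    (mfderiv 𝓘(ℝ, E) 𝓘(ℝ, E) (chartAt E x) x : E →L[ℝ] E) = ContinuousLinearMap.id ℝ E := by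
  have h : MDifferentiableAt 𝓘(ℝ, E) 𝓘(ℝ, E) (chartAt E x) x :=
    mdifferentiableAt_atlas (chart_mem_atlas E x) (mem_chart_source E x)
  rw [h.mfderiv]
  simp only [mfld_simps, fderivWithin_univ]
  exact fderiv_trans_self (mem_chart_target E x)

theorem mfderiv_chart {c x : M} (hx : x ∈ (chartAt E c).source) :
    (mfderiv 𝓘(ℝ, E) 𝓘(ℝ, E) (chartAt E c) x : E →L[ℝ] E) = fderiv ℝ (trans x c) (chartAt E x x) := by
  have h : MDifferentiableAt 𝓘(ℝ, E) 𝓘(ℝ, E) (chartAt E c) x :=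
    mdifferentiableAt_atlas (chart_mem_atlas E c) hx
  rw [h.mfderiv]
  simp only [mfld_simps, fderivWithin_univ]
  rfl

/-! ### Forms in charts -/

/-- The value of a form at a point, on the model space. -/
def val {p : ℕ} (η : Form M p F) (x : M) : E [⋀^Fin p]→L[ℝ] F := η x

theorem inChart_eq {p : ℕ} (η : Form M p F) {c : M} {y : E} (hy : y ∈ (chartAt E c).target) :
    inChart η c y = (val η ((chartAt E c).symm y)).compContinuousLinearMap
      (fderiv ℝ (trans c ((chartAt E c).symm y)) y) := by
  rw [← mfderiv_chart_symm hy]; rfl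

theorem inChart_trans {p : ℕ} (η : Form M p F) {c c' : M} {y : E} (hy : y ∈ transDom c c') :
    inChart η c y = (inChart η c' (trans c c' y)).compContinuousLinearMap (fderiv ℝ (trans c c') y) := by
  rw [inChart_eq η hy.1, inChart_eq η (trans_mem_target hy), symm_trans hy,
    fderiv_trans_comp hy (mem_transDom_symm hy.1)]
  rfl

theorem inChart_self {p : ℕ} (η : Form M p F) (x : M) : inChart η x (chartAt E x x) = val η x := by
  have hx : (chartAt E x).symm (chartAt E x x) = x := (chartAt E x).left_inv (mem_chart_source E x)
  rw [inChart_eq η (mem_chart_target E x), hx, fderiv_trans_self (mem_chart_target E x)]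
  rfl

theorem form_ext {p : ℕ} {η η' : Form M p F}
    (h : ∀ c : M, ∀ y ∈ (chartAt E c).target, inChart η c y = inChart η' c y) : η = η' := by
  funext x
  change val η x = val η' x
  rw [← inChart_self η x, ← inChart_self η' x]
  exact h x _ (mem_chart_target E x)

theorem d_apply {p : ℕ} (η : Form M p F) (x : M) : val (d η) x = extDeriv (inChart η x) (chartAt E x x) := by
  have : val (d η) x =
      (extDeriv (inChart η x) (chartAt E x x)).compContinuousLinearMap
        (mfderiv 𝓘(ℝ, E) 𝓘(ℝ, E) (chartAt E x) x : E →L[ℝ] E) := rfl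
  rw [this, mfderiv_chart_self]
  rfl

theorem IsSmooth.contDiffAt {p : ℕ} {η : Form M p F} (h : IsSmooth η) {c : M} {y : E}
    (hy : y ∈ (chartAt E c).target) : ContDiffAt ℝ ∞ (inChart η c) y :=
  (h c).contDiffAt (target_mem_nhds hy)

theorem IsSmooth.differentiableAt {p : ℕ} {η : Form M p F} (h : IsSmooth η) {c : M} {y : E}
    (hy : y ∈ (chartAt E c).target) : DifferentiableAt ℝ (inChart η c) y :=
  (h.contDiffAt hy).differentiableAt (by simp)

theorem isSmooth_of_contDiffAt {p : ℕ} {η : Form M p F}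
    (h : ∀ c : M, ∀ y ∈ (chartAt E c).target, ContDiffAt ℝ ∞ (inChart η c) y) : IsSmooth η :=
  fun c y hy => (h c y hy).contDiffWithinAt

theorem two_le_smoothness : minSmoothness ℝ 2 ≤ (∞ : WithTop ℕ∞) := by
  rw [minSmoothness_of_isRCLikeNormedField]
  exact WithTop.coe_le_coe.2 le_top

/-- The operator `d` is defined at each point in the chart preferred there. Naturality of the
exterior derivative under coordinate changes makes it computable in any chart. -/
theorem inChart_d {p : ℕ} {η : Form M p F} (hη : IsSmooth η) {c : M} {y : E}
    (hy : y ∈ (chartAt E c).target) : inChart (d η) c y = extDeriv (inChart η c) y := by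
  have hx := mem_transDom_symm hy
  set x := (chartAt E c).symm y with hxdef
  have h1 : inChart η c =ᶠ[nhds y] fun z => (inChart η x (trans c x z)).compContinuousLinearMap
      (fderiv ℝ (trans c x) z) :=
    Filter.eventuallyEq_of_mem (transDom_mem_nhds hx) fun z hz => inChart_trans η hz
  rw [h1.extDeriv_eq, extDeriv_pullback (r := ∞) (hη.differentiableAt (trans_mem_target hx))
    (contDiffAt_trans hx) two_le_smoothness, inChart_eq _ hy]
  exact congrArg (fun α : E [⋀^Fin (p + 1)]→L[ℝ] F => α.compContinuousLinearMap (fderiv ℝ (trans c x) y))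
    (d_apply η x)

theorem contDiffAt_extDeriv {p : ℕ} {η : E → E [⋀^Fin p]→L[ℝ] F} {y : E} (h : ContDiffAt ℝ ∞ η y) :
    ContDiffAt ℝ ∞ (extDeriv η) y :=
  (ContinuousAlternatingMap.alternatizeUncurryFinCLM ℝ E F).contDiff.contDiffAt.comp y
    (h.fderiv_right (by simp))

theorem IsSmooth.d {p : ℕ} {η : Form M p F} (hη : IsSmooth η) : IsSmooth (d η) := by
  refine isSmooth_of_contDiffAt fun c y hy => ?_
  exact (contDiffAt_extDeriv (hη.contDiffAt hy)).congr_of_eventuallyEq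
    (Filter.eventuallyEq_of_mem (target_mem_nhds hy) fun z hz => inChart_d hη hz)

theorem inChart_zero {p : ℕ} (c : M) (y : E) : inChart (0 : Form M p F) c y = 0 := rfl

theorem d_d {p : ℕ} {η : Form M p F} (hη : IsSmooth η) : Hitchin.d (Hitchin.d η) = 0 := by
  refine form_ext fun c y hy => ?_
  have h1 : inChart (Hitchin.d η) c =ᶠ[nhds y] extDeriv (inChart η c) :=
    Filter.eventuallyEq_of_mem (target_mem_nhds hy) fun z hz => inChart_d hη hz
  rw [inChart_d hη.d hy, h1.extDeriv_eq,
    extDeriv_extDeriv_apply (r := ∞) (hη.contDiffAt hy) two_le_smoothness, inChart_zero]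

theorem inChart_add {p : ℕ} (η η' : Form M p F) (c : M) (y : E) :
    inChart (η + η') c y = inChart η c y + inChart η' c y := rfl

theorem inChart_smul {p : ℕ} (t : ℝ) (η : Form M p F) (c : M) (y : E) :
    inChart (t • η) c y = t • inChart η c y := rfl

theorem inChart_sum {p : ℕ} {ι : Type*} (s : Finset ι) (η : ι → Form M p F) (c : M) (y : E) :
    inChart (∑ i ∈ s, η i) c y = ∑ i ∈ s, inChart (η i) c y := by
  classical
  induction s using Finset.induction_on with
  | empty => simp [inChart_zero]
  | insert i s hi ih => rw [Finset.sum_insert hi, Finset.sum_insert hi, inChart_add, ih]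

theorem IsSmooth.add {p : ℕ} {η η' : Form M p F} (h : IsSmooth η) (h' : IsSmooth η') :
    IsSmooth (η + η') := fun c => (h c).add (h' c)

theorem IsSmooth.sub {p : ℕ} {η η' : Form M p F} (h : IsSmooth η) (h' : IsSmooth η') :
    IsSmooth (η - η') := fun c => (h c).sub (h' c)

theorem IsSmooth.sum {p : ℕ} {ι : Type*} {s : Finset ι} {η : ι → Form M p F}
    (h : ∀ i ∈ s, IsSmooth (η i)) : IsSmooth (∑ i ∈ s, η i) := by
  intro c
  have : inChart (∑ i ∈ s, η i) c = fun y => ∑ i ∈ s, inChart (η i) c y :=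
    funext fun y => inChart_sum s η c y
  rw [this]
  exact ContDiffOn.sum fun i hi => h i hi c

theorem d_add {p : ℕ} {η η' : Form M p F} (h : IsSmooth η) (h' : IsSmooth η') :
    Hitchin.d (η + η') = Hitchin.d η + Hitchin.d η' := by
  refine form_ext fun c y hy => ?_
  rw [inChart_d (h.add h') hy, inChart_add, inChart_d h hy, inChart_d h' hy,
    ← extDeriv_add (h.differentiableAt hy) (h'.differentiableAt hy)]
  rfl

theorem d_sub {p : ℕ} {η η' : Form M p F} (h : IsSmooth η) (h' : IsSmooth η') :
    Hitchin.d (η - η') = Hitchin.d η - Hitchin.d η' := by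
  have h1 := d_add (h.sub h') h'
  rw [sub_add_cancel] at h1
  rw [h1, add_sub_cancel_right]

theorem d_zero {p : ℕ} : Hitchin.d (0 : Form M p F) = 0 := by
  have h : IsSmooth (0 : Form M p F) := fun c => (contDiffOn_const (c := 0)).congr fun y _ => inChart_zero c y
  have := d_sub h h
  rwa [sub_self, sub_self] at this

theorem d_sum {p : ℕ} {ι : Type*} {s : Finset ι} {η : ι → Form M p F} (h : ∀ i ∈ s, IsSmooth (η i)) :
    Hitchin.d (∑ i ∈ s, η i) = ∑ i ∈ s, Hitchin.d (η i) := by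
  classical
  induction s using Finset.induction_on with
  | empty => simp [d_zero]
  | insert i s hi ih =>
    rw [Finset.sum_insert hi, Finset.sum_insert hi, d_add (h i (Finset.mem_insert_self i s))
      (IsSmooth.sum fun j hj => h j (Finset.mem_insert_of_mem hj)),
      ih fun j hj => h j (Finset.mem_insert_of_mem hj)]

/-! ### Postcomposition with a linear map -/

/-- The composition of a vector valued form with a continuous linear map of the values. -/
def mapForm {G : Type*} [NormedAddCommGroup G] [NormedSpace ℝ G] {p : ℕ} (L : F →L[ℝ] G)
    (η : Form M p F) : Form M p G := fun x => L.compContinuousAlternatingMap (η x)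

section Map

variable {G : Type*} [NormedAddCommGroup G] [NormedSpace ℝ G]

theorem inChart_mapForm {p : ℕ} (L : F →L[ℝ] G) (η : Form M p F) (c : M) (y : E) :
    inChart (mapForm L η) c y = L.compContinuousAlternatingMap (inChart η c y) := rfl

theorem IsSmooth.mapForm {p : ℕ} (L : F →L[ℝ] G) {η : Form M p F} (h : IsSmooth η) :
    IsSmooth (mapForm L η) := fun c =>
  (ContinuousLinearMap.compContinuousAlternatingMapCLM ℝ E F G (Fin p) L).contDiff.comp_contDiffOn (h c)

theorem d_mapForm {p : ℕ} (L : F →L[ℝ] G) {η : Form M p F} (h : IsSmooth η) :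
    Hitchin.d (mapForm L η) = mapForm L (Hitchin.d η) := by
  refine form_ext fun c y hy => ?_
  rw [inChart_d (h.mapForm L) hy, inChart_mapForm, inChart_d h hy]
  have h1 : HasFDerivAt (inChart (Hitchin.mapForm L η) c)
      ((ContinuousLinearMap.compContinuousAlternatingMapCLM ℝ E F G (Fin p) L).comp
        (fderiv ℝ (inChart η c) y)) y :=
    (ContinuousLinearMap.compContinuousAlternatingMapCLM ℝ E F G (Fin p) L).hasFDerivAt.comp y
      (h.differentiableAt hy).hasFDerivAt
  ext v
  rw [extDeriv, h1.fderiv, ContinuousAlternatingMap.alternatizeUncurryFin_apply,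
    ContinuousLinearMap.compContinuousAlternatingMap_coe, Function.comp_apply, extDeriv,
    ContinuousAlternatingMap.alternatizeUncurryFin_apply, map_sum]
  simp

end Map

end Charts

set_option maxSynthPendingDepth 3

/-! ### Smoothness of families of forms -/

section Smoothness

variable {V : Type*} [NormedAddCommGroup V] [NormedSpace ℝ V] {F : Type*} [NormedAddCommGroup F]
  [NormedSpace ℝ F] {n : WithTop ℕ∞}

theorem map_eq_sum_frame {p : ℕ} (α : E [⋀^Fin p]→L[ℝ] F) (w : Fin p → E) :
    α w = ∑ σ : Fin p → Fin 6, (∏ i, frame.coord (σ i) (w i)) • α fun i => frame (σ i) := by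
  have h : w = fun i => ∑ j, frame.coord j (w i) • frame j :=
    funext fun i => (frame.sum_repr (w i)).symm
  conv_lhs => rw [h]
  refine (α.toMultilinearMap.map_sum fun i j => frame.coord j (w i) • frame j).trans ?_
  exact Finset.sum_congr rfl fun σ _ => α.toMultilinearMap.map_smul_univ _ _

/-- Evaluation on tuples of basis vectors is an injective linear map into a finite-dimensional
space, and composing with a linear left inverse recovers the form from its values. -/
theorem contDiffAt_form [FiniteDimensional ℝ F] {p : ℕ} {f : V → E [⋀^Fin p]→L[ℝ] F} {x : V}
    (h : ∀ v, ContDiffAt ℝ n (fun y => f y v) x) : ContDiffAt ℝ n f x := by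
  let ev : (E [⋀^Fin p]→L[ℝ] F) →ₗ[ℝ] ((Fin p → Fin 6) → F) :=
    { toFun := fun α σ => α fun i => frame (σ i)
      map_add' := fun _ _ => rfl
      map_smul' := fun _ _ => rfl }
  have hev : LinearMap.ker ev = ⊥ := by
    refine LinearMap.ker_eq_bot.2 fun α β hαβ => ContinuousAlternatingMap.ext fun w => ?_
    rw [map_eq_sum_frame α, map_eq_sum_frame β]
    exact Finset.sum_congr rfl fun σ _ => congrArg _ (congrFun hαβ σ)
  obtain ⟨g, hg⟩ := ev.exists_leftInverse_of_injective hev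
  have h1 : f = fun y => (LinearMap.toContinuousLinearMap g) (fun σ => f y fun i => frame (σ i)) :=
    funext fun y => (congrArg (fun L => L (f y)) hg).symm
  rw [h1]
  exact (LinearMap.toContinuousLinearMap g).contDiff.contDiffAt.comp x (contDiffAt_pi.2 fun σ => h _)

theorem contDiffAt_form_apply {p : ℕ} {f : V → E [⋀^Fin p]→L[ℝ] F} {w : V → Fin p → E} {x : V}
    (hf : ContDiffAt ℝ n f x) (hw : ∀ i, ContDiffAt ℝ n (fun y => w y i) x) :
    ContDiffAt ℝ n (fun y => f y (w y)) x := by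
  have h1 : (fun y => f y (w y)) = fun y => ∑ σ : Fin p → Fin 6,
      (∏ i, frame.coord (σ i) (w y i)) • f y fun i => frame (σ i) := funext fun y => map_eq_sum_frame _ _
  rw [h1]
  refine ContDiffAt.sum fun σ _ => ContDiffAt.smul (contDiffAt_prod fun i _ => ?_) ?_
  · exact (LinearMap.toContinuousLinearMap (frame.coord (σ i))).contDiff.contDiffAt.comp x (hw i)
  · exact (ContinuousAlternatingMap.apply ℝ E F fun i => frame (σ i)).contDiff.contDiffAt.comp x hf

theorem contDiffAt_form_comp [FiniteDimensional ℝ F] {p : ℕ} {f : V → E [⋀^Fin p]→L[ℝ] F}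
    {A : V → E →L[ℝ] E} {x : V} (hf : ContDiffAt ℝ n f x) (hA : ContDiffAt ℝ n A x) :
    ContDiffAt ℝ n (fun y => (f y).compContinuousLinearMap (A y)) x :=
  contDiffAt_form fun v => contDiffAt_form_apply (w := fun y i => A y (v i)) hf fun _ => hA.clm_apply contDiffAt_const

theorem contDiffAt_curryLeft [FiniteDimensional ℝ F] {p : ℕ} {γ : V → E [⋀^Fin (p + 1)]→L[ℝ] F}
    {X : V → E} {y : V} (hγ : ContDiffAt ℝ n γ y) (hX : ContDiffAt ℝ n X y) :
    ContDiffAt ℝ n (fun z => (γ z).curryLeft (X z)) y :=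
  contDiffAt_form fun v => contDiffAt_form_apply (w := fun y => Matrix.vecCons (X y) v) hγ fun i => by
    refine Fin.cases ?_ (fun j => ?_) i
    · exact hX
    · exact contDiffAt_const

end Smoothness

section Fields

variable {M : Type*} [TopologicalSpace M] [ChartedSpace E M] [IsManifold 𝓘(ℂ, E) ω M]
variable {F : Type*} [NormedAddCommGroup F] [NormedSpace ℝ F]

/-! ### Vector fields -/

/-- The value of a vector field at a point, in the model space. -/
def fieldVal (X : ∀ x : M, TangentSpace 𝓘(ℝ, E) x) (x : M) : E := X x

theorem fieldInChart_eq (X : ∀ x : M, TangentSpace 𝓘(ℝ, E) x) {c : M} {y : E}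
    (hy : y ∈ (chartAt E c).target) :
    fieldInChart X c y = fderiv ℝ (trans ((chartAt E c).symm y) c)
      (chartAt E ((chartAt E c).symm y) ((chartAt E c).symm y)) (fieldVal X ((chartAt E c).symm y)) := by
  rw [← mfderiv_chart ((chartAt E c).map_target hy)]
  rfl

theorem fieldInChart_chart (X : ∀ x : M, TangentSpace 𝓘(ℝ, E) x) {c x : M}
    (hx : x ∈ (chartAt E c).source) :
    fieldInChart X c (chartAt E c x) = fderiv ℝ (trans x c) (chartAt E x x) (fieldVal X x) := by
  rw [fieldInChart_eq X ((chartAt E c).map_source hx), (chartAt E c).left_inv hx]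

/-- Near x₀ the trivialization of the tangent bundle at x₀ acts on X x as the derivative of the
coordinate change from the chart at x to that at x₀, which is `fieldInChart`. -/
theorem isSmoothField_iff (X : ∀ x : M, TangentSpace 𝓘(ℝ, E) x) :
    IsSmoothField X ↔ ∀ x : M, ContDiffAt ℝ ∞ (fieldInChart X x) (chartAt E x x) := by
  refine forall_congr' fun x₀ => ?_
  have hsrc := (chartAt E x₀).open_source.mem_nhds (mem_chart_source E x₀)
  have h0 : ContMDiffAt 𝓘(ℝ, E) 𝓘(ℝ, E).tangent ∞ (fun x => (⟨x, X x⟩ : TangentBundle 𝓘(ℝ, E) M)) x₀ ↔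
      ContMDiffAt 𝓘(ℝ, E) 𝓘(ℝ, E) ∞ (fun x => fieldInChart X x₀ (chartAt E x₀ x)) x₀ := by
    refine (Bundle.contMDiffAt_section (IB := 𝓘(ℝ, E)) (E := TangentSpace 𝓘(ℝ, E)) x₀).trans ?_
    refine Filter.EventuallyEq.contMDiffAt_iff (Filter.eventuallyEq_of_mem hsrc fun x hx => ?_)
    rw [fieldInChart_chart X hx, TangentBundle.trivializationAt_apply]
    simp only [mfld_simps, fderivWithin_univ]
    rfl
  refine h0.trans ⟨fun h => ?_, fun h => ?_⟩
  · have h1 : ContMDiffAt 𝓘(ℝ, E) 𝓘(ℝ, E) ∞ (chartAt E x₀).symm (chartAt E x₀ x₀) :=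
      contMDiffOn_chart_symm.contMDiffAt (target_mem_nhds (mem_chart_target E x₀))
    have h2 : ContMDiffAt 𝓘(ℝ, E) 𝓘(ℝ, E) ∞ (fun x => fieldInChart X x₀ (chartAt E x₀ x))
        ((chartAt E x₀).symm (chartAt E x₀ x₀)) := by
      rwa [(chartAt E x₀).left_inv (mem_chart_source E x₀)]
    refine (contMDiffAt_iff_contDiffAt.1 (h2.comp _ h1)).congr_of_eventuallyEq ?_
    refine Filter.eventuallyEq_of_mem (target_mem_nhds (mem_chart_target E x₀)) fun y hy => ?_
    simp only [Function.comp_apply]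
    rw [(chartAt E x₀).right_inv hy]
  · exact (contMDiffAt_iff_contDiffAt.2 h).comp x₀ (contMDiffOn_chart.contMDiffAt hsrc)

theorem isSmooth_of_contDiffAt_self [FiniteDimensional ℝ F] {p : ℕ} {η : Form M p F}
    (h : ∀ x : M, ContDiffAt ℝ ∞ (inChart η x) (chartAt E x x)) : IsSmooth η := by
  refine isSmooth_of_contDiffAt fun c y hy => ?_
  have hx := mem_transDom_symm hy
  set x := (chartAt E c).symm y with hxdef
  have h1 : inChart η c =ᶠ[nhds y] fun z => (inChart η x (trans c x z)).compContinuousLinearMap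
      (fderiv ℝ (trans c x) z) :=
    Filter.eventuallyEq_of_mem (transDom_mem_nhds hx) fun z hz => inChart_trans η hz
  refine ContDiffAt.congr_of_eventuallyEq ?_ h1
  have hxx : trans c x y = chartAt E x x := by rw [trans, hxdef]
  have h2 : ContDiffAt ℝ ∞ (fun z => inChart η x (trans c x z)) y := by
    have h3 : ContDiffAt ℝ ∞ (inChart η x) (trans c x y) := by
      rw [hxx]; exact h x
    exact h3.comp y (contDiffAt_trans hx)
  exact contDiffAt_form_comp h2 ((contDiffAt_trans hx).fderiv_right (by simp))

/-- The interior product of a form with a vector field. -/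
def contr {p : ℕ} (X : ∀ x : M, TangentSpace 𝓘(ℝ, E) x) (η : Form M (p + 1) F) : Form M p F := fun x =>
  (val η x).curryLeft (fieldVal X x)

theorem fderiv_trans_fieldInChart (X : ∀ x : M, TangentSpace 𝓘(ℝ, E) x) {c : M} {y : E}
    (hy : y ∈ (chartAt E c).target) :
    fderiv ℝ (trans c ((chartAt E c).symm y)) y (fieldInChart X c y) = fieldVal X ((chartAt E c).symm y) := by
  rw [fieldInChart_eq X hy]
  exact congrArg (fun L : E →L[ℝ] E => L (fieldVal X ((chartAt E c).symm y)))
    (fderiv_trans_inv' (mem_transDom_symm hy))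

theorem inChart_contr {p : ℕ} (X : ∀ x : M, TangentSpace 𝓘(ℝ, E) x) (η : Form M (p + 1) F) {c : M} {y : E}
    (hy : y ∈ (chartAt E c).target) :
    inChart (contr X η) c y = (inChart η c y).curryLeft (fieldInChart X c y) := by
  rw [inChart_eq _ hy, inChart_eq _ hy, ContinuousAlternatingMap.curryLeft_compContinuousLinearMap,
    fderiv_trans_fieldInChart X hy]
  rfl

theorem IsSmooth.contr [FiniteDimensional ℝ F] {p : ℕ} {X : ∀ x : M, TangentSpace 𝓘(ℝ, E) x} (hX : IsSmoothField X)
    {η : Form M (p + 1) F} (hη : IsSmooth η) : IsSmooth (contr X η) := by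
  refine isSmooth_of_contDiffAt_self fun x => ?_
  refine (contDiffAt_curryLeft (hη.contDiffAt (mem_chart_target E x))
    ((isSmoothField_iff X).1 hX x)).congr_of_eventuallyEq ?_
  exact Filter.eventuallyEq_of_mem (target_mem_nhds (mem_chart_target E x)) fun y hy => inChart_contr X η hy

theorem map_update_eq {p : ℕ} (f : E [⋀^Fin (p + 1)]→L[ℝ] F) (v : Fin (p + 1) → E) (i : Fin (p + 1)) (x : E) :
    f (Function.update v i x) = (-1) ^ (i : ℕ) • f (Matrix.vecCons x (i.removeNth v)) := by
  rw [← f.map_insertNth, Fin.insertNth_removeNth]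

/-- **Cartan's formula** on a vector space. -/
theorem extDeriv_curryLeft {p : ℕ} {γ : E → E [⋀^Fin (p + 1)]→L[ℝ] F} {X : E → E} {y : E}
    (hγ : DifferentiableAt ℝ γ y) (hX : DifferentiableAt ℝ X y) (v : Fin (p + 1) → E) :
    extDeriv (fun z => (γ z).curryLeft (X z)) y v + (extDeriv γ y).curryLeft (X y) v =
      fderiv ℝ γ y (X y) v + ∑ i, γ y (Function.update v i (fderiv ℝ X y (v i))) := by
  let C : (E [⋀^Fin (p + 1)]→L[ℝ] F) →L[ℝ] (E →L[ℝ] E [⋀^Fin p]→L[ℝ] F) :=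
    (ContinuousAlternatingMap.curryLeftLI (𝕜 := ℝ) (E := E) (F := F) (n := p)).toContinuousLinearMap
  have h1 : HasFDerivAt (fun z => C (γ z)) (C.comp (fderiv ℝ γ y)) y :=
    HasFDerivAt.comp (f := γ) (g := C) y C.hasFDerivAt hγ.hasFDerivAt
  have h2 : HasFDerivAt (fun z => (γ z).curryLeft (X z)) _ y := h1.clm_apply hX.hasFDerivAt
  rw [extDeriv, h2.fderiv, ContinuousAlternatingMap.alternatizeUncurryFin_apply, extDeriv,
    ContinuousAlternatingMap.curryLeft_apply_apply, ContinuousAlternatingMap.alternatizeUncurryFin_apply,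
    Fin.sum_univ_succ (fun i : Fin (p + 2) => _)]
  have e1 : ∀ i : Fin (p + 1), (((γ y).curryLeft.comp (fderiv ℝ X y)) (v i) +
      ((C.comp (fderiv ℝ γ y)).flip (X y)) (v i)) (i.removeNth v) =
      γ y (Matrix.vecCons (fderiv ℝ X y (v i)) (i.removeNth v)) +
        fderiv ℝ γ y (v i) (Matrix.vecCons (X y) (i.removeNth v)) := fun i => rfl
  have e2 : ∀ i : Fin (p + 1), (i.succ.removeNth (Matrix.vecCons (X y) v) : Fin (p + 1) → E) =
      Matrix.vecCons (X y) (i.removeNth v) := fun i => by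
    funext j
    refine Fin.cases ?_ (fun j => ?_) j
    · rfl
    · simp [Fin.removeNth]
  have e3 : ((0 : Fin (p + 2)).removeNth (Matrix.vecCons (X y) v) : Fin (p + 1) → E) = v := rfl
  have e4 : ∀ i : Fin (p + 1), (-1 : ℤ) ^ ((i.succ : Fin (p + 2)) : ℕ) •
      (fderiv ℝ γ y (Matrix.vecCons (X y) v i.succ)) (i.succ.removeNth (Matrix.vecCons (X y) v)) =
      - ((-1 : ℤ) ^ (i : ℕ) • fderiv ℝ γ y (v i) (Matrix.vecCons (X y) (i.removeNth v))) := fun i => by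
    rw [e2, Fin.val_succ, pow_succ, mul_neg_one, neg_smul]; rfl
  have e5 : ∀ i : Fin (p + 1), (-1 : ℤ) ^ (i : ℕ) • ((γ y).curryLeft ∘SL fderiv ℝ X y + (C ∘SL fderiv ℝ γ y).flip (X y)) (v i) (i.removeNth v) =
      γ y (Function.update v i (fderiv ℝ X y (v i))) +
        (-1 : ℤ) ^ (i : ℕ) • fderiv ℝ γ y (v i) (Matrix.vecCons (X y) (i.removeNth v)) := fun i => by
    rw [map_update_eq, ← smul_add]; rfl
  have e6 : (-1 : ℤ) ^ ((0 : Fin (p + 2)) : ℕ) • (fderiv ℝ γ y (Matrix.vecCons (X y) v 0))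
      ((0 : Fin (p + 2)).removeNth (Matrix.vecCons (X y) v)) = fderiv ℝ γ y (X y) v := by
    rw [e3]; simp
  -- The zeroth term of dγ(X, v) is the derivative of γ along X; its other terms cancel the
  -- derivatives of γ occurring in d(ι_X γ), which leaves the derivatives of X.
  rw [e6, Finset.sum_congr rfl fun i _ => e4 i]
  refine (congrArg (· + _) (Finset.sum_congr rfl fun i _ => e5 i)).trans ?_
  rw [Finset.sum_add_distrib, Finset.sum_neg_distrib]
  abel

theorem lieDeriv_eq {p : ℕ} {X : ∀ x : M, TangentSpace 𝓘(ℝ, E) x} (hX : IsSmoothField X)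
    {η : Form M (p + 1) F} (hη : IsSmooth η) (hd : d η = 0) (x : M)
    (v : Fin (p + 1) → TangentSpace 𝓘(ℝ, E) x) : lieDeriv X η x v = d (contr X η) x v := by
  have hy := mem_chart_target E x
  have h1 := extDeriv_curryLeft (hη.differentiableAt hy)
    (((isSmoothField_iff X).1 hX x).differentiableAt (by simp)) v
  have h2 : extDeriv (inChart η x) (chartAt E x x) = 0 := by
    rw [← inChart_d hη hy, hd, inChart_zero]
  have h3 : inChart (Hitchin.contr X η) x =ᶠ[nhds (chartAt E x x)] _ :=
    Filter.eventuallyEq_of_mem (target_mem_nhds hy) fun y hy => inChart_contr X η hy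
  rw [h2, ContinuousAlternatingMap.curryLeft_zero] at h1
  have h4 : d (Hitchin.contr X η) x v = val (d (Hitchin.contr X η)) x v := rfl
  rw [h4, d_apply, h3.extDeriv_eq]
  have h5 : ∀ w : TangentSpace 𝓘(ℝ, E) x, mfderiv 𝓘(ℝ, E) 𝓘(ℝ, E) (chartAt E x) x w = w := fun w =>
    congrArg (fun L : E →L[ℝ] E => L w) (mfderiv_chart_self x)
  rw [lieDeriv]
  simp only [h5]
  refine Eq.trans ?_ h1.symm |>.trans (add_zero _)
  rfl

theorem tangentToOrbit_iff {p : ℕ} {η a : Form M (p + 1) ℝ} (hη : IsSmooth η) (hd : d η = 0) :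
    TangentToOrbit η a ↔ ∃ X : ∀ x : M, TangentSpace 𝓘(ℝ, E) x, IsSmoothField X ∧ a = d (contr X η) := by
  refine exists_congr fun X => and_congr_right fun hX => ⟨fun h => ?_, fun h x v => ?_⟩
  · funext x
    refine ContinuousAlternatingMap.ext fun v => ?_
    rw [h x v, lieDeriv_eq hX hη hd]
  · rw [h, lieDeriv_eq hX hη hd]

end Fields

section Types

variable {M : Type*} [TopologicalSpace M] [ChartedSpace E M] [IsManifold 𝓘(ℂ, E) ω M]
variable {F : Type*} [NormedAddCommGroup F] [NormedSpace ℝ F]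

theorem IsSmooth.smul {p : ℕ} {η : Form M p F} (t : ℝ) (h : IsSmooth η) : IsSmooth (t • η) :=
  fun c => (h c).const_smul t

theorem d_smul {p : ℕ} (t : ℝ) {η : Form M p F} (h : IsSmooth η) : d (t • η) = t • d η := by
  refine form_ext fun c y hy => ?_
  rw [inChart_d (h.smul t) hy, inChart_smul, inChart_d h hy, ← extDeriv_smul]
  rfl

theorem val_add {p : ℕ} (η η' : Form M p F) (x : M) : val (η + η') x = val η x + val η' x := rfl

theorem val_zero {p : ℕ} (x : M) : val (0 : Form M p F) x = 0 := rfl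

theorem val_smul {p : ℕ} (t : ℝ) (η : Form M p F) (x : M) : val (t • η) x = t • val η x := rfl

theorem form_ext_val {p : ℕ} {η η' : Form M p F} (h : ∀ x, val η x = val η' x) : η = η' := funext h

/-! ### The type decomposition on a manifold -/

theorem val_typeProj {p : ℕ} (a b : ℕ) (η : Form M p ℂ) (x : M) :
    val (typeProj a b η) x = typePart a b (val η x) := rfl

theorem inChart_typeProj {p : ℕ} (a b : ℕ) (η : Form M p ℂ) {c : M} {y : E}
    (hy : y ∈ (chartAt E c).target) :
    inChart (typeProj a b η) c y = typePart a b (inChart η c y) := by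
  rw [inChart_eq _ hy, inChart_eq _ hy, val_typeProj, fderiv_trans_restrict (mem_transDom_symm hy),
    typePart_comp]

theorem IsSmooth.typeProj {p : ℕ} {η : Form M p ℂ} (h : IsSmooth η) (a b : ℕ) :
    IsSmooth (typeProj a b η) := fun c =>
  ((typePartL p a b).contDiff.comp_contDiffOn (h c)).congr fun _ hy => inChart_typeProj a b η hy

theorem typeProj_add {p : ℕ} (a b : ℕ) (η η' : Form M p ℂ) :
    typeProj a b (η + η') = typeProj a b η + typeProj a b η' :=
  form_ext_val fun x => (typePartL p a b).map_add (val η x) (val η' x)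

theorem typeProj_neg {p : ℕ} (a b : ℕ) (η : Form M p ℂ) :
    typeProj a b (-η) = -typeProj a b η :=
  form_ext_val fun x => (typePartL p a b).map_neg (val η x)

theorem typeProj_zero {p : ℕ} (a b : ℕ) : typeProj a b (0 : Form M p ℂ) = 0 :=
  form_ext_val fun _ => (typePartL p a b).map_zero

theorem sum_antidiagonal_one {A : Type*} [AddCommMonoid A] (f : ℕ × ℕ → A) :
    ∑ ab ∈ Finset.HasAntidiagonal.antidiagonal 1, f ab = f (0, 1) + f (1, 0) := by
  rw [Finset.Nat.sum_antidiagonal_eq_sum_range_succ_mk]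
  simp [Finset.sum_range_succ]

theorem sum_antidiagonal_two {A : Type*} [AddCommMonoid A] (f : ℕ × ℕ → A) :
    ∑ ab ∈ Finset.HasAntidiagonal.antidiagonal 2, f ab = f (0, 2) + f (1, 1) + f (2, 0) := by
  rw [Finset.Nat.sum_antidiagonal_eq_sum_range_succ_mk]
  simp [Finset.sum_range_succ]

theorem sum_antidiagonal_three {A : Type*} [AddCommMonoid A] (f : ℕ × ℕ → A) :
    ∑ ab ∈ Finset.HasAntidiagonal.antidiagonal 3, f ab = f (0, 3) + f (1, 2) + f (2, 1) + f (3, 0) := by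
  rw [Finset.Nat.sum_antidiagonal_eq_sum_range_succ_mk]
  simp [Finset.sum_range_succ]

theorem typeProj_two (η : Form M 2 ℂ) :
    η = typeProj 0 2 η + typeProj 1 1 η + typeProj 2 0 η := by
  refine form_ext_val fun x => ?_
  have h := sum_typePart (val η x)
  rw [sum_antidiagonal_two] at h
  exact h.symm

theorem typeProj_three (η : Form M 3 ℂ) :
    η = typeProj 0 3 η + typeProj 1 2 η + typeProj 2 1 η + typeProj 3 0 η := by
  refine form_ext_val fun x => ?_
  have h := sum_typePart (val η x)
  rw [sum_antidiagonal_three] at h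
  exact h.symm

/-- Forms of type `(a, b)`. -/
def OfType {p : ℕ} (a b : ℕ) (η : Form M p ℂ) : Prop :=
  a + b = p ∧ ∀ x, HasWeight ((a : ℤ) - b) (val η x)

theorem ofType_typeProj {p a b : ℕ} (hab : a + b = p) (η : Form M p ℂ) :
    OfType a b (typeProj a b η) := ⟨hab, fun x => hasWeight_typePart hab (val η x)⟩

theorem OfType.typeProj_self {p a b : ℕ} {η : Form M p ℂ} (h : OfType a b η) : typeProj a b η = η :=
  form_ext_val fun x => (h.2 x).typePart_self h.1

theorem OfType.typeProj_of_ne {p a b a' b' : ℕ} {η : Form M p ℂ} (h : OfType a b η) (hab : a' + b' = p)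
    (hne : a' ≠ a) : typeProj a' b' η = 0 :=
  form_ext_val fun x => (h.2 x).typePart_of_ne hab h.1 hne

theorem OfType.hasWeight_inChart {p a b : ℕ} {η : Form M p ℂ} (h : OfType a b η) {c : M} {y : E}
    (hy : y ∈ (chartAt E c).target) : HasWeight ((a : ℤ) - b) (inChart η c y) := by
  rw [inChart_eq _ hy, fderiv_trans_restrict (mem_transDom_symm hy)]
  exact (h.2 _).comp _

theorem OfType.exists_d {p a b : ℕ} {η : Form M p ℂ} (h : OfType a b η) (x : M) :
    ∃ A B : E [⋀^Fin (p + 1)]→L[ℝ] ℂ, HasWeight ((a : ℤ) - b + 1) A ∧ HasWeight ((a : ℤ) - b - 1) B ∧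
      val (d η) x = A + B := by
  rw [d_apply]
  exact exists_extDeriv_weight (Filter.eventually_of_mem (target_mem_nhds (mem_chart_target E x))
    fun y hy => h.hasWeight_inChart hy)

theorem OfType.typeProj_d {p a b a' b' : ℕ} {η : Form M p ℂ} (h : OfType a b η) (hab : a' + b' = p + 1)
    (h1 : a' ≠ a) (h2 : a' ≠ a + 1) : typeProj a' b' (d η) = 0 := by
  refine form_ext_val fun x => ?_
  obtain ⟨A, B, hA, hB, hAB⟩ := h.exists_d x
  have hp := h.1
  have hA' : HasWeight (((a + 1 : ℕ) : ℤ) - (b : ℕ)) A := by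
    convert hA using 1; push_cast; ring
  have hB' : HasWeight (((a : ℕ) : ℤ) - ((b + 1 : ℕ) : ℤ)) B := by
    convert hB using 1; push_cast; ring
  have e := (typePartL (p + 1) a' b').map_add A B
  rw [typePartL_apply, typePartL_apply, typePartL_apply,
    hA'.typePart_of_ne hab (by omega) h2, hB'.typePart_of_ne hab (by omega) h1, add_zero] at e
  rw [val_typeProj, hAB, e, val_zero]

theorem typeProj_mapForm_conj {p a b : ℕ} (η : Form M p ℂ) :
    typeProj b a (mapForm (Complex.conjCLE : ℂ →L[ℝ] ℂ) η) =
      mapForm (Complex.conjCLE : ℂ →L[ℝ] ℂ) (typeProj a b η) :=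
  form_ext_val fun x => (conjForm_typePart (val η x)).symm

theorem OfType.conj {p a b : ℕ} {η : Form M p ℂ} (h : OfType a b η) :
    OfType b a (mapForm (Complex.conjCLE : ℂ →L[ℝ] ℂ) η) := by
  refine ⟨by rw [add_comm]; exact h.1, fun x => ?_⟩
  have := (h.2 x).conj
  rwa [neg_sub] at this

/-- The real part of a form. -/
def reForm {p : ℕ} (η : Form M p ℂ) : Form M p ℝ := mapForm Complex.reCLM η

/-- The imaginary part of a form. -/
def imForm {p : ℕ} (η : Form M p ℂ) : Form M p ℝ := mapForm Complex.imCLM η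

/-- The complex conjugate of a form. -/
def cjForm {p : ℕ} (η : Form M p ℂ) : Form M p ℂ := mapForm (Complex.conjCLE : ℂ →L[ℝ] ℂ) η

theorem mapForm_add {G : Type*} [NormedAddCommGroup G] [NormedSpace ℝ G] {p : ℕ} (L : F →L[ℝ] G)
    (η η' : Form M p F) : mapForm L (η + η') = mapForm L η + mapForm L η' :=
  form_ext_val fun x => ContinuousAlternatingMap.ext fun v => L.map_add (val η x v) (val η' x v)

theorem mapForm_sub {G : Type*} [NormedAddCommGroup G] [NormedSpace ℝ G] {p : ℕ} (L : F →L[ℝ] G)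
    (η η' : Form M p F) : mapForm L (η - η') = mapForm L η - mapForm L η' :=
  form_ext_val fun x => ContinuousAlternatingMap.ext fun v => L.map_sub (val η x v) (val η' x v)

theorem mapForm_smul {G : Type*} [NormedAddCommGroup G] [NormedSpace ℝ G] {p : ℕ} (L : F →L[ℝ] G)
    (t : ℝ) (η : Form M p F) : mapForm L (t • η) = t • mapForm L η :=
  form_ext_val fun x => ContinuousAlternatingMap.ext fun v => L.map_smul t (val η x v)

theorem reForm_cjForm {p : ℕ} (η : Form M p ℂ) : reForm (cjForm η) = reForm η :=
  form_ext_val fun _ => ContinuousAlternatingMap.ext fun _ => Complex.conj_re _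

theorem eq_zero_of_reForm_imForm {p : ℕ} {η : Form M p ℂ} (h1 : reForm η = 0) (h2 : imForm η = 0) :
    η = 0 := by
  refine form_ext_val fun x => ContinuousAlternatingMap.ext fun v => Complex.ext ?_ ?_
  · exact congrArg (fun α : Form M p ℝ => val α x v) h1
  · exact congrArg (fun α : Form M p ℝ => val α x v) h2

/-! ### Consequences of the `∂∂̄`-lemma -/

/-- The (0,3)-part of du is minus that of dw, which is zero because dw has type (2,1) + (1,2). -/
theorem d_eq_typeProj_one_two {u w : Form M 2 ℂ} (hu : IsSmooth u) (hw : IsSmooth w)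
    (hut : OfType 0 2 u) (hwt : OfType 1 1 w) (h : d (u + w) = 0) : typeProj 1 2 (d u) = d u := by
  have h1 : d u = - d w := by
    rw [d_add hu hw] at h
    exact eq_neg_of_add_eq_zero_left h
  have h2 : typeProj 0 3 (d u) = 0 := by
    rw [h1, typeProj_neg, hwt.typeProj_d (by norm_num) (by norm_num) (by norm_num), neg_zero]
  conv_rhs => rw [typeProj_three (d u)]
  rw [h2, hut.typeProj_d (a' := 2) (b' := 1) (by norm_num) (by norm_num) (by norm_num),
    hut.typeProj_d (a' := 3) (b' := 0) (by norm_num) (by norm_num) (by norm_num), zero_add, add_zero,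
    add_zero]

theorem d_eq_typeProj_two_one {v w : Form M 2 ℂ} (hv : IsSmooth v) (hw : IsSmooth w)
    (hvt : OfType 1 1 v) (hwt : OfType 2 0 w) (h : d (v + w) = 0) : typeProj 2 1 (d v) = d v := by
  have h1 : d v = - d w := by
    rw [d_add hv hw] at h
    exact eq_neg_of_add_eq_zero_left h
  have h2 : typeProj 1 2 (d v) = 0 := by
    rw [h1, typeProj_neg, hwt.typeProj_d (by norm_num) (by norm_num) (by norm_num), neg_zero]
  conv_rhs => rw [typeProj_three (d v)]
  rw [h2, hvt.typeProj_d (a' := 0) (b' := 3) (by norm_num) (by norm_num) (by norm_num),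
    hvt.typeProj_d (a' := 3) (b' := 0) (by norm_num) (by norm_num) (by norm_num), zero_add, zero_add,
    add_zero]

/-- Write D = u + (its (1,1)-part) and D' = v + w by type. As D and D' are closed, du is purely of
type (1,2) and dv purely of type (2,1), so ∂(u + v) = du + dv, and dv = -dw. It is applied to the
differentials of the (0,1)- and (1,0)-parts of a 1-form. -/
theorem del_typeProj_add {D D' : Form M 2 ℂ} (sD : IsSmooth D) (sD' : IsSmooth D')
    (h : typeProj 2 0 D = 0) (h' : typeProj 0 2 D' = 0) (hd : d D = 0) (hd' : d D' = 0) :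
    del (typeProj 0 2 D + typeProj 1 1 D') = d (typeProj 0 2 D) - d (typeProj 2 0 D') := by
  have e : typeProj 0 2 D + typeProj 1 1 D = D := by
    conv_rhs => rw [typeProj_two D]
    rw [h, add_zero]
  have e' : typeProj 1 1 D' + typeProj 2 0 D' = D' := by
    conv_rhs => rw [typeProj_two D']
    rw [h', zero_add]
  have tu : OfType 0 2 (typeProj 0 2 D) := ofType_typeProj (by norm_num) D
  have tv : OfType 1 1 (typeProj 1 1 D') := ofType_typeProj (by norm_num) D'
  have tw : OfType 2 0 (typeProj 2 0 D') := ofType_typeProj (by norm_num) D'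
  have hu : typeProj 1 2 (d (typeProj 0 2 D)) = d (typeProj 0 2 D) :=
    d_eq_typeProj_one_two (sD.typeProj _ _) (sD.typeProj _ _) tu (ofType_typeProj (by norm_num) D)
      (by rw [e, hd])
  have hd1 : d (typeProj 1 1 D' + typeProj 2 0 D') = 0 := by rw [e', hd']
  have hv : typeProj 2 1 (d (typeProj 1 1 D')) = d (typeProj 1 1 D') :=
    d_eq_typeProj_two_one (sD'.typeProj _ _) (sD'.typeProj _ _) tv tw hd1
  rw [d_add (sD'.typeProj _ _) (sD'.typeProj _ _)] at hd1
  generalize typeProj 0 2 D = u at *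
  generalize typeProj 1 1 D' = v at *
  generalize typeProj 2 0 D' = w at *
  rw [del, sum_antidiagonal_two]
  dsimp only
  rw [typeProj_add 0 2, typeProj_add 1 1, typeProj_add 2 0, tu.typeProj_self, tv.typeProj_self,
    tv.typeProj_of_ne (a' := 0) (b' := 2) (by norm_num) (by norm_num),
    tv.typeProj_of_ne (a' := 2) (b' := 0) (by norm_num) (by norm_num),
    tu.typeProj_of_ne (a' := 1) (b' := 1) (by norm_num) (by norm_num),
    tu.typeProj_of_ne (a' := 2) (b' := 0) (by norm_num) (by norm_num), add_zero, zero_add, add_zero,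
    d_zero, typeProj_zero, add_zero, zero_add v]
  refine (congrArg₂ (· + ·) hu hv).trans ?_
  rw [eq_neg_of_add_eq_zero_left hd1, sub_eq_add_neg]

/-- `∂∂̄` of a `1`-form is the differential of a sum of forms of type `(0, 2)` and `(2, 0)`. -/
theorem exists_of_del_delbar {β : Form M 1 ℂ} (hβ : IsSmooth β) :
    ∃ u w : Form M 2 ℂ, IsSmooth u ∧ IsSmooth w ∧ OfType 0 2 u ∧ OfType 2 0 w ∧
      del (delbar β) = d u - d w := by
  have t01 : OfType 0 1 (typeProj 0 1 β) := ofType_typeProj (by norm_num) β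
  have t10 : OfType 1 0 (typeProj 1 0 β) := ofType_typeProj (by norm_num) β
  have sD : IsSmooth (d (typeProj 0 1 β)) := (hβ.typeProj 0 1).d
  have sD' : IsSmooth (d (typeProj 1 0 β)) := (hβ.typeProj 1 0).d
  have h1 : delbar β = typeProj 0 2 (d (typeProj 0 1 β)) + typeProj 1 1 (d (typeProj 1 0 β)) := by
    rw [delbar, sum_antidiagonal_one]
  refine ⟨typeProj 0 2 (d (typeProj 0 1 β)), typeProj 2 0 (d (typeProj 1 0 β)), sD.typeProj _ _,
    sD'.typeProj _ _, ofType_typeProj (by norm_num) _, ofType_typeProj (by norm_num) _, ?_⟩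
  rw [h1]
  exact del_typeProj_add sD sD'
    (t01.typeProj_d (a' := 2) (b' := 0) (by norm_num) (by norm_num) (by norm_num))
    (t10.typeProj_d (a' := 0) (b' := 2) (by norm_num) (by norm_num) (by norm_num))
    (d_d (hβ.typeProj 0 1)) (d_d (hβ.typeProj 1 0))

/-- Under the `∂∂̄`-lemma, a form `α = dχ` with `χ` of type `(1, 1)` whose component of type `(2, 1)`
is closed, as well as that of type `(1, 2)`, has a primitive of type `(0, 2) + (2, 0)`. -/
theorem DdbarLemma.exists_primitive (hM : DdbarLemma M) {χ : Form M 2 ℂ} (hχ : IsSmooth χ)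
    (hχt : OfType 1 1 χ) (h1 : d (typeProj 2 1 (d χ)) = 0) (h2 : d (typeProj 1 2 (d χ)) = 0) :
    ∃ u w : Form M 2 ℂ, IsSmooth u ∧ IsSmooth w ∧ OfType 0 2 u ∧ OfType 2 0 w ∧ d χ = d u - d w := by
  have h3 : typeProj 3 0 (d χ) = 0 := hχt.typeProj_d (by norm_num) (by norm_num) (by norm_num)
  have h4 : typeProj 0 3 (d χ) = 0 := hχt.typeProj_d (by norm_num) (by norm_num) (by norm_num)
  obtain ⟨β, hβ, h⟩ := hM 1 (d χ) ⟨χ, hχ, rfl⟩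
    (by
      change del (p := 3) (d χ) = 0
      rw [del, sum_antidiagonal_three]
      dsimp only
      rw [h1, h2, h3, h4, d_zero]
      simp only [typeProj_zero, add_zero])
    (by
      change delbar (p := 3) (d χ) = 0
      rw [delbar, sum_antidiagonal_three]
      dsimp only
      rw [h1, h2, h3, h4, d_zero]
      simp only [typeProj_zero, add_zero])
  obtain ⟨u, w, hu, hw, tu, tw, huw⟩ := exists_of_del_delbar hβ
  exact ⟨u, w, hu, hw, tu, tw, h.trans huw⟩

end Types

/-! ### Forms of degree and weight two -/

theorem map_pair_add_left (Y : E [⋀^Fin 2]→L[ℝ] ℂ) (u u' v : E) :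
    Y ![u + u', v] = Y ![u, v] + Y ![u', v] := by
  have h := Y.toMultilinearMap.map_update_add ![u, v] 0 u u'
  have e : ∀ x, Function.update ![u, v] 0 x = ![x, v] := fun x => by
    funext i; fin_cases i <;> rfl
  rw [e, e, e] at h
  exact h

theorem map_pair_smul_left (Y : E [⋀^Fin 2]→L[ℝ] ℂ) (c : ℝ) (u v : E) :
    Y ![c • u, v] = c * Y ![u, v] := by
  have h := Y.toMultilinearMap.map_update_smul ![u, v] 0 c u
  have e : ∀ x, Function.update ![u, v] 0 x = ![x, v] := fun x => by
    funext i; fin_cases i <;> rfl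
  rw [e, e] at h
  exact h

theorem map_pair_swap (Y : E [⋀^Fin 2]→L[ℝ] ℂ) (u v : E) : Y ![u, v] = - Y ![v, u] := by
  have h := Y.toAlternatingMap.map_swap ![v, u] (i := 0) (j := 1) (by decide)
  have e : (![v, u] ∘ Equiv.swap 0 1 : Fin 2 → E) = ![u, v] := by
    funext i; fin_cases i <;> rfl
  rw [e] at h
  exact h

theorem HasWeight.apply_pair {k : ℤ} {α : E [⋀^Fin 2]→L[ℝ] ℂ} (h : HasWeight k α) (z : ℂ) (hz : ‖z‖ = 1)
    (u v : E) : α ![z • u, z • v] = z ^ k * α ![u, v] := by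
  rw [← h z hz]
  congr 1
  funext i
  fin_cases i <;> rfl

theorem HasWeight.linear_of_two {γ : E [⋀^Fin 2]→L[ℝ] ℂ} (h : HasWeight 2 γ) (u v : E) :
    γ ![Complex.I • u, v] = Complex.I * γ ![u, v] := by
  have hII : Complex.I ^ 2 = -1 := Complex.I_sq
  have add₁ : ∀ u v v', γ ![u, v + v'] = γ ![u, v] + γ ![u, v'] := fun u v v' => by
    rw [map_pair_swap, map_pair_add_left, map_pair_swap γ u v, map_pair_swap γ u v']; ring
  have smul₁ : ∀ (c : ℝ) u v, γ ![u, c • v] = c * γ ![u, v] := fun c u v => by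
    rw [map_pair_swap, map_pair_smul_left, map_pair_swap γ u v]; ring
  have rot : ∀ u v, γ ![Complex.I • u, Complex.I • v] = - γ ![u, v] := fun u v => by
    rw [h.apply_pair Complex.I Complex.norm_I, show (2 : ℤ) = ((2 : ℕ) : ℤ) from rfl, zpow_natCast, hII]
    ring
  have der : ∀ u v, γ ![Complex.I • u, v] + γ ![u, Complex.I • v] = 2 * Complex.I * γ ![u, v] := fun u v => by
    have e := h.apply_pair _ norm_pythagorean u v
    rw [pythagorean_smul, pythagorean_smul, map_pair_add_left, add₁, add₁, map_pair_smul_left,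
      map_pair_smul_left, map_pair_smul_left, map_pair_smul_left, smul₁, smul₁, smul₁, smul₁, rot,
      pythagorean_eq, show (2 : ℤ) = ((2 : ℕ) : ℤ) from rfl, zpow_natCast] at e
    push_cast at e
    linear_combination (25 / 12) * e + (4 / 3) * γ ![u, v] * hII
  have d := der u (Complex.I • v)
  rw [I_smul_I_smul, smul₁, rot] at d
  push_cast at d
  have d0 := der u v
  linear_combination d0 - (Complex.I / 2) * d - γ ![u, Complex.I • v] * hII

/-- Forms of degree and weight two are contractions of the holomorphic volume form. -/
theorem HasWeight.eq_contraction {γ : E [⋀^Fin 2]→L[ℝ] ℂ} (h : HasWeight 2 γ) (v w : E) :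
    γ ![v, w] = stdForm ![fun k => γ ![Pi.single (k + 1) 1, Pi.single (k + 2) 1], v, w] := by
  have gsmul : ∀ (c : ℂ) u v, γ ![c • u, v] = c * γ ![u, v] := fun c u v =>
    complex_smul_of_I_smul (fun u => γ ![u, v]) (fun a b => map_pair_add_left γ a b v)
      (fun c u => map_pair_smul_left γ c u v) (fun u => h.linear_of_two u v) c u
  let B : E →ₗ[ℂ] E →ₗ[ℂ] ℂ := LinearMap.mk₂ ℂ (fun v w => γ ![v, w]) (map_pair_add_left γ)
    gsmul (fun a b c => by
      rw [map_pair_swap, map_pair_add_left, map_pair_swap γ a b, map_pair_swap γ a c]; ring)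
    (fun c a b => by rw [map_pair_swap, gsmul, map_pair_swap γ a b, smul_eq_mul]; ring)
  exact bilinear_eq_stdForm B
    (fun v => γ.map_eq_zero_of_eq ![v, v] (i := 0) (j := 1) rfl (by decide)) v w

theorem stdForm_single (u : E) (k : Fin 3) :
    stdForm ![u, Pi.single (k + 1) 1, Pi.single (k + 2) 1] = u k := by
  rw [stdForm_apply]
  erw [Matrix.det_fin_three]
  fin_cases k <;> simp

/-! ### Holomorphic volume forms and their contractions -/

section Holomorphic

variable {M : Type*} [TopologicalSpace M] [ChartedSpace E M] [IsManifold 𝓘(ℂ, E) ω M]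

/-- The coefficient of a holomorphic `3`-form in a chart. -/
def hcoeff (Ωc : Form M 3 ℂ) (c : M) (y : E) : ℂ :=
  inChart Ωc c y ![Pi.single 0 1, Pi.single 1 1, Pi.single 2 1]

theorem update_vec_zero (u v w x : E) : Function.update ![u, v, w] 0 x = ![x, v, w] := by
  funext i; fin_cases i <;> rfl

theorem IsHolomorphicForm.inChart_eq_smul {Ωc : Form M 3 ℂ} (h : IsHolomorphicForm Ωc) {c : M} {y : E}
    (hy : y ∈ (chartAt E c).target) : inChart Ωc c y = hcoeff Ωc c y • stdForm := by
  refine eq_smul_stdForm _ fun u v w => ?_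
  rw [inChart_eq _ hy, fderiv_trans_restrict (mem_transDom_symm hy)]
  set g := fderiv ℂ (trans c ((chartAt E c).symm y)) y
  have e : ∀ a b c : E, (fun i => g ((![a, b, c] : Fin 3 → E) i)) = ![g a, g b, g c] := fun a b c => by
    funext i; fin_cases i <;> rfl
  have h1 : val Ωc ((chartAt E c).symm y) (Function.update ![g u, g v, g w] 0 (Complex.I • g u)) =
      Complex.I * val Ωc ((chartAt E c).symm y) ![g u, g v, g w] :=
    h.1 ((chartAt E c).symm y) ![g u, g v, g w] 0
  rw [update_vec_zero] at h1
  change val Ωc _ (fun i => g ((![Complex.I • u, v, w] : Fin 3 → E) i)) =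
    Complex.I * val Ωc _ (fun i => g ((![u, v, w] : Fin 3 → E) i))
  rw [e, e, map_smul]
  exact h1

theorem hcoeff_ne_zero {Ωc : Form M 3 ℂ} (h : IsHolomorphicForm Ωc) (hne : ∀ x, Ωc x ≠ 0) {c : M} {y : E}
    (hy : y ∈ (chartAt E c).target) : hcoeff Ωc c y ≠ 0 := by
  intro h0
  have h1 := h.inChart_eq_smul hy
  rw [h0, zero_smul, inChart_eq _ hy] at h1
  refine hne ((chartAt E c).symm y) (ContinuousAlternatingMap.ext fun v => ?_)
  have h2 := congrArg (fun α : E [⋀^Fin 3]→L[ℝ] ℂ =>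
    α fun i => (transEquiv (mem_transDom_symm hy)).symm (v i)) h1
  simp only [ContinuousAlternatingMap.compContinuousLinearMap_apply] at h2
  have h3 : (fun i => fderiv ℝ (trans c ((chartAt E c).symm y)) y
      ((transEquiv (mem_transDom_symm hy)).symm (v i))) = v :=
    funext fun i => (transEquiv (mem_transDom_symm hy)).apply_symm_apply (v i)
  change val Ωc _ (fun i => fderiv ℝ (trans c ((chartAt E c).symm y)) y
      ((transEquiv (mem_transDom_symm hy)).symm (v i))) = _ at h2
  rw [h3] at h2
  exact h2

theorem IsHolomorphicForm.isSmooth {p : ℕ} {Ωc : Form M p ℂ} (h : IsHolomorphicForm Ωc) : IsSmooth Ωc :=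
  isSmooth_of_contDiffAt fun c y hy => ((h.2 c y hy).contDiffAt (n := ∞)).restrict_scalars ℝ

/-- The left side is a complex multilinear alternating 4-form on ℂ³, so it vanishes: four vectors
are linearly dependent. -/
theorem alternatize_smul_stdForm (g : E →L[ℂ] ℂ) (L : E →L[ℝ] E [⋀^Fin 3]→L[ℝ] ℂ)
    (hL : ∀ u, L u = g u • stdForm) : ContinuousAlternatingMap.alternatizeUncurryFin L = 0 := by
  ext v
  let D : E [⋀^Fin 3]→ₗ[ℂ] ℂ := Matrix.detRowAlternating
  have h1 : AlternatingMap.alternatizeUncurryFin ((g : E →ₗ[ℂ] ℂ).smulRight D) v = 0 := by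
    refine AlternatingMap.map_linearDependent _ _ fun hv => ?_
    have := hv.fintype_card_le_finrank
    simp at this
  rw [AlternatingMap.alternatizeUncurryFin_apply] at h1
  rw [ContinuousAlternatingMap.alternatizeUncurryFin_apply]
  refine Eq.trans (Finset.sum_congr rfl fun i _ => ?_) h1
  rw [hL]
  rfl

/-- The derivative of the holomorphic coefficient is complex linear, so dΩᶜ is a form of type (4,0)
in three complex dimensions. -/
theorem IsHolomorphicForm.d_eq_zero {Ωc : Form M 3 ℂ} (h : IsHolomorphicForm Ωc) : d Ωc = 0 := by
  refine form_ext fun c y hy => ?_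
  rw [inChart_d h.isSmooth hy, inChart_zero]
  have h1 : AnalyticAt ℂ (inChart Ωc c) y := h.2 c y hy
  have h2 : DifferentiableAt ℂ (inChart Ωc c) y := h1.differentiableAt
  let ev : (E [⋀^Fin 3]→L[ℝ] ℂ) →L[ℂ] ℂ :=
    LinearMap.mkContinuousOfExistsBound
      { toFun := fun α => α ![Pi.single 0 1, Pi.single 1 1, Pi.single 2 1]
        map_add' := fun _ _ => rfl
        map_smul' := fun _ _ => rfl }
      ⟨∏ i, ‖(![Pi.single 0 1, Pi.single 1 1, Pi.single 2 1] : Fin 3 → E) i‖, fun α => by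
        rw [mul_comm]; exact α.le_opNorm _⟩
  have h3 : DifferentiableAt ℂ (hcoeff Ωc c) y := ev.differentiableAt.comp y h2
  have h4 : inChart Ωc c =ᶠ[nhds y] fun z => hcoeff Ωc c z • stdForm :=
    Filter.eventuallyEq_of_mem (target_mem_nhds hy) fun z hz => h.inChart_eq_smul hz
  refine alternatize_smul_stdForm (fderiv ℂ (hcoeff Ωc c) y) _ fun u => ?_
  rw [h2.fderiv_restrictScalars ℝ, h4.fderiv_eq]
  have h5 := h3.hasFDerivAt.smul_const stdForm
  rw [h5.fderiv]
  rfl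

theorem val_eq_re_smul {Ωc : Form M 3 ℂ} (h : IsHolomorphicForm Ωc) (hne : ∀ x, Ωc x ≠ 0) (x : M) :
    ∃ c : ℂ, c ≠ 0 ∧ val Ωc x = c • stdForm := by
  refine ⟨_, hcoeff_ne_zero h hne (mem_chart_target E x), ?_⟩
  rw [← inChart_self, h.inChart_eq_smul (mem_chart_target E x)]

/-- `J` maps the real part of a form of type `(2, 1) + (3, 0)` to a multiple of its imaginary part. -/
theorem formJ_reForm {Ωc : Form M 3 ℂ} (h : IsHolomorphicForm Ωc) (hne : ∀ x, Ωc x ≠ 0)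
    {γ : Form M 3 ℂ} (hγ : ∀ x, ∃ A B, HasWeight 3 A ∧ HasWeight 1 B ∧ val γ x = A + B) :
    formJ (reForm Ωc) (reForm γ) = qConst • imForm γ := by
  refine form_ext_val fun x => ?_
  obtain ⟨c, hc, hx⟩ := val_eq_re_smul h hne x
  obtain ⟨A, B, hA, hB, hAB⟩ := hγ x
  have h1 : val (reForm Ωc) x = Complex.reCLM.compContinuousAlternatingMap (c • stdForm) := by
    rw [← hx]; rfl
  have h2 : val (reForm γ) x = Complex.reCLM.compContinuousAlternatingMap A +
      Complex.reCLM.compContinuousAlternatingMap B := by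
    change Complex.reCLM.compContinuousAlternatingMap (val γ x) = _
    rw [hAB]
    exact ContinuousAlternatingMap.ext fun v => Complex.reCLM.map_add (A v) (B v)
  have h3 : val (imForm γ) x = Complex.imCLM.compContinuousAlternatingMap A +
      Complex.imCLM.compContinuousAlternatingMap B := by
    change Complex.imCLM.compContinuousAlternatingMap (val γ x) = _
    rw [hAB]
    exact ContinuousAlternatingMap.ext fun v => Complex.imCLM.map_add (A v) (B v)
  rw [val_smul, h3, smul_add, ← J_re_of_weight hc (Or.inr hA), ← J_re_of_weight hc (Or.inl hB), ← map_add,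
    ← h2, ← h1]
  rfl

/-! ### Vector fields and forms of type `(2, 0)` -/

theorem val_contr {F : Type*} [NormedAddCommGroup F] [NormedSpace ℝ F] {p : ℕ}
    (X : ∀ x : M, TangentSpace 𝓘(ℝ, E) x) (η : Form M (p + 1) F) (x : M) :
    val (contr X η) x = (val η x).curryLeft (fieldVal X x) := rfl

theorem hasWeight_contr {Ωc : Form M 3 ℂ} (h : IsHolomorphicForm Ωc)
    (X : ∀ x : M, TangentSpace 𝓘(ℝ, E) x) : OfType 2 0 (contr X Ωc) := by
  refine ⟨rfl, fun x z hz v => ?_⟩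
  have hx := h.inChart_eq_smul (mem_chart_target E x)
  rw [inChart_self] at hx
  have e1 : ∀ w : Fin 2 → E, val (contr X Ωc) x w =
      hcoeff Ωc x (chartAt E x x) * stdForm ![fieldVal X x, w 0, w 1] := fun w => by
    have e2 : Matrix.vecCons (fieldVal X x) w = ![fieldVal X x, w 0, w 1] := by
      funext i; fin_cases i <;> rfl
    rw [val_contr, ContinuousAlternatingMap.curryLeft_apply_apply, e2, hx]
    rfl
  rw [e1, e1, stdForm_apply, stdForm_apply]
  erw [Matrix.det_fin_three, Matrix.det_fin_three]
  simp only [Matrix.cons_val, Pi.smul_apply, smul_eq_mul]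
  rw [show (((2 : ℕ) : ℤ) - ((0 : ℕ) : ℤ)) = ((2 : ℕ) : ℤ) by norm_num, zpow_natCast]
  ring

/-- Contraction with a nonzero (3,0)-form can be inverted explicitly: the k-th coordinate of X is ν
on the next two basis vectors in cyclic order, divided by the coefficient of Ωᶜ. The same formula
holds throughout a chart, so X is smooth. -/
theorem exists_field_of_ofType {Ωc : Form M 3 ℂ} (h : IsHolomorphicForm Ωc) (hne : ∀ x, Ωc x ≠ 0)
    {ν : Form M 2 ℂ} (hν : IsSmooth ν) (hνt : OfType 2 0 ν) :
    ∃ X : ∀ x : M, TangentSpace 𝓘(ℝ, E) x, IsSmoothField X ∧ contr X Ωc = ν := by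
  let f : M → ℂ := fun x => hcoeff Ωc x (chartAt E x x)
  have hf : ∀ x, f x ≠ 0 := fun x => hcoeff_ne_zero h hne (mem_chart_target E x)
  obtain ⟨X, hXv⟩ : ∃ X : ∀ x : M, TangentSpace 𝓘(ℝ, E) x, ∀ x, fieldVal X x = fun k => (f x)⁻¹ * val ν x ![Pi.single (k + 1) 1, Pi.single (k + 2) 1] := ⟨fun x => _, fun x => rfl⟩
  have hX : contr X Ωc = ν := by
    refine form_ext_val fun x => ContinuousAlternatingMap.ext fun w => ?_
    have hx := h.inChart_eq_smul (mem_chart_target E x)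
    rw [inChart_self] at hx
    have e2 : Matrix.vecCons (fieldVal X x) w = ![fieldVal X x, w 0, w 1] := by
      funext i; fin_cases i <;> rfl
    have e3 : w = ![w 0, w 1] := by funext i; fin_cases i <;> rfl
    have h2 : HasWeight 2 (val ν x) := hνt.2 x
    have e4 : val (contr X Ωc) x w = f x * stdForm ![fieldVal X x, w 0, w 1] := by
      rw [val_contr, ContinuousAlternatingMap.curryLeft_apply_apply, hx]
      exact congrArg (fun u => f x * stdForm u) e2
    have e5 : stdForm ![fieldVal X x, w 0, w 1] = (f x)⁻¹ * stdForm
        ![fun k => val ν x ![Pi.single (k + 1) 1, Pi.single (k + 2) 1], w 0, w 1] := by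
      rw [stdForm_apply, stdForm_apply]
      erw [Matrix.det_fin_three, Matrix.det_fin_three]
      simp only [Matrix.cons_val, hXv]
      ring
    rw [e4, e5, ← h2.eq_contraction, mul_inv_cancel_left₀ (hf x), ← e3]
  refine ⟨X, (isSmoothField_iff X).2 fun x => contDiffAt_pi.2 fun k => ?_, hX⟩
  have h1 : (fun y => fieldInChart X x y k) =ᶠ[nhds (chartAt E x x)] fun y =>
      (hcoeff Ωc x y)⁻¹ * inChart ν x y ![Pi.single (k + 1) 1, Pi.single (k + 2) 1] :=
    Filter.eventuallyEq_of_mem (target_mem_nhds (mem_chart_target E x)) fun y hy => by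
      have e : inChart ν x y = inChart (contr X Ωc) x y := by rw [hX]
      rw [e, inChart_contr X Ωc hy, ContinuousAlternatingMap.curryLeft_apply_apply, h.inChart_eq_smul hy]
      have e6 : (hcoeff Ωc x y • stdForm) ![fieldInChart X x y, Pi.single (k + 1) 1, Pi.single (k + 2) 1] =
        hcoeff Ωc x y * stdForm ![fieldInChart X x y, Pi.single (k + 1) 1, Pi.single (k + 2) 1] := rfl
      refine Eq.trans ?_ (congrArg _ e6.symm)
      rw [stdForm_single, inv_mul_cancel_left₀ (hcoeff_ne_zero h hne hy)]
  refine ContDiffAt.congr_of_eventuallyEq ?_ h1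
  have s1 : ContDiffAt ℝ ∞ (hcoeff Ωc x) (chartAt E x x) :=
    contDiffAt_form_apply (w := fun _ => _) (h.isSmooth.contDiffAt (mem_chart_target E x))
      fun _ => contDiffAt_const
  have s2 : ContDiffAt ℝ ∞ (fun y => inChart ν x y ![Pi.single (k + 1) 1, Pi.single (k + 2) 1])
      (chartAt E x x) :=
    contDiffAt_form_apply (w := fun _ => _) (hν.contDiffAt (mem_chart_target E x))
      fun _ => contDiffAt_const
  exact (s1.inv (hf x)).mul s2

/-! ### The kernel of `d J d` -/

/-- The form dν has type (3,0) + (2,1), so J d Re ν = q Im dν = q d Im ν, which is exact. -/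
theorem OfType.formJ_d {Ωc : Form M 3 ℂ} (h : IsHolomorphicForm Ωc) (hne : ∀ x, Ωc x ≠ 0)
    {ν : Form M 2 ℂ} (hν : IsSmooth ν) (hνt : OfType 2 0 ν) :
    d (formJ (reForm Ωc) (d (reForm ν))) = 0 := by
  have h1 : d (reForm ν) = reForm (d ν) := d_mapForm _ hν
  have h2 : formJ (reForm Ωc) (reForm (d ν)) = qConst • imForm (d ν) :=
    formJ_reForm h hne fun x => hνt.exists_d x
  have h3 : imForm (d ν) = d (imForm ν) := (d_mapForm _ hν).symm
  have h4 : IsSmooth (imForm ν) := hν.mapForm _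
  refine (congrArg d ((congrArg _ h1).trans h2)).trans ?_
  rw [h3, d_smul _ h4.d, d_d h4, smul_zero]

/-- Since dΩᶜ = 0, the Lie derivative of Re Ωᶜ along X is d Re(ι_X Ωᶜ), and the forms ι_X Ωᶜ are
exactly the smooth (2,0)-forms. -/
theorem tangentToOrbit_reForm_iff {Ωc : Form M 3 ℂ} (h : IsHolomorphicForm Ωc) (hne : ∀ x, Ωc x ≠ 0)
    (a : Form M 3 ℝ) : TangentToOrbit (reForm Ωc) a ↔
      ∃ ν : Form M 2 ℂ, IsSmooth ν ∧ OfType 2 0 ν ∧ a = d (reForm ν) := by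
  have hs : IsSmooth (reForm Ωc) := h.isSmooth.mapForm _
  have hd : d (reForm Ωc) = 0 := by
    have : d (reForm Ωc) = mapForm Complex.reCLM (d Ωc) := d_mapForm _ h.isSmooth
    rw [this, h.d_eq_zero]
    exact form_ext_val fun x => ContinuousAlternatingMap.ext fun v => Complex.reCLM.map_zero
  refine (tangentToOrbit_iff hs hd).trans ⟨?_, ?_⟩
  · rintro ⟨X, hX, rfl⟩
    exact ⟨contr X Ωc, h.isSmooth.contr hX, hasWeight_contr h X, rfl⟩
  · rintro ⟨ν, hν, hνt, rfl⟩
    obtain ⟨X, hX, rfl⟩ := exists_field_of_ofType h hne hν hνt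
    exact ⟨X, hX, rfl⟩

end Holomorphic

section Kernel

variable {M : Type*} [TopologicalSpace M] [ChartedSpace E M] [IsManifold 𝓘(ℂ, E) ω M]

theorem reForm_add {p : ℕ} (η η' : Form M p ℂ) : reForm (η + η') = reForm η + reForm η' :=
  mapForm_add _ η η'

theorem reForm_sub {p : ℕ} (η η' : Form M p ℂ) : reForm (η - η') = reForm η - reForm η' :=
  mapForm_sub _ η η'

theorem d_reForm {p : ℕ} {η : Form M p ℂ} (h : IsSmooth η) : d (reForm η) = reForm (d η) :=
  d_mapForm _ h

theorem d_imForm {p : ℕ} {η : Form M p ℂ} (h : IsSmooth η) : d (imForm η) = imForm (d η) :=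
  d_mapForm _ h

theorem d_cjForm {p : ℕ} {η : Form M p ℂ} (h : IsSmooth η) : d (cjForm η) = cjForm (d η) :=
  d_mapForm _ h

theorem IsSmooth.reForm {p : ℕ} {η : Form M p ℂ} (h : IsSmooth η) : IsSmooth (reForm η) := h.mapForm _

theorem IsSmooth.imForm {p : ℕ} {η : Form M p ℂ} (h : IsSmooth η) : IsSmooth (imForm η) := h.mapForm _

theorem IsSmooth.cjForm {p : ℕ} {η : Form M p ℂ} (h : IsSmooth η) : IsSmooth (cjForm η) := h.mapForm _

theorem cjForm_zero {p : ℕ} : cjForm (0 : Form M p ℂ) = 0 :=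
  form_ext_val fun _ => ContinuousAlternatingMap.ext fun _ => map_zero (starRingEnd ℂ)

theorem hasWeight_real_smul {p : ℕ} {k : ℤ} {α : E [⋀^Fin p]→L[ℝ] ℂ} (h : HasWeight k α) (t : ℝ) :
    HasWeight k (t • α) := fun z hz v => by
  rw [ContinuousAlternatingMap.smul_apply, ContinuousAlternatingMap.smul_apply, h z hz, mul_smul_comm]

/-- A real `2`-form is the real part of a form of type `(2, 0)` plus a real form of type `(1, 1)`. -/
theorem exists_types_of_real {ψ : Form M 2 ℝ} (hψ : IsSmooth ψ) :
    ∃ μ χ : Form M 2 ℂ, IsSmooth μ ∧ IsSmooth χ ∧ OfType 2 0 μ ∧ OfType 1 1 χ ∧ cjForm χ = χ ∧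
      ψ = reForm (μ + χ) := by
  let ψc : Form M 2 ℂ := mapForm Complex.ofRealCLM ψ
  have hs : IsSmooth ψc := hψ.mapForm _
  have hc : cjForm ψc = ψc :=
    form_ext_val fun x => ContinuousAlternatingMap.ext fun v => Complex.conj_ofReal (val ψ x v)
  have hr : reForm ψc = ψ :=
    form_ext_val fun x => ContinuousAlternatingMap.ext fun v => Complex.ofReal_re (val ψ x v)
  have h02 : typeProj 0 2 ψc = cjForm (typeProj 2 0 ψc) := by
    conv_lhs => rw [← hc]
    exact typeProj_mapForm_conj (a := 2) (b := 0) ψc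
  have h20 : OfType 2 0 (typeProj 2 0 ψc) := ofType_typeProj (by norm_num) ψc
  have hs20 : IsSmooth (typeProj 2 0 ψc) := hs.typeProj 2 0
  -- The (0,2)-part of a real form is conjugate to its (2,0)-part and so has the same real part;
  -- hence the factor 2.
  refine ⟨(2 : ℝ) • typeProj 2 0 ψc, typeProj 1 1 ψc, hs20.smul 2, hs.typeProj 1 1,
    ⟨h20.1, fun x => ?_⟩, ofType_typeProj (by norm_num) ψc, ?_, ?_⟩
  · exact (hasWeight_real_smul (h20.2 x) 2)
  · conv_rhs => rw [← hc]
    exact (typeProj_mapForm_conj (a := 1) (b := 1) ψc).symm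
  · have h1 : reForm ψc = reForm (typeProj 0 2 ψc) + reForm (typeProj 1 1 ψc) + reForm (typeProj 2 0 ψc) := by
      rw [← reForm_add, ← reForm_add, ← typeProj_two]
    have h2 : reForm ((2 : ℝ) • typeProj 2 0 ψc) = (2 : ℝ) • reForm (typeProj 2 0 ψc) := mapForm_smul _ _ _
    rw [← hr, h1, h02, reForm_cjForm, reForm_add, h2, two_smul]
    abel

/-- The use of the ∂∂̄-lemma. Closedness of J dψ says that dμ + 2A has closed imaginary part, and
its real part dψ is closed anyway. Hence the (2,1)-part A of dχ is closed, and so is its conjugate.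
-/
theorem exists_primitive_of_closed (hM : DdbarLemma M) {Ωc : Form M 3 ℂ} (h : IsHolomorphicForm Ωc)
    (hne : ∀ x, Ωc x ≠ 0) {ψ : Form M 2 ℝ} (hψ : IsSmooth ψ)
    (hJ : d (formJ (reForm Ωc) (d ψ)) = 0) :
    ∃ ν : Form M 2 ℂ, IsSmooth ν ∧ OfType 2 0 ν ∧ d ψ = d (reForm ν) := by
  obtain ⟨μ, χ, hμ, hχ, tμ, tχ, hcχ, rfl⟩ := exists_types_of_real hψ
  have sA : IsSmooth (typeProj 2 1 (d χ)) := hχ.d.typeProj 2 1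
  have hsplit : d χ = typeProj 1 2 (d χ) + typeProj 2 1 (d χ) := by
    conv_lhs => rw [typeProj_three (d χ)]
    rw [tχ.typeProj_d (a' := 0) (b' := 3) (by norm_num) (by norm_num) (by norm_num),
      tχ.typeProj_d (a' := 3) (b' := 0) (by norm_num) (by norm_num) (by norm_num), zero_add, add_zero]
  have hcd : cjForm (d χ) = d χ := by rw [← d_cjForm hχ, hcχ]
  have hconj : typeProj 1 2 (d χ) = cjForm (typeProj 2 1 (d χ)) := by
    conv_lhs => rw [← hcd]
    exact typeProj_mapForm_conj (a := 2) (b := 1) (d χ)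
  have tA : OfType (p := 3) 2 1 (typeProj 2 1 (d χ)) := ofType_typeProj (by norm_num) (d χ)
  have hM' := hM.exists_primitive hχ tχ
  rw [hconj] at hM'
  generalize typeProj 2 1 (d χ) = A at *
  have hθ : d (reForm (μ + χ)) = reForm (d μ + (2 : ℝ) • A) := by
    have h2 : reForm ((2 : ℝ) • A) = (2 : ℝ) • reForm A := mapForm_smul _ _ _
    rw [d_reForm (hμ.add hχ), d_add hμ hχ, reForm_add, reForm_add, h2, hsplit, hconj, reForm_add,
      reForm_cjForm, two_smul]
  have sθ : IsSmooth (d μ + (2 : ℝ) • A) := hμ.d.add (sA.smul 2)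
  have hJθ : formJ (reForm Ωc) (reForm (d μ + (2 : ℝ) • A)) = qConst • imForm (d μ + (2 : ℝ) • A) := by
    refine formJ_reForm h hne fun x => ?_
    obtain ⟨B, C, hB, hC, hBC⟩ := tμ.exists_d x
    refine ⟨B, C + (2 : ℝ) • val A x, hB, HasWeight.add hC (hasWeight_real_smul (tA.2 x) 2), ?_⟩
    rw [val_add, hBC, val_smul, add_assoc]
  have him : imForm (d (d μ + (2 : ℝ) • A)) = 0 := by
    have e : d (formJ (reForm Ωc) (d (reForm (μ + χ)))) = d (qConst • imForm (d μ + (2 : ℝ) • A)) :=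
      congrArg d ((congrArg _ hθ).trans hJθ)
    rw [e, d_smul _ sθ.imForm, d_imForm sθ] at hJ
    exact (smul_eq_zero.1 hJ).resolve_left qConst_ne_zero
  have hre : reForm (d (d μ + (2 : ℝ) • A)) = 0 := by
    rw [← d_reForm sθ, ← hθ]
    exact d_d ((hμ.add hχ).mapForm _)
  have hdA : d A = 0 := by
    have e := eq_zero_of_reForm_imForm hre him
    rw [d_add hμ.d (sA.smul 2), d_smul _ sA] at e
    have e2 : d (d μ) = 0 := d_d hμ
    have e3 : (2 : ℝ) • d A = 0 := by
      refine Eq.trans ?_ e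
      rw [e2, zero_add]
    exact (smul_eq_zero.1 e3).resolve_left two_ne_zero
  have hdB : d (cjForm A) = 0 := by rw [d_cjForm sA, hdA, cjForm_zero]
  obtain ⟨u, w, hu, hw, tu, tw, huw⟩ := hM' hdA hdB
  -- Conjugating the (0,2)-form u makes it of type (2,0) without changing its real part.
  refine ⟨μ + cjForm u - w, (hμ.add (hu.cjForm)).sub hw, ?_, ?_⟩
  · refine ⟨rfl, fun x => ?_⟩
    have e : val (μ + cjForm u - w) x = (val μ x + val (cjForm u) x) + (-1 : ℝ) • val w x := by
      rw [neg_one_smul, ← sub_eq_add_neg]; rfl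
    rw [e]
    exact HasWeight.add (HasWeight.add (tμ.2 x) (tu.conj.2 x)) (hasWeight_real_smul (tw.2 x) _)
  · rw [d_reForm (hμ.add hχ), d_add hμ hχ, huw,
      d_reForm ((hμ.add (hu.cjForm)).sub hw), d_sub (hμ.add (hu.cjForm)) hw, d_add hμ (hu.cjForm)]
    rw [d_cjForm hu, reForm_add, reForm_sub, reForm_sub, reForm_add, reForm_cjForm]
    abel

theorem d_formJ_d_eq_zero_iff (hM : DdbarLemma M) {Ωc : Form M 3 ℂ} (h : IsHolomorphicForm Ωc)
    (hne : ∀ x, Ωc x ≠ 0) {ψ : Form M 2 ℝ} (hψ : IsSmooth ψ) :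
    d (formJ (reForm Ωc) (d ψ)) = 0 ↔ TangentToOrbit (reForm Ωc) (d ψ) := by
  rw [tangentToOrbit_reForm_iff h hne]
  refine ⟨exists_primitive_of_closed hM h hne hψ, ?_⟩
  rintro ⟨ν, hν, hνt, e⟩
  rw [e]
  exact hνt.formJ_d h hne hν

end Kernel

section ChartExpressions

variable {M : Type*} [TopologicalSpace M] [ChartedSpace E M] [IsManifold 𝓘(ℂ, E) ω M]

/-! ### Pointwise operations in charts -/

theorem inChart_eq_pullE (Ω : Form M 3 ℝ) {c : M} {y : E} (hy : y ∈ (chartAt E c).target) :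
    inChart Ω c y = pullE (transEquiv (mem_transDom_symm hy)) (val Ω ((chartAt E c).symm y)) :=
  inChart_eq Ω hy

/-- J commutes with pullback by maps of positive determinant, and coordinate changes are such maps.
-/
theorem inChart_formJ (Ω a : Form M 3 ℝ) {c : M} {y : E} (hy : y ∈ (chartAt E c).target) :
    inChart (formJ Ω a) c y = J (inChart Ω c y) (inChart a c y) := by
  rw [inChart_eq_pullE _ hy, inChart_eq_pullE _ hy, inChart_eq_pullE _ hy,
    J_pullE (transEquiv (mem_transDom_symm hy)) (det_fderiv_trans_pos (mem_transDom_symm hy))]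
  rfl

theorem IsSmooth.formJ {Ω a : Form M 3 ℝ} (hΩ : IsSmooth Ω) (ha : IsSmooth a)
    (h : ∀ c : M, ∀ y ∈ (chartAt E c).target, lam (inChart Ω c y) ≠ 0) : IsSmooth (formJ Ω a) := by
  refine isSmooth_of_contDiffAt fun c y hy => ?_
  refine ContDiffAt.congr_of_eventuallyEq ?_ (Filter.eventuallyEq_of_mem (target_mem_nhds hy)
    fun z hz => inChart_formJ Ω a hz)
  exact ((contDiffAt_J (h c y hy)).comp y (hΩ.contDiffAt hy)).clm_apply (ha.contDiffAt hy)

theorem inChart_phiForm (Ω : Form M 3 ℝ) {c : M} {y : E} (hy : y ∈ (chartAt E c).target) :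
    inChart (phiForm Ω) c y frame = phi (inChart Ω c y) := by
  have hpos := det_fderiv_trans_pos (mem_transDom_symm hy)
  rw [inChart_eq_pullE _ hy, pullE_apply, phi_comp, inChart_eq _ hy, coe_transEquiv, abs_of_pos hpos, mul_comm]
  have h1 : frame.det (fun i => (fderiv ℝ (trans c ((chartAt E c).symm y)) y : E →ₗ[ℝ] E) (frame i)) =
      LinearMap.det (fderiv ℝ (trans c ((chartAt E c).symm y)) y : E →ₗ[ℝ] E) := by
    have := frame.det_comp (fderiv ℝ (trans c ((chartAt E c).symm y)) y : E →ₗ[ℝ] E) frame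
    rw [frame.det_self, mul_one] at this
    exact this
  rw [← h1]
  rfl

theorem lam_re_smul_stdForm {w : ℂ} (hw : w ≠ 0) :
    lam (Complex.reCLM.compContinuousAlternatingMap (w • stdForm)) ≠ 0 := by
  intro h
  have h1 := phi_re_smul_stdForm w
  rw [phi, h, abs_zero, Real.sqrt_zero] at h1
  exact mul_ne_zero (Complex.normSq_pos.2 hw).ne' phi_reStd_ne_zero h1.symm

theorem lam_inChart_reForm {Ωc : Form M 3 ℂ} (h : IsHolomorphicForm Ωc) (hne : ∀ x, Ωc x ≠ 0) {c : M}
    {y : E} (hy : y ∈ (chartAt E c).target) : lam (inChart (reForm Ωc) c y) ≠ 0 := by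
  have h1 : inChart (reForm Ωc) c y =
      Complex.reCLM.compContinuousAlternatingMap (hcoeff Ωc c y • stdForm) := by
    rw [← h.inChart_eq_smul hy]; rfl
  rw [h1]
  exact lam_re_smul_stdForm (hcoeff_ne_zero h hne hy)

theorem symp_inChart_trans (τ b : Form M 3 ℝ) {c c' : M} {y : E} (hy : y ∈ transDom c c') :
    symp (inChart τ c y) (inChart b c y) =
      |LinearMap.det (fderiv ℝ (trans c c') y : E →ₗ[ℝ] E)| *
        symp (inChart τ c' (trans c c' y)) (inChart b c' (trans c c' y)) := by
  rw [abs_of_pos (det_fderiv_trans_pos hy), inChart_trans τ hy, inChart_trans b hy]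
  exact symp_comp _ _ _

/-! ### Forms supported in a chart -/

variable {F : Type*} [NormedAddCommGroup F] [NormedSpace ℝ F]

open Classical in
/-- The form on `M` with the given expression in the chart at `c` which vanishes outside of the
domain of that chart. -/
def ofChart {p : ℕ} (c : M) (β : E → E [⋀^Fin p]→L[ℝ] F) : Form M p F := fun x =>
  if x ∈ (chartAt E c).source then
    (β (chartAt E c x)).compContinuousLinearMap (fderiv ℝ (trans x c) (chartAt E x x))
  else 0

theorem val_ofChart {p : ℕ} {c : M} (β : E → E [⋀^Fin p]→L[ℝ] F) {x : M}
    (hx : x ∈ (chartAt E c).source) : val (ofChart c β) x =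
      (β (chartAt E c x)).compContinuousLinearMap (fderiv ℝ (trans x c) (chartAt E x x)) := if_pos hx

theorem val_ofChart_of_notMem {p : ℕ} {c : M} (β : E → E [⋀^Fin p]→L[ℝ] F) {x : M}
    (hx : x ∉ (chartAt E c).source) : val (ofChart c β) x = 0 := if_neg hx

theorem inChart_ofChart {p : ℕ} {c c' : M} (β : E → E [⋀^Fin p]→L[ℝ] F) {y : E} (hy : y ∈ transDom c' c) :
    inChart (ofChart c β) c' y =
      (β (trans c' c y)).compContinuousLinearMap (fderiv ℝ (trans c' c) y) := by
  rw [inChart_eq _ hy.1, val_ofChart β hy.2, fderiv_trans_comp (mem_transDom_symm hy.1) hy]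
  rfl

theorem inChart_ofChart_of_notMem {p : ℕ} {c c' : M} (β : E → E [⋀^Fin p]→L[ℝ] F) {y : E}
    (hy : y ∈ (chartAt E c').target) (hy' : y ∉ transDom c' c) : inChart (ofChart c β) c' y = 0 := by
  rw [inChart_eq _ hy, val_ofChart_of_notMem β fun h => hy' ⟨hy, h⟩]
  rfl

theorem inChart_ofChart_self {p : ℕ} {c : M} (β : E → E [⋀^Fin p]→L[ℝ] F) {y : E}
    (hy : y ∈ (chartAt E c).target) : inChart (ofChart c β) c y = β y := by
  rw [inChart_ofChart β (mem_transDom_self hy), trans_self hy, fderiv_trans_self hy]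
  rfl

variable [T2Space M]

/-- The image of the compact set K is closed because M is Hausdorff, so the extension by zero
vanishes near every point outside the chart at c. -/
theorem inChart_ofChart_eventually_zero {p : ℕ} {c c' : M} {β : E → E [⋀^Fin p]→L[ℝ] F} {K : Set E}
    (hK : IsCompact K) (hKc : K ⊆ (chartAt E c).target) (hβ : ∀ y ∉ K, β y = 0) {y : E}
    (hy : y ∈ (chartAt E c').target) (hy' : y ∉ transDom c' c) :
    inChart (ofChart c β) c' =ᶠ[nhds y] fun _ => 0 := by
  have hK' : IsClosed ((chartAt E c).symm '' K) :=
    (hK.image_of_continuousOn ((chartAt E c).continuousOn_symm.mono hKc)).isClosed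
  have h1 : (chartAt E c').symm y ∉ (chartAt E c).symm '' K := by
    rintro ⟨z, hz, h⟩
    exact hy' ⟨hy, by rw [Set.mem_preimage, ← h]; exact (chartAt E c).map_target (hKc hz)⟩
  have h2 : ∀ᶠ z in nhds y, (chartAt E c').symm z ∉ (chartAt E c).symm '' K :=
    ((chartAt E c').continuousAt_symm hy).eventually (hK'.isOpen_compl.mem_nhds h1)
  filter_upwards [h2, target_mem_nhds hy] with z hz hz'
  by_cases hzd : z ∈ transDom c' c
  · rw [inChart_ofChart β hzd, hβ]
    · rfl
    · exact fun h => hz ⟨_, h, symm_trans hzd⟩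
  · exact inChart_ofChart_of_notMem β hz' hzd

theorem isSmooth_ofChart [FiniteDimensional ℝ F] {p : ℕ} {c : M} {β : E → E [⋀^Fin p]→L[ℝ] F} {K : Set E}
    (hK : IsCompact K) (hKc : K ⊆ (chartAt E c).target) (hβ : ∀ y ∉ K, β y = 0) (hs : ContDiff ℝ ∞ β) :
    IsSmooth (ofChart c β) := by
  refine isSmooth_of_contDiffAt fun c' y hy => ?_
  by_cases hyd : y ∈ transDom c' c
  · refine ContDiffAt.congr_of_eventuallyEq ?_ (Filter.eventuallyEq_of_mem (transDom_mem_nhds hyd)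
      fun z hz => inChart_ofChart β hz)
    exact contDiffAt_form_comp (hs.contDiffAt.comp y (contDiffAt_trans hyd))
      ((contDiffAt_trans hyd).fderiv_right (by simp))
  · exact contDiffAt_const.congr_of_eventuallyEq (inChart_ofChart_eventually_zero hK hKc hβ hy hyd)

theorem inChart_d_ofChart_of_notMem [FiniteDimensional ℝ F] {p : ℕ} {c c' : M}
    {β : E → E [⋀^Fin p]→L[ℝ] F} {K : Set E} (hK : IsCompact K) (hKc : K ⊆ (chartAt E c).target)
    (hβ : ∀ y ∉ K, β y = 0) (hs : ContDiff ℝ ∞ β) {y : E} (hy : y ∈ (chartAt E c').target)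
    (hy' : y ∉ transDom c' c) : inChart (d (ofChart c β)) c' y = 0 := by
  rw [inChart_d (isSmooth_ofChart hK hKc hβ hs) hy,
    (inChart_ofChart_eventually_zero hK hKc hβ hy hy').extDeriv_eq, extDeriv, fderiv_fun_const]
  exact ContinuousAlternatingMap.ext fun v => by
    rw [ContinuousAlternatingMap.alternatizeUncurryFin_apply]
    simp

theorem inChart_d_ofChart [FiniteDimensional ℝ F] {p : ℕ} {c : M}
    {β : E → E [⋀^Fin p]→L[ℝ] F} {K : Set E} (hK : IsCompact K) (hKc : K ⊆ (chartAt E c).target)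
    (hβ : ∀ y ∉ K, β y = 0) (hs : ContDiff ℝ ∞ β) {y : E} (hy : y ∈ (chartAt E c).target) :
    inChart (d (ofChart c β)) c y = extDeriv β y := by
  rw [inChart_d (isSmooth_ofChart hK hKc hβ hs) hy]
  exact (Filter.eventuallyEq_of_mem (target_mem_nhds hy) fun z hz => inChart_ofChart_self β hz).extDeriv_eq

end ChartExpressions

/-! ### The partition of unity in charts -/

section Partition

variable {M : Type*} [TopologicalSpace M] [CompactSpace M] [T2Space M] [ChartedSpace E M]
  [IsManifold 𝓘(ℂ, E) ω M]

theorem partition_isSubordinate : (partition M).IsSubordinate fun c => (chartAt E c).source :=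
  Classical.choose_spec (SmoothPartitionOfUnity.exists_isSubordinate_chartAt_source 𝓘(ℝ, E) M)

variable (M) in
theorem finite_charts : {c : M | (Function.support (partition M c)).Nonempty}.Finite :=
  (partition M).locallyFinite.finite_nonempty_of_compact

variable (M) in
/-- The finitely many indices at which the partition of unity does not vanish. -/
def charts : Finset M := (finite_charts M).toFinset

theorem partition_eq_zero {c : M} (hc : c ∉ charts M) (x : M) : partition M c x = 0 := by
  by_contra h
  exact hc ((finite_charts M).mem_toFinset.2 ⟨x, h⟩)

theorem sum_partition (x : M) : ∑ c ∈ charts M, partition M c x = 1 := by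
  rw [← (partition M).sum_eq_one (Set.mem_univ x)]
  refine (finsum_eq_sum_of_support_subset _ fun c hc => ?_).symm
  by_contra h
  exact hc (partition_eq_zero h x)

/-- The function of the partition of unity in its chart, extended by zero. -/
def weight (c : M) : E → ℝ := (chartAt E c).target.indicator fun y => partition M c ((chartAt E c).symm y)

theorem weight_of_mem {c : M} {y : E} (hy : y ∈ (chartAt E c).target) :
    weight c y = partition M c ((chartAt E c).symm y) := Set.indicator_of_mem hy _

/-- A compact subset of the chart that contains the support of `weight`. -/
def weightSupp (c : M) : Set E := chartAt E c '' tsupport (partition M c)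

theorem isCompact_weightSupp (c : M) : IsCompact (weightSupp c) :=
  (isClosed_tsupport _).isCompact.image_of_continuousOn
    ((chartAt E c).continuousOn.mono (partition_isSubordinate c))

theorem weightSupp_subset (c : M) : weightSupp c ⊆ (chartAt E c).target := by
  rintro _ ⟨x, hx, rfl⟩
  exact (chartAt E c).map_source (partition_isSubordinate c hx)

theorem weight_eq_zero {c : M} {y : E} (hy : y ∉ weightSupp c) : weight c y = 0 := by
  by_cases h : y ∈ (chartAt E c).target
  · rw [weight_of_mem h]
    by_contra h0
    exact hy ⟨_, subset_tsupport _ h0, (chartAt E c).right_inv h⟩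
  · exact Set.indicator_of_notMem h _

theorem contDiff_weight (c : M) : ContDiff ℝ ∞ (weight c) := by
  refine contDiff_iff_contDiffAt.2 fun y => ?_
  by_cases h : y ∈ (chartAt E c).target
  · have h1 : ContMDiffAt 𝓘(ℝ, E) 𝓘(ℝ, E) ∞ (chartAt E c).symm y :=
      contMDiffOn_chart_symm.contMDiffAt (target_mem_nhds h)
    have h2 := ((partition M c).contMDiff.contMDiffAt (x := (chartAt E c).symm y)).comp y h1
    exact (contMDiffAt_iff_contDiffAt.1 h2).congr_of_eventuallyEq
      (Filter.eventuallyEq_of_mem (target_mem_nhds h) fun z hz => weight_of_mem hz)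
  · have h1 : (weightSupp c)ᶜ ∈ nhds y :=
      (isCompact_weightSupp c).isClosed.isOpen_compl.mem_nhds fun hy => h (weightSupp_subset c hy)
    exact contDiffAt_const.congr_of_eventuallyEq
      (Filter.eventuallyEq_of_mem h1 fun z hz => weight_eq_zero hz)

theorem integral_eq_sum (η : Form M 6 ℝ) :
    integral η = ∑ c ∈ charts M, ∫ y, weight c y * inChart η c y frame := by
  have h : ∀ c : M, ∫ y in (chartAt E c).target, partition M c ((chartAt E c).symm y) * inChart η c y frame =
      ∫ y, weight c y * inChart η c y frame := fun c => by
    rw [← integral_indicator (chartAt E c).open_target.measurableSet]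
    congr 1
    funext y
    by_cases hy : y ∈ (chartAt E c).target
    · rw [Set.indicator_of_mem hy, weight_of_mem hy]
    · rw [Set.indicator_of_notMem hy, weight, Set.indicator_of_notMem hy, zero_mul]
  rw [Hitchin.integral, finsum_eq_sum_of_support_subset (s := charts M)]
  · exact Finset.sum_congr rfl fun c _ => h c
  · intro c hc
    by_contra hc'
    refine hc ?_
    have : ∀ y, partition M c ((chartAt E c).symm y) * inChart η c y frame = 0 := fun y => by
      rw [partition_eq_zero hc', zero_mul]
    simp [this]

theorem Phi_eq_sum (Ω : Form M 3 ℝ) : Phi Ω = ∑ c ∈ charts M, ∫ y, weight c y * phi (inChart Ω c y) := by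
  rw [Phi, integral_eq_sum]
  refine Finset.sum_congr rfl fun c _ => ?_
  congr 1
  funext y
  by_cases hy : y ∈ (chartAt E c).target
  · rw [inChart_phiForm Ω hy]
  · rw [weight, Set.indicator_of_notMem hy, zero_mul, zero_mul]

end Partition

/-! ### Integration by parts in a chart -/

section Divergence

variable {G : Type*} [NormedAddCommGroup G] [NormedSpace ℝ G]

theorem contDiff_of_support {n : WithTop ℕ∞} {f : E → G} {U K : Set E} (hK : IsCompact K) (hKU : K ⊆ U)
    (hf : ∀ y ∈ U, ContDiffAt ℝ n f y) (h0 : ∀ y ∉ K, f y = 0) : ContDiff ℝ n f := by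
  refine contDiff_iff_contDiffAt.2 fun y => ?_
  by_cases h : y ∈ K
  · exact hf y (hKU h)
  · exact contDiffAt_const.congr_of_eventuallyEq
      (Filter.eventuallyEq_of_mem (hK.isClosed.isOpen_compl.mem_nhds h) fun z hz => h0 z hz)

theorem integrable_of_support {f : E → G} {K : Set E} (hK : IsCompact K) (hf : Continuous f)
    (h0 : ∀ y ∉ K, f y = 0) : Integrable f :=
  hf.integrable_of_hasCompactSupport (HasCompactSupport.intro hK fun y hy => h0 y hy)

theorem integral_fderiv_eq_zero {f : E → ℝ} {K : Set E} (hK : IsCompact K) (hf : ContDiff ℝ 1 f)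
    (h0 : ∀ y ∉ K, f y = 0) (v : E) : ∫ y, fderiv ℝ f y v = 0 := by
  have h1 : ∀ y ∉ K, fderiv ℝ f y v = 0 := fun y hy => by
    have : f =ᶠ[nhds y] fun _ => 0 :=
      Filter.eventuallyEq_of_mem (hK.isClosed.isOpen_compl.mem_nhds hy) fun z hz => h0 z hz
    rw [this.fderiv_eq, fderiv_fun_const]; rfl
  have h2 : Integrable fun y => fderiv ℝ f y v :=
    integrable_of_support hK ((hf.continuous_fderiv one_ne_zero).clm_apply continuous_const) h1
  have := integral_mul_fderiv_eq_neg_fderiv_mul_of_integrable (μ := volume) (f := fun _ : E => (1 : ℝ))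
    (g := f) (v := v) (by simp) (by simpa using h2)
    (by simpa using integrable_of_support hK hf.continuous h0) (fun _ _ => by fun_prop)
    (fun y _ => hf.differentiable one_ne_zero y)
  simpa using this

theorem exists_pair42 : ∃ B : (E [⋀^Fin 4]→L[ℝ] ℝ) →L[ℝ] (E [⋀^Fin 2]→L[ℝ] ℝ) →L[ℝ] ℝ,
    ∀ a b, B a b = coeff (wedge a.toAlternatingMap b.toAlternatingMap) :=
  exists_bilinear_of_finiteDimensional _
    (fun a a' b => by
      rw [ContinuousAlternatingMap.toAlternatingMap_add, wedge_add_left]; exact coeff_add _ _)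
    (fun c a b => by
      rw [ContinuousAlternatingMap.toAlternatingMap_smul, wedge_smul_left]; exact coeff_smul _ _)
    (fun a b b' => by
      rw [ContinuousAlternatingMap.toAlternatingMap_add, wedge_add_right]; exact coeff_add _ _)
    (fun c a b => by
      rw [ContinuousAlternatingMap.toAlternatingMap_smul, wedge_smul_right]; exact coeff_smul _ _)

/-- The pairing of `4`-forms and `2`-forms. -/
def pair42 : (E [⋀^Fin 4]→L[ℝ] ℝ) →L[ℝ] (E [⋀^Fin 2]→L[ℝ] ℝ) →L[ℝ] ℝ := Classical.choose exists_pair42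

theorem pair42_apply (a : E [⋀^Fin 4]→L[ℝ] ℝ) (b : E [⋀^Fin 2]→L[ℝ] ℝ) :
    pair42 a b = coeff (wedge a.toAlternatingMap b.toAlternatingMap) := Classical.choose_spec exists_pair42 a b

theorem pair42_nondegenerate (a : E [⋀^Fin 4]→L[ℝ] ℝ) (h : ∀ b, pair42 a b = 0) : a = 0 := by
  apply ContinuousAlternatingMap.toAlternatingMap_injective
  refine eq_zero_of_wedge_eq_zero (p := 4) (q := 2) rfl _ fun b => ?_
  have h1 : coeff (wedge a.toAlternatingMap b) = 0 := by
    rw [← h (toContinuousForm b), pair42_apply]; rfl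
  exact eq_zero_of_coeff_eq_zero _ h1

/-- The coordinates dual to `frame`, as continuous linear maps. -/
def coordL (j : Fin 6) : E →L[ℝ] ℝ := LinearMap.toContinuousLinearMap (frame.coord j)

/-- The exterior product with a coordinate form. -/
def wedgeCoord (j : Fin 6) : (E [⋀^Fin 2]→L[ℝ] ℝ) →L[ℝ] Forms3 :=
  (ContinuousAlternatingMap.alternatizeUncurryFinCLM ℝ E ℝ).comp
    (ContinuousLinearMap.smulRightL ℝ E (E [⋀^Fin 2]→L[ℝ] ℝ) (coordL j))

theorem wedgeCoord_apply (j : Fin 6) (b : E [⋀^Fin 2]→L[ℝ] ℝ) :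
    wedgeCoord j b = ContinuousAlternatingMap.alternatizeUncurryFin ((coordL j).smulRight b) := rfl

theorem alternatize_eq_sum (D : E →L[ℝ] E [⋀^Fin 2]→L[ℝ] ℝ) :
    ContinuousAlternatingMap.alternatizeUncurryFin D = ∑ j, wedgeCoord j (D (frame j)) := by
  have h : D = ∑ j, (coordL j).smulRight (D (frame j)) := by
    ext1 v
    rw [sum_apply]
    conv_lhs => rw [← frame.sum_repr v, map_sum]
    exact Finset.sum_congr rfl fun j _ => D.map_smul _ _
  conv_lhs => rw [h, ← ContinuousAlternatingMap.alternatizeUncurryFinCLM_apply, map_sum]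
  rfl

theorem sum_symp_wedgeCoord (L : E →L[ℝ] Forms3) (b : E [⋀^Fin 2]→L[ℝ] ℝ) :
    ∑ j, symp (L (frame j)) (wedgeCoord j b) =
      - pair42 (ContinuousAlternatingMap.alternatizeUncurryFin L) b := by
  rw [pair42_apply, ContinuousAlternatingMap.toAlternatingMap_alternatizeUncurryFin]
  have h := sum_coeff_wedge_alternatize
    (ContinuousAlternatingMap.toAlternatingMapLinear ∘ₗ (L : E →ₗ[ℝ] E [⋀^Fin 3]→L[ℝ] ℝ)) b.toAlternatingMap
  rw [← h]
  refine Finset.sum_congr rfl fun j _ => ?_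
  rw [wedgeCoord_apply, symp, ContinuousAlternatingMap.toAlternatingMap_alternatizeUncurryFin]
  rfl

theorem contDiffAt_symp {n : WithTop ℕ∞} {V : Type*} [NormedAddCommGroup V] [NormedSpace ℝ V]
    {f g : V → Forms3} {x : V} (hf : ContDiffAt ℝ n f x)
    (hg : ContDiffAt ℝ n g x) : ContDiffAt ℝ n (fun y => symp (f y) (g y)) x := by
  have h : ContDiffAt ℝ n (fun y => sympL (f y) (g y)) x :=
    (sympL.contDiff.contDiffAt.comp x hf).clm_apply hg
  simpa only [sympL_apply] using h

theorem symp_zero_right (a : Forms3) : symp a 0 = 0 := by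
  have := symp_smul_right 0 a 0
  rwa [zero_smul, zero_mul] at this

theorem extDeriv_eq_zero_of_support {p : ℕ} {β : E → E [⋀^Fin p]→L[ℝ] G} {K : Set E} (hK : IsCompact K)
    (h0 : ∀ y ∉ K, β y = 0) : ∀ y ∉ K, extDeriv β y = 0 := fun y hy => by
  have : β =ᶠ[nhds y] fun _ => 0 :=
    Filter.eventuallyEq_of_mem (hK.isClosed.isOpen_compl.mem_nhds hy) fun z hz => h0 z hz
  rw [this.extDeriv_eq, extDeriv, fderiv_fun_const]
  exact ContinuousAlternatingMap.ext fun v => by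
    rw [ContinuousAlternatingMap.alternatizeUncurryFin_apply]
    simp

/-- The difference of the two integrands is Σⱼ ∂ⱼ(T ∧ θⱼ ∧ β), a divergence with compact support:
moving θⱼ past the 3-form ∂ⱼT produces the sign in `sum_symp_wedgeCoord`. Smoothness of T is needed
only near K, as every product vanishes off K. -/
theorem integral_symp_extDeriv {U K : Set E} (hK : IsCompact K) (hKU : K ⊆ U)
    {T : E → Forms3} (hT : ∀ y ∈ U, ContDiffAt ℝ ∞ T y) {β : E → E [⋀^Fin 2]→L[ℝ] ℝ}
    (hβ : ContDiff ℝ ∞ β) (h0 : ∀ y ∉ K, β y = 0) :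
    ∫ y, symp (T y) (extDeriv β y) = ∫ y, pair42 (extDeriv T y) (β y) := by
  have hβ' := extDeriv_eq_zero_of_support hK h0
  have sP : ∀ j, ContDiff ℝ ∞ fun y => symp (T y) (wedgeCoord j (β y)) := fun j => by
    refine contDiff_of_support hK hKU (fun y hy => ?_) fun y hy => ?_
    · exact contDiffAt_symp (hT y hy) ((wedgeCoord j).contDiff.contDiffAt.comp y hβ.contDiffAt)
    · rw [h0 y hy, map_zero, symp_zero_right]
  have zP : ∀ j, ∀ y ∉ K, symp (T y) (wedgeCoord j (β y)) = 0 := fun j y hy => by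
    rw [h0 y hy, map_zero, symp_zero_right]
  have hsum : ∀ y, symp (T y) (extDeriv β y) - pair42 (extDeriv T y) (β y) =
      ∑ j, fderiv ℝ (fun y => symp (T y) (wedgeCoord j (β y))) y (frame j) := fun y => by
    by_cases hy : y ∈ K
    · have dT : HasFDerivAt T (fderiv ℝ T y) y :=
        ((hT y (hKU hy)).differentiableAt (by simp)).hasFDerivAt
      have dβ : HasFDerivAt β (fderiv ℝ β y) y := (hβ.differentiable (by simp) y).hasFDerivAt
      have h1 : ∀ j, fderiv ℝ (fun y => symp (T y) (wedgeCoord j (β y))) y (frame j) =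
          symp (T y) (wedgeCoord j (fderiv ℝ β y (frame j))) +
            symp (fderiv ℝ T y (frame j)) (wedgeCoord j (β y)) := fun j => by
        have h2 : HasFDerivAt (fun y => sympL (T y) (wedgeCoord j (β y))) _ y :=
          (sympL.hasFDerivAt.comp y dT).clm_apply ((wedgeCoord j).hasFDerivAt.comp y dβ)
        have h3 : (fun y => symp (T y) (wedgeCoord j (β y))) = fun y => sympL (T y) (wedgeCoord j (β y)) :=
          funext fun y => (sympL_apply _ _).symm
        rw [h3, h2.fderiv]
        change sympL (T y) (wedgeCoord j (fderiv ℝ β y (frame j))) +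
          sympL (fderiv ℝ T y (frame j)) (wedgeCoord j (β y)) = _
        rw [sympL_apply, sympL_apply]
      rw [Finset.sum_congr rfl fun j _ => h1 j, Finset.sum_add_distrib, sum_symp_wedgeCoord, extDeriv, extDeriv,
        alternatize_eq_sum]
      have h4 : symp (T y) (∑ j, wedgeCoord j (fderiv ℝ β y (frame j))) =
          ∑ j, symp (T y) (wedgeCoord j (fderiv ℝ β y (frame j))) := by
        simp only [← sympL_apply, map_sum]
      rw [h4, sub_eq_add_neg]
    · have h1 : ∀ j, fderiv ℝ (fun y => symp (T y) (wedgeCoord j (β y))) y = 0 := fun j => by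
        have : (fun y => symp (T y) (wedgeCoord j (β y))) =ᶠ[nhds y] fun _ => 0 :=
          Filter.eventuallyEq_of_mem (hK.isClosed.isOpen_compl.mem_nhds hy) fun z hz => zP j z hz
        rw [this.fderiv_eq, fderiv_fun_const]; rfl
      rw [hβ' y hy, h0 y hy, symp_zero_right, map_zero, sub_zero]
      exact (Finset.sum_eq_zero fun j _ => by rw [h1 j]; rfl).symm
  have iA : Integrable fun y => symp (T y) (extDeriv β y) :=
    integrable_of_support hK (contDiff_of_support (n := ∞) hK hKU
      (fun y hy => contDiffAt_symp (hT y hy) (contDiffAt_extDeriv hβ.contDiffAt))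
      fun y hy => by rw [hβ' y hy, symp_zero_right]).continuous
      fun y hy => by rw [hβ' y hy, symp_zero_right]
  have iB : Integrable fun y => pair42 (extDeriv T y) (β y) :=
    integrable_of_support hK (contDiff_of_support (n := ∞) hK hKU
      (fun y hy => (pair42.contDiff.contDiffAt.comp y (contDiffAt_extDeriv (hT y hy))).clm_apply hβ.contDiffAt)
      fun y hy => by rw [h0 y hy, map_zero]).continuous
      fun y hy => by rw [h0 y hy, map_zero]
  rw [← sub_eq_zero, ← integral_sub iA iB]
  refine (integral_congr_ae (Filter.Eventually.of_forall hsum)).trans ?_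
  rw [integral_finsetSum]
  · exact Finset.sum_eq_zero fun j _ => integral_fderiv_eq_zero hK ((sP j).of_le (by exact_mod_cast le_top)) (zP j) _
  · intro j _
    refine integrable_of_support hK (((sP j).continuous_fderiv (by simp)).clm_apply continuous_const)
      fun y hy => ?_
    have : (fun y => symp (T y) (wedgeCoord j (β y))) =ᶠ[nhds y] fun _ => 0 :=
      Filter.eventuallyEq_of_mem (hK.isClosed.isOpen_compl.mem_nhds hy) fun z hz => zP j z hz
    rw [this.fderiv_eq, fderiv_fun_const]; rfl

end Divergence

/-! ### The global pairing of `3`-forms -/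

section Pairing

variable {M : Type*} [TopologicalSpace M] [CompactSpace M] [T2Space M] [ChartedSpace E M]
  [IsManifold 𝓘(ℂ, E) ω M]

/-- The integral over `M` of `τ ∧ b`. -/
def pairInt (τ b : Form M 3 ℝ) : ℝ :=
  ∑ c ∈ charts M, ∫ y, weight c y * symp (inChart τ c y) (inChart b c y)

theorem weight_eq_partition {c c' : M} {y : E} (hy : y ∈ transDom c c') :
    weight c y = partition M c ((chartAt E c').symm (trans c c' y)) := by
  rw [weight_of_mem hy.1, symm_trans hy]

theorem image_trans (c c' : M) : trans c c' '' transDom c c' = transDom c' c := by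
  ext z
  constructor
  · rintro ⟨y, hy, rfl⟩
    exact trans_mem_transDom hy (mem_transDom_self hy.1)
  · intro hz
    exact ⟨trans c' c z, trans_mem_transDom hz (mem_transDom_self hz.1), trans_inv hz⟩

theorem partition_eq_zero_of_notMem_transDom {c c' : M} {y : E} (hy : y ∈ (chartAt E c').target)
    (hy' : y ∉ transDom c' c) : partition M c ((chartAt E c').symm y) = 0 := by
  by_contra h
  exact hy' ⟨hy, partition_isSubordinate c (subset_tsupport _ h)⟩

theorem setIntegral_eq_of_eq_zero {s t : Set E} (hs : MeasurableSet s) (ht : MeasurableSet t) (hst : s ⊆ t)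
    {f : E → ℝ} (h : ∀ y ∈ t, y ∉ s → f y = 0) : ∫ y in t, f y = ∫ y in s, f y := by
  rw [← integral_indicator hs, ← integral_indicator ht]
  congr 1
  funext y
  by_cases h1 : y ∈ s
  · rw [Set.indicator_of_mem h1, Set.indicator_of_mem (hst h1)]
  · by_cases h2 : y ∈ t
    · rw [Set.indicator_of_notMem h1, Set.indicator_of_mem h2, h y h2 h1]
    · rw [Set.indicator_of_notMem h1, Set.indicator_of_notMem h2]

/-- The family f transforms as a density, so this is the change of variables formula for the
coordinate change from c to c'; the parts of the charts outside the overlap contribute nothing. -/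
theorem integral_weight_mul_eq {f : M → E → ℝ} {c c' : M}
    (htr : ∀ y ∈ transDom c c', f c y =
      |LinearMap.det (fderiv ℝ (trans c c') y : E →ₗ[ℝ] E)| * f c' (trans c c' y))
    (h0 : ∀ y ∈ (chartAt E c).target, y ∉ transDom c c' → f c y = 0) :
    ∫ y, weight c y * f c y =
      ∫ y in (chartAt E c').target, partition M c ((chartAt E c').symm y) * f c' y := by
  have m1 := (isOpen_transDom c c').measurableSet
  have m2 := (isOpen_transDom c' c).measurableSet
  rw [setIntegral_eq_of_eq_zero m2 (chartAt E c').open_target.measurableSet (fun y hy => hy.1)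
    fun y hy hy' => by rw [partition_eq_zero_of_notMem_transDom hy hy', zero_mul],
    ← setIntegral_univ, setIntegral_eq_of_eq_zero m1 MeasurableSet.univ (Set.subset_univ _),
    ← image_trans c c', integral_image_eq_integral_abs_det_fderiv_smul volume m1
      (f' := fun y => fderiv ℝ (trans c c') y)
      (fun y hy => (differentiableAt_trans hy).hasFDerivAt.hasFDerivWithinAt)]
  · refine setIntegral_congr_fun m1 fun y hy => ?_
    change weight c y * f c y = |LinearMap.det (fderiv ℝ (trans c c') y : E →ₗ[ℝ] E)| *
      (partition M c ((chartAt E c').symm (trans c c' y)) * f c' (trans c c' y))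
    rw [htr y hy, weight_eq_partition hy]
    ring
  · intro y hy z hz h
    change trans c c' y = trans c c' z at h
    rw [← trans_inv hy, h, trans_inv hz]
  · intro y _ hy
    by_cases hy' : y ∈ (chartAt E c).target
    · rw [h0 y hy' hy, mul_zero]
    · rw [weight, Set.indicator_of_notMem hy', zero_mul]

/-- Once every summand is moved to the one chart containing the support, the functions of the
partition add up to 1. -/
theorem sum_integral_weight_mul_eq {f : M → E → ℝ} {c' : M}
    (htr : ∀ c, ∀ y ∈ transDom c c', f c y =
      |LinearMap.det (fderiv ℝ (trans c c') y : E →ₗ[ℝ] E)| * f c' (trans c c' y))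
    (h0 : ∀ c, ∀ y ∈ (chartAt E c).target, y ∉ transDom c c' → f c y = 0)
    (hi : IntegrableOn (f c') (chartAt E c').target) :
    ∑ c ∈ charts M, ∫ y, weight c y * f c y = ∫ y in (chartAt E c').target, f c' y := by
  have ht := (chartAt E c').open_target.measurableSet
  rw [Finset.sum_congr rfl fun c _ => integral_weight_mul_eq (htr c) (h0 c), ← integral_finsetSum]
  · refine setIntegral_congr_fun ht fun y _ => ?_
    change ∑ c ∈ charts M, partition M c ((chartAt E c').symm y) * f c' y = _
    rw [← Finset.sum_mul, sum_partition, one_mul]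
  · intro c _
    refine Integrable.bdd_mul (c := 1) hi ?_ (Filter.Eventually.of_forall fun y => ?_)
    · exact ((partition M c).contMDiff.continuous.comp_continuousOn
        (chartAt E c').continuousOn_symm).aestronglyMeasurable ht
    · rw [Real.norm_eq_abs, abs_of_nonneg ((partition M).nonneg c _)]
      exact (partition M).le_one c _

/-- For a differential supported in one chart the global pairing is an integral over that chart,
where integration by parts applies. Both Stokes' theorem and its converse rest on this. -/
theorem pairInt_d_ofChart {τ : Form M 3 ℝ} (hτ : IsSmooth τ) {c : M} {β : E → E [⋀^Fin 2]→L[ℝ] ℝ} {K : Set E}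
    (hK : IsCompact K) (hKc : K ⊆ (chartAt E c).target) (hβ : ∀ y ∉ K, β y = 0) (hs : ContDiff ℝ ∞ β) :
    pairInt τ (d (ofChart c β)) = ∫ y, pair42 (extDeriv (inChart τ c) y) (β y) := by
  have ht := (chartAt E c).open_target.measurableSet
  have hβ' := extDeriv_eq_zero_of_support hK hβ
  have h1 : ∀ y ∈ (chartAt E c).target, symp (inChart τ c y) (inChart (d (ofChart c β)) c y) =
      symp (inChart τ c y) (extDeriv β y) := fun y hy => by
    rw [inChart_d_ofChart hK hKc hβ hs hy]
  have hz : ∀ y ∉ K, symp (inChart τ c y) (extDeriv β y) = 0 := fun y hy => by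
    rw [hβ' y hy, symp_zero_right]
  have hint : Integrable fun y => symp (inChart τ c y) (extDeriv β y) :=
    integrable_of_support hK (contDiff_of_support (n := ∞) hK hKc
      (fun y hy => contDiffAt_symp (hτ.contDiffAt hy) (contDiffAt_extDeriv hs.contDiffAt)) hz).continuous hz
  rw [← integral_symp_extDeriv hK hKc (fun y hy => hτ.contDiffAt hy) hs hβ, pairInt,
    sum_integral_weight_mul_eq (f := fun c' y => symp (inChart τ c' y) (inChart (d (ofChart c β)) c' y))
      (c' := c), setIntegral_congr_fun ht h1, setIntegral_eq_integral_of_forall_compl_eq_zero]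
  · exact fun y hy => hz y fun h => hy (hKc h)
  · exact fun c' y hy => symp_inChart_trans τ _ hy
  · intro c' y hy hy'
    rw [inChart_d_ofChart_of_notMem hK hKc hβ hs hy hy', symp_zero_right]
  · exact hint.integrableOn.congr_fun (fun y hy => (h1 y hy).symm) ht

/-! ### Stokes' theorem and its converse -/

theorem smul_inChart_eq_zero {p : ℕ} (φ : Form M p ℝ) {c : M} {y : E} (hy : y ∉ weightSupp c) :
    weight c y • inChart φ c y = 0 := by rw [weight_eq_zero hy, zero_smul]

theorem contDiff_weight_smul {p : ℕ} {φ : Form M p ℝ} (hφ : IsSmooth φ) (c : M) :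
    ContDiff ℝ ∞ fun y => weight c y • inChart φ c y :=
  contDiff_of_support (isCompact_weightSupp c) (weightSupp_subset c)
    (fun _ hy => (contDiff_weight c).contDiffAt.smul (hφ.contDiffAt hy))
    fun _ hy => smul_inChart_eq_zero φ hy

theorem sum_ofChart {p : ℕ} (φ : Form M p ℝ) :
    ∑ c ∈ charts M, ofChart c (fun y => weight c y • inChart φ c y) = φ := by
  refine form_ext fun c' y hy => ?_
  rw [inChart_sum]
  have h : ∀ c : M, inChart (ofChart c fun y => weight c y • inChart φ c y) c' y =
      partition M c ((chartAt E c').symm y) • inChart φ c' y := fun c => by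
    by_cases h : y ∈ transDom c' c
    · rw [inChart_ofChart _ h, weight_of_mem (trans_mem_target h), symm_trans h, inChart_trans φ h]
      rfl
    · rw [inChart_ofChart_of_notMem _ hy h, partition_eq_zero_of_notMem_transDom hy h, zero_smul]
  rw [Finset.sum_congr rfl fun c _ => h c, ← Finset.sum_smul, sum_partition, one_smul]

theorem integrable_weight_symp {τ b : Form M 3 ℝ} (hτ : IsSmooth τ) (hb : IsSmooth b) (c : M) :
    Integrable fun y => weight c y * symp (inChart τ c y) (inChart b c y) := by
  have h0 : ∀ y ∉ weightSupp c, weight c y * symp (inChart τ c y) (inChart b c y) = 0 := fun y hy => by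
    rw [weight_eq_zero hy, zero_mul]
  refine integrable_of_support (isCompact_weightSupp c) (contDiff_of_support (n := ∞)
    (isCompact_weightSupp c) (weightSupp_subset c) (fun y hy => ?_) h0).continuous h0
  exact (contDiff_weight c).contDiffAt.mul (contDiffAt_symp (hτ.contDiffAt hy)
    (hb.contDiffAt hy))

theorem pairInt_sum_right {ι : Type*} {τ : Form M 3 ℝ} (hτ : IsSmooth τ) (s : Finset ι) {b : ι → Form M 3 ℝ}
    (hb : ∀ i ∈ s, IsSmooth (b i)) : pairInt τ (∑ i ∈ s, b i) = ∑ i ∈ s, pairInt τ (b i) := by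
  simp only [pairInt]
  rw [Finset.sum_comm]
  refine Finset.sum_congr rfl fun c _ => ?_
  rw [← integral_finsetSum _ fun i hi => integrable_weight_symp hτ (hb i hi) c]
  congr 1
  funext y
  rw [inChart_sum, ← Finset.mul_sum, ← sympL_apply, map_sum]
  simp only [sympL_apply]

theorem extDeriv_inChart_eq_zero {τ : Form M 3 ℝ} (hτ : IsSmooth τ) (h : d τ = 0) {c : M} {y : E}
    (hy : y ∈ (chartAt E c).target) : extDeriv (inChart τ c) y = 0 := by
  rw [← inChart_d hτ hy, h, inChart_zero]

/-- Cutting φ into pieces supported in charts by the partition of unity, each piece pairs to an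
integral involving dτ. -/
theorem pairInt_d_eq_zero {τ : Form M 3 ℝ} (hτ : IsSmooth τ) (h : d τ = 0) {φ : Form M 2 ℝ} (hφ : IsSmooth φ) :
    pairInt τ (d φ) = 0 := by
  have hs : ∀ c : M, IsSmooth (ofChart c fun y => weight c y • inChart φ c y) := fun c =>
    isSmooth_ofChart (isCompact_weightSupp c) (weightSupp_subset c)
      (fun y hy => smul_inChart_eq_zero φ hy) (contDiff_weight_smul hφ c)
  rw [← sum_ofChart φ, d_sum fun c _ => hs c, pairInt_sum_right hτ _ fun c _ => (hs c).d]
  refine Finset.sum_eq_zero fun c _ => ?_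
  rw [pairInt_d_ofChart hτ (isCompact_weightSupp c) (weightSupp_subset c)
      (fun y hy => smul_inChart_eq_zero φ hy) (contDiff_weight_smul hφ c)]
  refine integral_eq_zero_of_ae (Filter.Eventually.of_forall fun y => ?_)
  change pair42 (extDeriv (inChart τ c) y) (weight c y • inChart φ c y) = 0
  by_cases hy : y ∈ weightSupp c
  · rw [extDeriv_inChart_eq_zero hτ h (weightSupp_subset c hy), map_zero]; rfl
  · rw [smul_inChart_eq_zero φ hy, map_zero]

/-- Testing with g·b, for g a bump function and b a constant 2-form in a chart, shows that the
pairing of dτ with b integrates to zero against every g. It vanishes almost everywhere, then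
everywhere by continuity, and the pairing of 4-forms with 2-forms is nondegenerate. -/
theorem d_eq_zero_of_pairInt {τ : Form M 3 ℝ} (hτ : IsSmooth τ)
    (h : ∀ φ : Form M 2 ℝ, IsSmooth φ → pairInt τ (d φ) = 0) : d τ = 0 := by
  refine form_ext fun c y hy => ?_
  rw [inChart_zero, inChart_d hτ hy]
  refine pair42_nondegenerate _ fun b => ?_
  have hcont : ContinuousOn (fun y => pair42 (extDeriv (inChart τ c) y) b) (chartAt E c).target := fun z hz =>
    ((pair42.continuous.continuousAt.comp
      (contDiffAt_extDeriv (hτ.contDiffAt hz)).continuousAt).clm_apply continuousAt_const).continuousWithinAt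
  have hae : ∀ᵐ z : E, z ∈ (chartAt E c).target → pair42 (extDeriv (inChart τ c) z) b = 0 := by
    refine (chartAt E c).open_target.ae_eq_zero_of_integral_contDiff_smul_eq_zero
      (hcont.locallyIntegrableOn (chartAt E c).open_target.measurableSet) fun g hg hgc hgs => ?_
    have h0 : ∀ z ∉ tsupport g, g z • b = 0 := fun z hz => by rw [image_eq_zero_of_notMem_tsupport hz, zero_smul]
    have hs : ContDiff ℝ ∞ fun z => g z • b := hg.smul contDiff_const
    rw [← h _ (isSmooth_ofChart (c := c) hgc hgs h0 hs), pairInt_d_ofChart hτ hgc hgs h0 hs]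
    congr 1
    funext z
    rw [map_smul]
  exact Measure.eqOn_open_of_ae_eq ((ae_restrict_iff' (chartAt E c).open_target.measurableSet).2 hae)
    (chartAt E c).open_target hcont continuousOn_const hy

end Pairing

/-! ### Integrals depending on a parameter -/

section Parameter

variable {P : Type*} [NormedAddCommGroup P] [NormedSpace ℝ P]

/-- By compactness of K, one neighbourhood of the parameter serves for all y in K (tube lemma). Off
K the product is locally zero, whatever G does there. -/
theorem exists_contDiffOn_mul {n : ℕ} {w : E → ℝ} {K : Set E} (hK : IsCompact K) (hw : ContDiff ℝ ∞ w)
    (h0 : ∀ y ∉ K, w y = 0) {G : P × E → ℝ} {p : P} (hG : ∀ y ∈ K, ContDiffAt ℝ n G (p, y)) :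
    ∃ s : Set P, IsOpen s ∧ p ∈ s ∧ ContDiffOn ℝ n (fun q : P × E => w q.2 * G q) (s ×ˢ Set.univ) := by
  have ho : IsOpen {q : P × E | ContDiffAt ℝ n G q} :=
    isOpen_iff_mem_nhds.2 fun q hq => ContDiffAt.eventually hq (by simp)
  obtain ⟨s, v, hs, hv, hps, hKv, hsv⟩ := generalized_tube_lemma (isCompact_singleton (x := p)) hK ho
    (by rintro ⟨q, y⟩ ⟨hq, hy⟩; obtain rfl : q = p := hq; exact hG y hy)
  refine ⟨s, hs, hps rfl, fun q hq => ContDiffAt.contDiffWithinAt ?_⟩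
  by_cases hy : q.2 ∈ K
  · exact ((hw.of_le (by exact_mod_cast le_top)).contDiffAt.comp q contDiffAt_snd).mul (hsv ⟨hq.1, hKv hy⟩)
  · refine (contDiffAt_const (c := (0 : ℝ))).congr_of_eventuallyEq ?_
    filter_upwards [(hK.isClosed.isOpen_compl.preimage continuous_snd).mem_nhds hy] with z hz
    rw [h0 _ hz, zero_mul]

theorem contDiffAt_integral_mul {n : ℕ} {w : E → ℝ} {K : Set E} (hK : IsCompact K) (hw : ContDiff ℝ ∞ w)
    (h0 : ∀ y ∉ K, w y = 0) {G : P × E → ℝ} {p : P} (hG : ∀ y ∈ K, ContDiffAt ℝ n G (p, y)) :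
    ContDiffAt ℝ n (fun q => ∫ y, w y * G (q, y)) p := by
  obtain ⟨s, hs, hps, h⟩ := exists_contDiffOn_mul hK hw h0 hG
  -- The integral is the convolution of the constant function 1 with the integrand, evaluated at the
  -- origin; smooth dependence on parameters is known for such convolutions.
  have h1 := contDiffOn_convolution_right_with_param_comp (n := n) (μ := volume) (ContinuousLinearMap.mul ℝ ℝ)
    (v := fun _ : P => (0 : E)) contDiffOn_const (f := fun _ => 1) (g := fun q y => w y * G (q, y)) hs hK
    (fun q y _ hy => by rw [h0 y hy, zero_mul]) (locallyIntegrable_const 1) h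
  refine (h1.contDiffAt (hs.mem_nhds hps)).congr_of_eventuallyEq (Filter.Eventually.of_forall fun q => ?_)
  change _ = convolution _ _ _ _ _
  rw [convolution_def, ← integral_sub_left_eq_self _ volume (0 : E)]
  simp

theorem hasDerivAt_integral_mul {w : E → ℝ} {K : Set E} (hK : IsCompact K) (hw : ContDiff ℝ ∞ w)
    (h0 : ∀ y ∉ K, w y = 0) {G : ℝ × E → ℝ} {t : ℝ} (hG : ∀ y ∈ K, ContDiffAt ℝ (1 : ℕ) G (t, y)) :
    HasDerivAt (fun r => ∫ y, w y * G (r, y)) (∫ y, w y * deriv (fun r => G (r, y)) t) t := by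
  obtain ⟨s, hs, hts, h⟩ := exists_contDiffOn_mul hK hw h0 hG
  have hopen : IsOpen (s ×ˢ (Set.univ : Set E)) := hs.prod isOpen_univ
  set H : ℝ × E → ℝ := fun q => w q.2 * G q with hH
  have hHz : ∀ r, ∀ y ∉ K, H (r, y) = 0 := fun r y hy => by rw [hH]; simp [h0 y hy]
  have hd : ∀ r ∈ s, ∀ y, HasDerivAt (fun r => H (r, y)) (fderiv ℝ H (r, y) (1, 0)) r := fun r hr y => by
    have h1 : HasFDerivAt H (fderiv ℝ H (r, y)) (r, y) :=
      ((h.contDiffAt (hopen.mem_nhds ⟨hr, Set.mem_univ y⟩)).differentiableAt (by simp)).hasFDerivAt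
    exact h1.comp_hasDerivAt r ((hasDerivAt_id r).prodMk (hasDerivAt_const r y))
  have hc : ContinuousOn (fun q => fderiv ℝ H q (1, 0)) (s ×ˢ Set.univ) :=
    (h.continuousOn_fderiv_of_isOpen hopen (by simp)).clm_apply continuousOn_const
  have hz : ∀ r ∈ s, ∀ y ∉ K, fderiv ℝ H (r, y) (1, 0) = 0 := fun r hr y hy => by
    have h1 := hd r hr y
    have h2 : (fun r => H (r, y)) = fun _ => 0 := funext fun r => hHz r y hy
    rw [h2] at h1
    exact h1.unique (hasDerivAt_const r 0)
  have slice : ∀ (f : ℝ × E → ℝ) (r : ℝ), r ∈ s → ContinuousOn f (s ×ˢ Set.univ) → Continuous fun y => f (r, y) :=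
    fun f r hr hf => hf.comp_continuous (by fun_prop) fun y => ⟨hr, Set.mem_univ y⟩
  -- The derivative in the parameter is bounded on a compact ball times K and zero for y off K, so a
  -- constant on K is an integrable bound for dominated differentiation.
  obtain ⟨ε, hε, hball⟩ := Metric.nhds_basis_closedBall.mem_iff.1 (hs.mem_nhds hts)
  obtain ⟨C, hC⟩ := ((isCompact_closedBall t ε).prod hK).exists_bound_of_continuousOn
    (hc.mono (Set.prod_mono hball (Set.subset_univ K)))
  have key := hasDerivAt_integral_of_dominated_loc_of_deriv_le (μ := (volume : Measure E)) (x₀ := t)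
    (F := fun r y => H (r, y)) (F' := fun r y => fderiv ℝ H (r, y) (1, 0)) (bound := K.indicator fun _ => C)
    (Metric.closedBall_mem_nhds t hε)
    (Filter.eventually_of_mem (hs.mem_nhds hts) fun r hr => (slice H r hr h.continuousOn).aestronglyMeasurable)
    (integrable_of_support hK (slice H t hts h.continuousOn) (hHz t))
    (slice _ t hts hc).aestronglyMeasurable
    (Filter.Eventually.of_forall fun y r hr => by
      by_cases hy : y ∈ K
      · rw [Set.indicator_of_mem hy]; exact hC (r, y) ⟨hr, hy⟩
      · rw [Set.indicator_of_notMem hy, hz r (hball hr) y hy, norm_zero])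
    ((integrable_indicator_iff hK.measurableSet).2 (integrableOn_const hK.measure_lt_top.ne))
    (Filter.Eventually.of_forall fun y r hr => hd r (hball hr) y)
  have h3 : (fun y => w y * deriv (fun r => G (r, y)) t) = fun y => fderiv ℝ H (t, y) (1, 0) := by
    funext y
    by_cases hy : y ∈ K
    · rw [← (hd t hts y).deriv]
      have h4 : DifferentiableAt ℝ (fun r => G (r, y)) t :=
        ((hG y hy).differentiableAt (by simp)).comp t
          (f := fun r : ℝ => (r, y)) (differentiableAt_id.prodMk (differentiableAt_const y))
      exact (deriv_const_mul (w y) h4).symm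
    · rw [h0 y hy, zero_mul, hz t hts y hy]
  rw [h3]
  exact key.2

end Parameter

/-! ### Derivatives of the functional -/

section Variation

variable {M : Type*} [TopologicalSpace M] [CompactSpace M] [T2Space M] [ChartedSpace E M]
  [IsManifold 𝓘(ℂ, E) ω M]

/-- `λ(Ω)` does not vanish on the supports of the functions of the partition of unity. -/
def LamNeZero (Ω : Form M 3 ℝ) : Prop := ∀ c ∈ charts M, ∀ y ∈ weightSupp c, lam (inChart Ω c y) ≠ 0

theorem contDiffAt_fderiv_phi {ρ : Forms3} (h : lam ρ ≠ 0) : ContDiffAt ℝ ∞ (fderiv ℝ phi) ρ :=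
  (contDiffAt_phi h).fderiv_right (by simp)

theorem contDiffAt_phi_comp {P : Type*} [NormedAddCommGroup P] [NormedSpace ℝ P] {f : P → Forms3} {x : P}
    (hf : ContDiffAt ℝ ∞ f x) (h : lam (f x) ≠ 0) : ContDiffAt ℝ ∞ (fun q => phi (f q)) x :=
  (contDiffAt_phi h).comp x hf

theorem contDiffAt_fderiv_phi_comp {P : Type*} [NormedAddCommGroup P] [NormedSpace ℝ P] {f g : P → Forms3} {x : P}
    (hf : ContDiffAt ℝ ∞ f x) (hg : ContDiffAt ℝ ∞ g x) (h : lam (f x) ≠ 0) :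
    ContDiffAt ℝ ∞ (fun q => fderiv ℝ phi (f q) (g q)) x :=
  ((contDiffAt_fderiv_phi h).comp x hf).clm_apply hg

theorem contDiffAt_family {n : ℕ} {Ω : Form M 3 ℝ} {a : Fin n → Form M 3 ℝ} (hΩ : IsSmooth Ω)
    (ha : ∀ i, IsSmooth (a i)) {c : M} {y : E} (hy : y ∈ (chartAt E c).target) (t : Fin n → ℝ) :
    ContDiffAt ℝ ∞ (fun q : (Fin n → ℝ) × E => inChart (Ω + ∑ i, q.1 i • a i) c q.2) (t, y) := by
  have h : (fun q : (Fin n → ℝ) × E => inChart (Ω + ∑ i, q.1 i • a i) c q.2) =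
      fun q => inChart Ω c q.2 + ∑ i, q.1 i • inChart (a i) c q.2 := by
    funext q
    rw [inChart_add, inChart_sum]
    simp only [inChart_smul]
  rw [h]
  refine ((hΩ.contDiffAt hy).comp (t, y) contDiffAt_snd).add (ContDiffAt.sum fun i _ => ?_)
  exact ContDiffAt.smul (f := fun q : (Fin n → ℝ) × E => q.1 i) (by fun_prop) (((ha i).contDiffAt hy).comp (t, y) contDiffAt_snd)

theorem contDiffAt_Phi {n : ℕ} {Ω : Form M 3 ℝ} {a : Fin n → Form M 3 ℝ} (hΩ : IsSmooth Ω)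
    (ha : ∀ i, IsSmooth (a i)) (hlam : LamNeZero Ω) :
    ContDiffAt ℝ 2 (fun t : Fin n → ℝ => Phi (Ω + ∑ i, t i • a i)) 0 := by
  simp only [Phi_eq_sum]
  refine ContDiffAt.sum fun c hc => ?_
  refine contDiffAt_integral_mul (n := 2) (isCompact_weightSupp c) (contDiff_weight c)
    (fun y hy => weight_eq_zero hy)
    (G := fun q : (Fin n → ℝ) × E => phi (inChart (Ω + ∑ i, q.1 i • a i) c q.2)) fun y hy => ?_
  refine ContDiffAt.of_le (contDiffAt_phi_comp
    (contDiffAt_family hΩ ha (weightSupp_subset c hy) 0) ?_) (WithTop.coe_le_coe.2 (le_top (a := ((2 : ℕ) : ℕ∞))))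
  simpa using hlam c hc y hy

theorem contDiffAt_line {Ω a : Form M 3 ℝ} (hΩ : IsSmooth Ω) (ha : IsSmooth a) {c : M} {y : E}
    (hy : y ∈ (chartAt E c).target) (t : ℝ) :
    ContDiffAt ℝ ∞ (fun q : ℝ × E => inChart (Ω + q.1 • a) c q.2) (t, y) := by
  have h : (fun q : ℝ × E => inChart (Ω + q.1 • a) c q.2) =
      fun q => inChart Ω c q.2 + q.1 • inChart a c q.2 := by
    funext q
    rw [inChart_add, inChart_smul]
  rw [h]
  exact ((hΩ.contDiffAt hy).comp (t, y) contDiffAt_snd).add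
    (contDiffAt_fst.smul ((ha.contDiffAt hy).comp (t, y) contDiffAt_snd))

theorem hasDerivAt_line (Ω a : Form M 3 ℝ) (c : M) (y : E) (t : ℝ) :
    HasDerivAt (fun r : ℝ => inChart (Ω + r • a) c y) (inChart a c y) t := by
  have h : (fun r : ℝ => inChart (Ω + r • a) c y) = fun r => inChart Ω c y + r • inChart a c y := by
    funext q
    rw [inChart_add, inChart_smul]
  rw [h]
  simpa using ((hasDerivAt_id t).smul_const (inChart a c y)).const_add (inChart Ω c y)

/-- The condition λ ≠ 0 is open and is imposed on finitely many compact sets. It is needed near s =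
0 because the inner derivative in `hessian` is taken at Ω + s a. -/
theorem LamNeZero.eventually {Ω a : Form M 3 ℝ} (hlam : LamNeZero Ω) (hΩ : IsSmooth Ω) (ha : IsSmooth a) :
    ∀ᶠ t : ℝ in nhds 0, LamNeZero (Ω + t • a) := by
  simp only [LamNeZero]
  rw [Filter.eventually_all_finset]
  intro c hc
  have h : ∀ y ∈ weightSupp c, ∀ᶠ q : ℝ × E in nhds ((0 : ℝ), y), lam (inChart (Ω + q.1 • a) c q.2) ≠ 0 :=
    fun y hy => by
      refine ContinuousAt.eventually_ne ?_ (by simpa using hlam c hc y hy)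
      exact contDiff_lam.continuous.continuousAt.comp
        (contDiffAt_line hΩ ha (weightSupp_subset c hy) 0).continuousAt
  exact (isCompact_weightSupp c).eventually_forall_of_forall_eventually h

/-- The first variation of the functional. -/
def firstVariation (Ω b : Form M 3 ℝ) : ℝ :=
  ∑ c ∈ charts M, ∫ y, weight c y * fderiv ℝ phi (inChart Ω c y) (inChart b c y)

theorem hasDerivAt_Phi {Ω b : Form M 3 ℝ} (hΩ : IsSmooth Ω) (hb : IsSmooth b) (hlam : LamNeZero Ω) :
    HasDerivAt (fun t : ℝ => Phi (Ω + t • b)) (firstVariation Ω b) 0 := by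
  simp only [Phi_eq_sum]
  refine HasDerivAt.fun_sum fun c hc => ?_
  have h1 := hasDerivAt_integral_mul (isCompact_weightSupp c) (contDiff_weight c) (fun y hy => weight_eq_zero hy)
    (G := fun q : ℝ × E => phi (inChart (Ω + q.1 • b) c q.2)) (t := 0) fun y hy => by
      refine ContDiffAt.of_le (contDiffAt_phi_comp
        (contDiffAt_line hΩ hb (weightSupp_subset c hy) 0) ?_) (by exact_mod_cast le_top)
      simpa using hlam c hc y hy
  refine HasDerivAt.congr_deriv h1 (integral_congr_ae (Filter.Eventually.of_forall fun y => ?_))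
  change weight c y * deriv (fun r => phi (inChart (Ω + r • b) c y)) 0 =
    weight c y * fderiv ℝ phi (inChart Ω c y) (inChart b c y)
  by_cases hy : y ∈ weightSupp c
  · congr 1
    have h2 : HasFDerivAt phi (fderiv ℝ phi (inChart Ω c y)) (inChart (Ω + (0 : ℝ) • b) c y) := by
      rw [zero_smul, add_zero]
      exact ((contDiffAt_phi (hlam c hc y hy)).differentiableAt (by simp)).hasFDerivAt
    exact (h2.comp_hasDerivAt (0 : ℝ) (hasDerivAt_line Ω b c y 0)).deriv
  · rw [weight_eq_zero hy, zero_mul, zero_mul]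

/-- Under the integral, the derivative of dφ(b) along a is D²φ(a, b), which is ω(Ja, b) by `symp_J`.
-/
theorem hasDerivAt_firstVariation {Ω a b : Form M 3 ℝ} (hΩ : IsSmooth Ω) (ha : IsSmooth a) (hb : IsSmooth b)
    (hlam : LamNeZero Ω) :
    HasDerivAt (fun s : ℝ => firstVariation (Ω + s • a) b) (pairInt (formJ Ω a) b) 0 := by
  simp only [firstVariation, pairInt]
  refine HasDerivAt.fun_sum fun c hc => ?_
  have h1 := hasDerivAt_integral_mul (isCompact_weightSupp c) (contDiff_weight c) (fun y hy => weight_eq_zero hy)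
    (G := fun q : ℝ × E => fderiv ℝ phi (inChart (Ω + q.1 • a) c q.2) (inChart b c q.2)) (t := 0) fun y hy => by
      have hy' := weightSupp_subset c hy
      refine ContDiffAt.of_le (contDiffAt_fderiv_phi_comp (contDiffAt_line hΩ ha hy' 0)
        ((hb.contDiffAt hy').comp (0, y) contDiffAt_snd) ?_) (by exact_mod_cast le_top)
      simpa using hlam c hc y hy
  refine HasDerivAt.congr_deriv h1 (integral_congr_ae (Filter.Eventually.of_forall fun y => ?_))
  change weight c y * deriv (fun r => fderiv ℝ phi (inChart (Ω + r • a) c y) (inChart b c y)) 0 =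
    weight c y * symp (inChart (formJ Ω a) c y) (inChart b c y)
  by_cases hy : y ∈ weightSupp c
  · have hl := hlam c hc y hy
    rw [inChart_formJ Ω a (weightSupp_subset c hy), symp_J hl]
    have h2 : HasFDerivAt (fderiv ℝ phi) (fderiv ℝ (fderiv ℝ phi) (inChart Ω c y))
        (inChart (Ω + (0 : ℝ) • a) c y) := by
      rw [zero_smul, add_zero]
      exact ((contDiffAt_fderiv_phi hl).differentiableAt (by simp)).hasFDerivAt
    have h3 := h2.comp_hasDerivAt (0 : ℝ) (hasDerivAt_line Ω a c y 0)
    exact congrArg (weight c y * ·) ((((ContinuousLinearMap.apply ℝ ℝ (inChart b c y)).hasFDerivAt).comp_hasDerivAt (0 : ℝ) h3).deriv)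
  · rw [weight_eq_zero hy, zero_mul, zero_mul]

theorem hessian_eq_pairInt {Ω a b : Form M 3 ℝ} (hΩ : IsSmooth Ω) (ha : IsSmooth a) (hb : IsSmooth b)
    (hlam : LamNeZero Ω) : hessian Ω a b = pairInt (formJ Ω a) b := by
  have h : (fun s : ℝ => deriv (fun t : ℝ => Phi (Ω + s • a + t • b)) 0) =ᶠ[nhds 0]
      fun s => firstVariation (Ω + s • a) b := by
    filter_upwards [hlam.eventually hΩ ha] with s hs
    exact (hasDerivAt_Phi (hΩ.add (ha.smul s)) hb hs).deriv
  rw [hessian, h.deriv_eq]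
  exact (hasDerivAt_firstVariation hΩ ha hb hlam).deriv

end Variation

/-! ### The null space of the Hessian -/

section Orbit

variable {M : Type*} [TopologicalSpace M] [CompactSpace M] [T2Space M] [ChartedSpace E M]
  [IsManifold 𝓘(ℂ, E) ω M] {Ωc : Form M 3 ℂ}

theorem lamNeZero_reForm (h : IsHolomorphicForm Ωc) (hne : ∀ x, Ωc x ≠ 0) : LamNeZero (reForm Ωc) :=
  fun c _ _ hy => lam_inChart_reForm h hne (weightSupp_subset c hy)

/-- The Hessian against b = dφ is the integral of Ja ∧ dφ: Stokes' theorem gives one direction and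
its converse the other. -/
theorem hessian_null_iff (h : IsHolomorphicForm Ωc) (hne : ∀ x, Ωc x ≠ 0) {a : Form M 3 ℝ} (ha : IsSmooth a) :
    (∀ b : Form M 3 ℝ, IsExact b → hessian (reForm Ωc) a b = 0) ↔ d (formJ (reForm Ωc) a) = 0 := by
  have hs := h.isSmooth.reForm
  have hJ : IsSmooth (formJ (reForm Ωc) a) := hs.formJ ha fun c y hy => lam_inChart_reForm h hne hy
  constructor
  · refine fun H => d_eq_zero_of_pairInt hJ fun φ hφ => ?_
    rw [← hessian_eq_pairInt hs ha hφ.d (lamNeZero_reForm h hne)]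
    exact H _ ⟨φ, hφ, rfl⟩
  · rintro H _ ⟨φ, hφ, rfl⟩
    rw [hessian_eq_pairInt hs ha hφ.d (lamNeZero_reForm h hne)]
    exact pairInt_d_eq_zero hJ H hφ

end Orbit

end Hitchin

end

theorem mainTheorem5 {M : Type*} [TopologicalSpace M] [CompactSpace M] [T2Space M]
    [ChartedSpace Hitchin.E M] [IsManifold 𝓘(ℂ, Hitchin.E) ω M]
    (hM : Hitchin.DdbarLemma M)
    (Ωc : Hitchin.Form M 3 ℂ) (hhol : Hitchin.IsHolomorphicForm Ωc) (hne : ∀ x, Ωc x ≠ 0)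
    (Ω : Hitchin.Form M 3 ℝ) (hΩ : Ω = Hitchin.rePart Ωc) :
    (∀ (n : ℕ) (a : Fin n → Hitchin.Form M 3 ℝ), (∀ i, Hitchin.IsExact (a i)) →
      ContDiffAt ℝ 2 (fun t : Fin n → ℝ => Hitchin.Phi (Ω + ∑ i, t i • a i)) 0) ∧
    (∀ a : Hitchin.Form M 3 ℝ,
      (Hitchin.IsExact a ∧ ∀ b : Hitchin.Form M 3 ℝ, Hitchin.IsExact b →
        Hitchin.hessian Ω a b = 0) ↔ Hitchin.TangentToOrbit Ω a) ∧
    (∀ ψ : Hitchin.Form M 2 ℝ, Hitchin.IsSmooth ψ →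
      (Hitchin.d (Hitchin.formJ Ω (Hitchin.d ψ)) = 0 ↔
        Hitchin.TangentToOrbit Ω (Hitchin.d ψ))) := by
  obtain rfl : Ω = Hitchin.reForm Ωc := hΩ
  refine ⟨fun n a ha => ?_, fun a => ?_, fun ψ hψ => Hitchin.d_formJ_d_eq_zero_iff hM hhol hne hψ⟩
  · refine Hitchin.contDiffAt_Phi hhol.isSmooth.reForm (fun i => ?_) (Hitchin.lamNeZero_reForm hhol hne)
    obtain ⟨σ, hσ, h⟩ := ha i
    rw [h]
    exact hσ.d
  · constructor
    · rintro ⟨⟨ψ, hψ, rfl⟩, H⟩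
      exact (Hitchin.d_formJ_d_eq_zero_iff hM hhol hne hψ).1 ((Hitchin.hessian_null_iff hhol hne hψ.d).1 H)
    · intro H
      -- A form tangent to the orbit is d Re ν with ν of type (2,0); this gives its exactness and
      -- the closedness of its image under J.
      obtain ⟨ν, hν, hνt, rfl⟩ := (Hitchin.tangentToOrbit_reForm_iff hhol hne a).1 H
      exact ⟨⟨_, hν.reForm, rfl⟩, (Hitchin.hessian_null_iff hhol hne hν.reForm.d).2
        (hνt.formJ_d hhol hne hν)⟩
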